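/- **Notation.** Let $I=[-1,1]$. For a curve $\gamma:I\to\mathbb R^d$ and a function $a$ on $\mathbb R^d\times I\times I$ set, for $g\in\mathcal S(\mathbb R^{d+1})$, $$\mathcal A[a,\gamma]g(x,s)=\int_I\int_{\mathbb R^d}e^{i\langle x-t\gamma(s),\xi\rangle}a(\xi,s,t)\,\mathcal F_x g(\xi,t)\,d\xi\,dt,\qquad \mathcal F_xg(\xi,t)=\int_{\mathbb R^d}e^{-i\langle x,\xi\rangle}g(x,t)\,dx,$$ and $\mathfrak D_s\mathcal A[a,\gamma]=(1+\sqrt{-\partial_s^2})^{1/2}\mathcal A[a,\gamma]$, where $(1+\sqrt{-\partial_s^2})^{1/2}$ is the Fourier multiplier operator in $s$ with multiplier $(1+|\sigma|)^{1/2}$. For $1\le L\le d$ and $B>0$ let $\mathfrak G(B,L)$ be the class of curves $\gamma\in C^{2d}(I;\mathbb R^d)$ with $\|\gamma\|_{C^{2d}(I)}=\max_{0\le i\le 2d}\sup_I|\gamma^{(i)}|\le B$ and $|\det(\gamma^{(1)}(s),\dots,\gamma^{(L)}(s))|\ge B^{-1}$ for all $s\in I$, where the square of the determinant means the sum of the squares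 of the $L\times L$ minors. Fix constants $C=C(A,B)>1$ and $K_\beta=K_\beta(A)$. For $\lambda\ge2$, $A>0$ and $\gamma\in\mathfrak G(B,L)$, a symbol $a\in C^{3d}(\mathbb R^d\times I\times I)$, complex valued and such that its extension by zero to $s\notin I$ is still of class $C^{3d}$ on $\mathbb R^d\times\mathbb R\times I$, is of type $(\lambda,A,L)$ with respect to $\gamma$ if 1. $C\lambda\le|\xi|\le2C\lambda$ for all $(\xi,s,t)\in\operatorname{supp}a$; 2. $|\partial_s^\beta a(\xi,s,t)|\le K_\beta$ for $0\le\beta\le3d$ and $(\xi,s,t)\in\operatorname{supp}a$; 3. $A^{-1}|\xi|\le\sum_{i=1}^L|\langle\gamma^{(i)}(s),\xi\rangle|\le A|\xi|$ for all $(\xi,s,t)\in\operatorname{supp}a$. **Proposition.** (a) Let $1\le L\le d$, $A,B>0$, $\lambda\ge2$, $\gamma\in\mathfrak G(B,L)$, and let $a$ be a symbol of type $(\lambda,A,L)$ with respect to $\gamma$. Then $\mathfrak D_s\mathcal A[a,\gamma]$ is well defined on $\mathcal S(\mathbb R^{d+1})$ and extends to a bounded operator on $L^2(\mathbb R^{d+1})$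 with $$\|\mathfrak D_s\mathcal A[a,\gamma]\|_{L^2(\mathbb R^{d+1})\to L^2(\mathbb R^{d+1})}\le M\,(\log\lambda)^{(L-1)/2},$$ where $M$ depends only on $A$, $B$, $d$ (and on the choice of the functions $C(A,B)$, $K_\beta(A)$). (b) Let $d\ge1$, and let $\gamma:[-2,2]\to\mathbb R^d$ be $C^\infty$ with $\det(\gamma^{(1)}(s),\dots,\gamma^{(d)}(s))\ne0$ for all $s\in[-2,2]$. Let $\psi,\eta,\beta\in C_c^\infty(\mathbb R)$, with $\psi$ complex valued and $\eta,\beta$ real valued, be supported in $[-1,1]$, in $\{|r|\le2\}$ and in $\{1/2\le|r|\le2\}$ respectively, and let $\tilde\chi\ge0$ be a smooth function equal to $1$ on $I$ and to $0$ outside $[-2,2]$. For $0<\delta<1$ put $a^0_\delta(\xi,s,t)=\psi(\delta|\xi|)\tilde\chi(s)\tilde\chi(t)\eta(|\xi|)$ and, for $\lambda\in\{2,4,8,\dots\}$, $a^\lambda_\delta(\xi,s,t)=\psi(\delta|\xi|)\tilde\chi(s)\tilde\chi(t)\beta(|\xi|/\lambda)$; define $\mathcal A[a^\lambda_\delta,\gamma]$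 by the formula above for $s\in[-2,2]$ and as $0$ for other $s$. Then for all $\lambda\in\{0,2,4,8,\dots\}$ and $0<\delta<1$, $\mathfrak D_s\mathcal A[a^\lambda_\delta,\gamma]$ is well defined on $\mathcal S(\mathbb R^{d+1})$ and extends to a bounded operator on $L^2(\mathbb R^{d+1})$ with $$\|\mathfrak D_s\mathcal A[a^\lambda_\delta,\gamma]\|_{L^2(\mathbb R^{d+1})\to L^2(\mathbb R^{d+1})}\le M'\,(\log(2+\lambda))^{(d-1)/2},$$ where $M'$ depends only on $d$, $\gamma$ and the fixed functions $\psi,\tilde\chi,\eta,\beta$. -/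

import Mathlib

open MeasureTheory Set
open scoped SchwartzMap ContDiff

noncomputable section

namespace NikodymFIO

/-- Euclidean space `ℝ^d`. -/
abbrev E (d : ℕ) : Type := EuclideanSpace ℝ (Fin d)

/-- The interval `I = [-1, 1]`. -/
abbrev I : Set ℝ := Icc (-1) 1

/-- The absolute value of the determinant of the `d × L` matrix with columns `v 0, …, v (L-1)`:
its square is the sum of the squares of all `L × L` minors, the rows of a minor being selected by
an `L`-element subset of the coordinates, in increasing order. -/
def absDet {d L : ℕ} (v : Fin L → E d) : ℝ :=
  Real.sqrt (∑ r : {S : Finset (Fin d) // S.card = L},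
    (Matrix.of fun i j : Fin L => v j (r.1.orderEmbOfFin r.2 i)).det ^ 2)

/-- The class `𝔊(B, L)` of curves `γ : I → ℝ^d` with `‖γ‖_{C^{2d}(I)} ≤ B` and
`|det (γ^{(1)}(s), …, γ^{(L)}(s))| ≥ B⁻¹` on `I` (derivatives are one-sided at the end points). -/
structure IsModelCurve {d : ℕ} (B : ℝ) (L : ℕ) (γ : ℝ → E d) : Prop where
  contDiffOn : ContDiffOn ℝ (2 * d : ℕ) γ I
  norm_le : ∀ i ≤ 2 * d, ∀ s ∈ I, ‖iteratedDerivWithin i γ I s‖ ≤ B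
  le_absDet : ∀ s ∈ I,
    B⁻¹ ≤ absDet (fun j : Fin L => iteratedDerivWithin ((j : ℕ) + 1) γ I s)

/-- The support of a symbol, as a function of `(ξ, s, t) ∈ ℝ^d × I × I`. -/
def symbolSupport {d : ℕ} (a : E d × ℝ × ℝ → ℂ) : Set (E d × ℝ × ℝ) :=
  closure {p | p.2.1 ∈ I ∧ p.2.2 ∈ I ∧ a p ≠ 0}

/-- Symbols of type `(lam, A, L)` with respect to `γ`. The number `C` is the constant of the
frequency support condition and `K β` is the implied constant in the bound for `∂_s^β a`.
The symbol is of class `C^{3d}` in `(ξ, s, t)`, with `t ∈ I`, and remains so when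
it is extended by zero to `s ∉ I`. -/
structure IsSymbolOfType {d : ℕ} (C : ℝ) (K : ℕ → ℝ) (lam A : ℝ) (L : ℕ) (γ : ℝ → E d)
    (a : E d × ℝ × ℝ → ℂ) : Prop where
  contDiffOn : ContDiffOn ℝ (3 * d : ℕ) a (univ ×ˢ univ ×ˢ I)
  eq_zero : ∀ ξ s t, t ∈ I → s ∉ I → a (ξ, s, t) = 0
  freq_supp : ∀ p ∈ symbolSupport a, C * lam ≤ ‖p.1‖ ∧ ‖p.1‖ ≤ 2 * C * lam
  deriv_le : ∀ β ≤ 3 * d, ∀ p ∈ symbolSupport a,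
    ‖iteratedDeriv β (fun s => a (p.1, s, p.2.2)) p.2.1‖ ≤ K β
  nondeg : ∀ p ∈ symbolSupport a,
    A⁻¹ * ‖p.1‖ ≤ ∑ i ∈ Finset.Icc 1 L, |inner ℝ (iteratedDerivWithin i γ I p.2.1) p.1| ∧
    ∑ i ∈ Finset.Icc 1 L, |inner ℝ (iteratedDerivWithin i γ I p.2.1) p.1| ≤ A * ‖p.1‖

/-- The Fourier transform in `x` only: `∫ e^{-i⟨x, ξ⟩} g(x, t) dx`. -/
def fourierX {d : ℕ} (g : E d × ℝ → ℂ) (ξ : E d) (t : ℝ) : ℂ :=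
  ∫ x : E d, Complex.exp (-Complex.I * (inner ℝ x ξ : ℝ)) * g (x, t)

/-- The Fourier integral operator
`𝒜[a, γ] g(x, s) = ∫_I ∫_{ℝ^d} e^{i⟨x - tγ(s), ξ⟩} a(ξ, s, t) (ℱ_x g)(ξ, t) dξ dt`. -/
def avg {d : ℕ} (a : E d × ℝ × ℝ → ℂ) (γ : ℝ → E d) (g : E d × ℝ → ℂ) (x : E d) (s : ℝ) : ℂ :=
  ∫ t in I, ∫ ξ : E d,
    Complex.exp (Complex.I * (inner ℝ (x - t • γ s) ξ : ℝ)) * a (ξ, s, t) * fourierX g ξ t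

/-- The Fourier transform on `ℝ`: `∫ e^{-isσ} f(s) ds`. -/
def fourierS (f : ℝ → ℂ) (σ : ℝ) : ℂ :=
  ∫ s : ℝ, Complex.exp (-Complex.I * (s * σ : ℝ)) * f s

/-- The Fourier transform of `(1 + √(-∂_s²))^{1/2} f`, that is `(1 + |σ|)^{1/2} f̂(σ)`. -/
def halfDerivFourier (f : ℝ → ℂ) (σ : ℝ) : ℂ :=
  (Real.sqrt (1 + |σ|) : ℂ) * fourierS f σ

/-- `(1 + √(-∂_s²))^{1/2} f`, through the Fourier inversion formula. -/
def halfDeriv (f : ℝ → ℂ) (s : ℝ) : ℂ :=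
  (2 * Real.pi : ℂ)⁻¹ *
    ∫ σ : ℝ, Complex.exp (Complex.I * (s * σ : ℝ)) * halfDerivFourier f σ

/-- The operator `(1 + √(-∂_s²))^{1/2} 𝒜[a, γ]`. -/
def halfAvg {d : ℕ} (a : E d × ℝ × ℝ → ℂ) (γ : ℝ → E d) (g : E d × ℝ → ℂ) (p : E d × ℝ) : ℂ :=
  halfDeriv (avg a γ g p.1) p.2

/-- Lebesgue measure on `ℝ^d × ℝ` has temperate growth, so that Schwartz functions are in `L²`. -/
instance instTemperate (d : ℕ) : (volume : Measure (E d × ℝ)).HasTemperateGrowth := by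
  have : (volume : Measure (E d × ℝ)).IsAddHaarMeasure :=
    inferInstanceAs ((volume : Measure (E d)).prod (volume : Measure ℝ)).IsAddHaarMeasure
  infer_instance

/-- `‖(1 + √(-∂_s²))^{1/2} 𝒜[a, γ]‖_{L²(ℝ^{d+1}) → L²(ℝ^{d+1})} ≤ M`: the operator is well defined on
Schwartz functions (the integral defining the half derivative converges absolutely), and it agrees
there with a bounded linear operator on `L²(ℝ^{d+1})` of norm at most `M`. -/
def HalfAvgNormLE {d : ℕ} (a : E d × ℝ × ℝ → ℂ) (γ : ℝ → E d) (M : ℝ) : Prop :=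
  (∀ (g : 𝓢(E d × ℝ, ℂ)) (x : E d), Integrable (halfDerivFourier (avg a γ g x))) ∧
  ∃ T : Lp ℂ 2 (volume : Measure (E d × ℝ)) →L[ℂ] Lp ℂ 2 (volume : Measure (E d × ℝ)),
    ‖T‖ ≤ M ∧ ∀ g : 𝓢(E d × ℝ, ℂ), T (g.toLp 2 volume) =ᵐ[volume] halfAvg a γ g

/-- The symbols `ψ(δ|ξ|) χ(s) χ(t) η(|ξ|)` for `lam = 0` and `ψ(δ|ξ|) χ(s) χ(t) β(|ξ|/lam)` for
`lam ≠ 0`. -/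
def dyadicSymbol {d : ℕ} (ψ : ℝ → ℂ) (χ η β : ℝ → ℝ) (δ lam : ℝ) (p : E d × ℝ × ℝ) : ℂ :=
  ψ (δ * ‖p.1‖) * χ p.2.1 * χ p.2.2 *
    (if lam = 0 then (η ‖p.1‖ : ℂ) else (β (‖p.1‖ / lam) : ℂ))

end NikodymFIO

end

/-! The estimate is one-dimensional. Plancherel in `x`, applied at fixed `s` and to differences of
two values of `s`, replaces `avg a γ g` by the oscillatory integrals `H(s) = ∫_I e^{-itφ(s)} b(s,t)
f(t) dt` with `φ(s) = ⟨γ(s), ξ⟩`, one for each frequency `ξ` (`lintegral_avg_add_gagliardo_le`). It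
remains to bound `H` in `H^{1/2}` by `f` in `L²(I)`, uniformly in `ξ`, with squared constant `O(1 +
(L-1) log λ)` (`PhaseCover.lintegral_add_gagliardo_le`).

The `H^{1/2}` norm is controlled by the `L²` norm and the Gagliardo seminorm. For any positive
`1`-Lipschitz function `r`, splitting the increments of `H` at distance `r/2` bounds the squared
seminorm by a multiple of `∫|H|²/r + ∫|H'|² r` (`gagliardo_le`). The natural choice `1/(1+|φ'|)`
need not be `1`-Lipschitz, so `r` is its largest `1`-Lipschitz minorant, `scale`.

Two bounds on `H` are available. Cauchy–Schwarz gives `|H|² ≲ ‖f‖²` pointwise. The substitution `y =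
φ(s)`, which is finitely-many-to-one on the relevant intervals, followed by Plancherel in `t`, gives
`∫|H|²|φ'| ≲ ‖f‖²` (`PhaseCover.lintegral_oscInt_le`). Since `H' = P - iφ'Q` with `P` and `Q` of the
same type and `r ≤ 1/(1+|φ'|)`, these bounds settle `∫|H'|² r`.

For `∫|H|²/r` they suffice where `1/r ≲ 1+|φ'|` or `r` is bounded below. Any other point lies within
`2^{-m}` of a point where `1+|φ'| = 2^m`, with `1/r ≲ 2^m` (`PhaseCover.exists_level`). By
nondegeneracy, boundedly many intervals cover the support so that on each of them one derivative of
order at most `L` is large (`exists_phaseCover`). If the order is `1`, then `φ'` has essentially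
constant size and no such point occurs; otherwise Rolle's theorem leaves at most `L-1` points on
each level of `φ'`. Each `m` therefore contributes `O(L-1)` to the integral of `1/r` over the
exceptional points, and there are `O(log λ)` values of `m` (`PhaseCover.exists_weight`). The
resulting factor `log λ` is absorbed by `(log λ)^{L-1}` if `L ≥ 2` and is absent if `L = 1`
(`Admissible.exists_const`).

Two integrations by parts in `s` make the half derivative an absolutely convergent integral, and
density of Schwartz functions gives the extension to `L²`. Both parts of the proposition are
instances of `Admissible.halfAvgNormLE`. -/

noncomputable section

namespace NikodymFIO

/-! ### Plancherel's theorem for explicit Fourier integrals -/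

section Plancherel

open FourierTransform

variable {V : Type*} [NormedAddCommGroup V] [InnerProductSpace ℝ V] [FiniteDimensional ℝ V]
  [MeasurableSpace V] [BorelSpace V]

/-- The Fourier integral of an integrable and square integrable function represents its
`L²` Fourier transform. -/
theorem fourier_ae_eq_fourier_toLp {f : V → ℂ} (hf : Integrable f) (hf2 : MemLp f 2) :
    (𝓕 f : V → ℂ) =ᵐ[volume] (𝓕 (hf2.toLp f) : Lp ℂ 2 (volume : Measure V)) := by
  have hcont : Continuous (𝓕 f) := VectorFourier.fourierIntegral_continuous
    Real.continuous_fourierChar continuous_inner hf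
  -- Both sides are tested against smooth compactly supported functions. For the integral the
  -- multiplication formula applies; for the `L²` transform, its compatibility with the transform of
  -- tempered distributions.
  refine ae_eq_of_integral_contDiff_smul_eq hcont.locallyIntegrable
    ((Lp.memLp _).locallyIntegrable one_le_two) fun g hg hgs => ?_
  have hg' : ContDiff ℝ ∞ (fun x => (g x : ℂ)) := Complex.ofRealCLM.contDiff.comp hg
  have hgs' : HasCompactSupport (fun x => (g x : ℂ)) :=
    hgs.comp_left (g := fun r : ℝ => (r : ℂ)) Complex.ofReal_zero
  set u : 𝓢(V, ℂ) := hgs'.toSchwartzMap hg' with hu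
  have hux : ∀ x, u x = (g x : ℂ) := fun x => rfl
  have h1 : ∫ x, u x • (𝓕 f) x = ∫ x, (𝓕 u) x • f x := by
    have := VectorFourier.integral_fourierIntegral_smul_eq_flip (e := Real.fourierChar)
      (μ := (volume : Measure V)) (ν := (volume : Measure V)) (L := innerₗ V)
      (f := u) (g := f) Real.continuous_fourierChar continuous_inner u.integrable hf
    rw [flip_innerₗ] at this
    exact this.symm
  have h2 : ∫ x, u x • (𝓕 (hf2.toLp f) : Lp ℂ 2 (volume : Measure V)) x
      = ∫ x, (𝓕 u) x • f x := by
    have := congrArg (fun T => T u) (Lp.fourier_toTemperedDistribution_eq (hf2.toLp f))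
    simp only [TemperedDistribution.fourier_apply, Lp.toTemperedDistribution_apply] at this
    rw [← this]
    refine integral_congr_ae ?_
    filter_upwards [hf2.coeFn_toLp] with x hx
    rw [hx]
  simpa [hux] using h1.trans h2.symm

theorem lintegral_enorm_sq_eq {α : Type*} [MeasurableSpace α] (μ : Measure α) (g : α → ℂ) :
    ∫⁻ x, ‖g x‖ₑ ^ 2 ∂μ = eLpNorm g 2 μ ^ 2 := by
  rw [eLpNorm_eq_lintegral_rpow_enorm_toReal (by norm_num) (by norm_num)]
  rw [← ENNReal.rpow_natCast, ← ENNReal.rpow_mul]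
  simp

theorem lintegral_enorm_sq_fourier {f : V → ℂ} (hf : Integrable f) (hf2 : MemLp f 2) :
    ∫⁻ ξ, ‖𝓕 f ξ‖ₑ ^ 2 = ∫⁻ x, ‖f x‖ₑ ^ 2 := by
  rw [lintegral_enorm_sq_eq, lintegral_enorm_sq_eq, eLpNorm_congr_ae (fourier_ae_eq_fourier_toLp hf hf2)]
  have h := congrArg ENNReal.ofReal (Lp.norm_fourier_eq (hf2.toLp f))
  rw [Lp.norm_def, Lp.norm_def, ENNReal.ofReal_toReal (Lp.eLpNorm_ne_top _),
    ENNReal.ofReal_toReal (Lp.eLpNorm_ne_top _), eLpNorm_congr_ae hf2.coeFn_toLp] at h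
  rw [h]

theorem lintegral_comp_inv_smul (G : V → ENNReal) {R : ℝ} (hR : 0 < R) :
    ∫⁻ x, G (R⁻¹ • x) = ENNReal.ofReal (R ^ Module.finrank ℝ V) * ∫⁻ x, G x := by
  have h : ∫⁻ y, G y ∂(Measure.map (fun x : V => R⁻¹ • x) volume) = ∫⁻ x, G (R⁻¹ • x) :=
    (Homeomorph.smulOfNeZero (α := V) R⁻¹ (inv_ne_zero hR.ne')).measurableEmbedding.lintegral_map G
  rw [← h, Measure.map_addHaar_smul (volume : Measure V) (inv_ne_zero hR.ne'),
    lintegral_smul_measure]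
  congr 2
  rw [inv_pow, inv_inv, abs_of_pos (by positivity)]

theorem lintegral_enorm_sq_integral_exp_neg {f : V → ℂ} (hf : Integrable f) (hf2 : MemLp f 2) :
    ∫⁻ ξ, ‖∫ x, Complex.exp (-Complex.I * (inner ℝ x ξ : ℝ)) * f x‖ₑ ^ 2 =
      ENNReal.ofReal ((2 * Real.pi) ^ Module.finrank ℝ V) * ∫⁻ x, ‖f x‖ₑ ^ 2 := by
  rw [← lintegral_enorm_sq_fourier hf hf2, ← lintegral_comp_inv_smul _ Real.two_pi_pos]
  refine lintegral_congr fun ξ => ?_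
  congr 2
  rw [Real.fourier_eq']
  refine integral_congr_ae (.of_forall fun x => ?_)
  simp only [inner_smul_right, smul_eq_mul]
  congr 2
  push_cast
  have : (Real.pi : ℂ) ≠ 0 := by exact_mod_cast Real.pi_ne_zero
  field_simp

theorem lintegral_enorm_sq_integral_exp {f : V → ℂ} (hf : Integrable f) (hf2 : MemLp f 2) :
    ∫⁻ ξ, ‖∫ x, Complex.exp (Complex.I * (inner ℝ ξ x : ℝ)) * f x‖ₑ ^ 2 =
      ENNReal.ofReal ((2 * Real.pi) ^ Module.finrank ℝ V) * ∫⁻ x, ‖f x‖ₑ ^ 2 := by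
  rw [← lintegral_enorm_sq_integral_exp_neg hf hf2, 
    ← lintegral_neg_eq_self]
  refine lintegral_congr fun ξ => ?_
  congr 2
  refine integral_congr_ae (.of_forall fun x => ?_)
  simp only [inner_neg_left, real_inner_comm]
  congr 2
  push_cast
  ring

/-- Plancherel's theorem on the line, in the normalization `∫ e^{-isσ} f(s) ds`. -/
theorem lintegral_enorm_sq_fourierS {f : ℝ → ℂ} (hf : Integrable f) (hf2 : MemLp f 2) :
    ∫⁻ σ, ‖fourierS f σ‖ₑ ^ 2 = ENNReal.ofReal (2 * Real.pi) * ∫⁻ s, ‖f s‖ₑ ^ 2 := by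
  have h := lintegral_enorm_sq_integral_exp_neg hf hf2
  simp only [Module.finrank_self, pow_one] at h
  rw [← h]
  refine lintegral_congr fun ξ => ?_
  simp only [fourierS, RCLike.inner_apply, conj_trivial, mul_comm ξ]

end Plancherel

/-! ### The half-order Sobolev norm through differences -/

open ENNReal in
/-- The Cauchy–Schwarz inequality against the constant function `1`. -/
theorem sq_lintegral_le {α : Type*} [MeasurableSpace α] (μ : Measure α) {f : α → ℝ≥0∞}
    (hf : AEMeasurable f μ) : (∫⁻ x, f x ∂μ) ^ 2 ≤ μ univ * ∫⁻ x, f x ^ 2 ∂μ := by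
  have h := ENNReal.lintegral_mul_le_Lp_mul_Lq μ (p := 2) (q := 2)
    Real.HolderConjugate.two_two (f := fun _ => 1) (g := f) aemeasurable_const hf
  simp only [Pi.mul_apply, one_mul, ENNReal.one_rpow, lintegral_one] at h
  refine (pow_le_pow_left' h 2).trans ?_
  rw [mul_pow, ← ENNReal.rpow_natCast, ← ENNReal.rpow_natCast, ← ENNReal.rpow_mul,
    ← ENNReal.rpow_mul]
  simp

theorem lintegral_Ioi_inv_sq {c : ℝ} (hc : 0 < c) :
    ∫⁻ u in Ioi c, ENNReal.ofReal ((u ^ 2)⁻¹) = ENNReal.ofReal c⁻¹ := by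
  have h1 := integrableOn_Ioi_rpow_of_lt (a := -2) (by norm_num) hc
  have h2 := integral_Ioi_rpow_of_lt (a := -2) (by norm_num) hc
  have h3 : ∀ u ∈ Ioi c, (u ^ 2)⁻¹ = u ^ (-2 : ℝ) := fun u hu => by
    rw [Real.rpow_neg (hc.trans hu).le]; norm_cast
  rw [setLIntegral_congr_fun measurableSet_Ioi (fun u hu => by rw [h3 u hu]),
    ← ofReal_integral_eq_lintegral_ofReal h1, h2]
  · congr 1
    norm_num [Real.rpow_neg_one]
  · filter_upwards [ae_restrict_mem measurableSet_Ioi] with u hu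
    exact Real.rpow_nonneg (hc.trans hu).le _

/-- The square of the Gagliardo seminorm of order `1/2`, over ordered pairs of points. -/
def gagliardo (h : ℝ → ℂ) : ENNReal :=
  ∫⁻ u in Ioi (0 : ℝ), ∫⁻ s : ℝ, ‖h (s + u) - h s‖ₑ ^ 2 * ENNReal.ofReal ((u ^ 2)⁻¹)

theorem continuous_fourierS {h : ℝ → ℂ} (hh : Integrable h) : Continuous (fourierS h) := by
  refine continuous_of_dominated (bound := fun s => ‖h s‖) (fun σ => ?_) (fun σ => ?_) hh.norm ?_
  · exact (Continuous.aestronglyMeasurable (by fun_prop)).mul hh.aestronglyMeasurable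
  · refine .of_forall fun s => ?_
    rw [norm_mul, show -Complex.I * ((s * σ : ℝ) : ℂ) = ((-(s * σ) : ℝ) : ℂ) * Complex.I by
      push_cast; ring, Complex.norm_exp_ofReal_mul_I, one_mul]
  · exact .of_forall fun s => by fun_prop

theorem fourierS_sub_translate {h : ℝ → ℂ} (hh : Integrable h) (u σ : ℝ) :
    fourierS (fun s => h (s + u) - h s) σ =
      (Complex.exp (Complex.I * (u * σ : ℝ)) - 1) * fourierS h σ := by
  have hi : ∀ {f : ℝ → ℂ}, Integrable f →
      Integrable (fun s : ℝ => Complex.exp (-Complex.I * (s * σ : ℝ)) * f s) := fun {f} hf => by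
    refine hf.bdd_mul (c := 1) (Continuous.aestronglyMeasurable (by fun_prop))
      (.of_forall fun s => ?_)
    rw [show -Complex.I * ((s * σ : ℝ) : ℂ) = ((-(s * σ) : ℝ) : ℂ) * Complex.I by
      push_cast; ring, Complex.norm_exp_ofReal_mul_I]
  have h1 := hi (hh.comp_add_right u)
  have h2 := hi hh
  simp only [fourierS, mul_sub, sub_mul, one_mul]
  rw [integral_sub h1 h2]
  congr 1
  rw [← integral_const_mul,
    ← integral_add_right_eq_self (fun s => Complex.exp (Complex.I * ((u * σ : ℝ) : ℂ)) *
      (Complex.exp (-Complex.I * (s * σ : ℝ)) * h s)) u]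
  refine integral_congr_ae (.of_forall fun s => ?_)
  simp only []
  rw [← mul_assoc, ← Complex.exp_add]
  congr 2
  push_cast
  ring

/-- By scaling the integral is a multiple of `|σ|`. Only the range `u ≤ 1/|σ|` is kept, where the
integrand is at least `σ²/4`. This turns the multiplier `|σ|` into an average of squared
differences. -/
theorem le_lintegral_exp_sub_one (σ : ℝ) : ENNReal.ofReal |σ| ≤
    4 * ∫⁻ u in Ioi (0 : ℝ), ‖Complex.exp (Complex.I * (u * σ : ℝ)) - 1‖ₑ ^ 2 *
      ENNReal.ofReal ((u ^ 2)⁻¹) := by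
  rcases eq_or_ne σ 0 with rfl | hσ
  · simp
  have hσ' : 0 < |σ| := abs_pos.2 hσ
  have key : ∀ u ∈ Ioc (0 : ℝ) |σ|⁻¹, ENNReal.ofReal (σ ^ 2 / 4) ≤
      ‖Complex.exp (Complex.I * (u * σ : ℝ)) - 1‖ₑ ^ 2 * ENNReal.ofReal ((u ^ 2)⁻¹) := by
    intro u hu
    have hu0 : 0 < u := hu.1
    rw [← ofReal_norm, ← ENNReal.ofReal_pow (norm_nonneg _),
      ← ENNReal.ofReal_mul (by positivity)]
    refine ENNReal.ofReal_le_ofReal ?_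
    rw [Complex.norm_exp_I_mul_ofReal_sub_one, Real.norm_eq_abs, sq_abs]
    have h1 : u * |σ| ≤ 1 := by
      have := mul_le_mul_of_nonneg_right hu.2 hσ'.le
      rwa [inv_mul_cancel₀ hσ'.ne'] at this
    -- Jordan's inequality, with its slope `2/π` then weakened to `1/2`.
    have h2 := Real.mul_le_sin (x := u * |σ| / 2) (by positivity)
      (by linarith [Real.pi_gt_three])
    have h3 : (1 / 2) * (u * |σ| / 2) ≤ Real.sin (u * |σ| / 2) := by
      refine le_trans (mul_le_mul_of_nonneg_right ?_ (by positivity)) h2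
      rw [div_le_div_iff₀ two_pos Real.pi_pos]
      linarith [Real.pi_lt_four]
    have h4 : Real.sin (u * σ / 2) ^ 2 = Real.sin (u * |σ| / 2) ^ 2 := by
      rcases abs_cases σ with ⟨h, _⟩ | ⟨h, _⟩ <;> rw [h]
      rw [show u * -σ / 2 = -(u * σ / 2) by ring, Real.sin_neg, neg_sq]
    rw [mul_pow, h4, ← div_eq_mul_inv, le_div_iff₀ (by positivity)]
    have h5 : ((1 / 2) * (u * |σ| / 2)) ^ 2 ≤ Real.sin (u * |σ| / 2) ^ 2 :=
      pow_le_pow_left₀ (by positivity) h3 2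
    have h6 : |σ| ^ 2 = σ ^ 2 := sq_abs σ
    nlinarith
  calc ENNReal.ofReal |σ| = 4 * ∫⁻ _ in Ioc (0 : ℝ) |σ|⁻¹, ENNReal.ofReal (σ ^ 2 / 4) := by
        rw [setLIntegral_const, Real.volume_Ioc, ← ENNReal.ofReal_mul (by positivity),
          show (4 : ENNReal) = ENNReal.ofReal 4 by norm_num, ← ENNReal.ofReal_mul (by positivity)]
        congr 1
        rw [← sq_abs σ]
        field_simp
        ring
    _ ≤ _ := by
        refine mul_le_mul_right ((setLIntegral_mono' measurableSet_Ioc key).trans ?_) _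
        exact lintegral_mono_set Ioc_subset_Ioi_self

/-- The `H^{1/2}` norm is controlled by the `L²` norm and the Gagliardo seminorm. -/
theorem lintegral_halfDerivFourier_sq_le {h : ℝ → ℂ} (hh : Integrable h) (hh2 : MemLp h 2) :
    ∫⁻ σ, ‖halfDerivFourier h σ‖ₑ ^ 2 ≤
      ENNReal.ofReal (2 * Real.pi) * ((∫⁻ s, ‖h s‖ₑ ^ 2) + 4 * gagliardo h) := by
  have hF := continuous_fourierS hh
  have h1 : ∀ σ, ‖halfDerivFourier h σ‖ₑ ^ 2 =
      ‖fourierS h σ‖ₑ ^ 2 + ENNReal.ofReal |σ| * ‖fourierS h σ‖ₑ ^ 2 := by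
    intro σ
    rw [halfDerivFourier, enorm_mul, mul_pow, ← ofReal_norm (Complex.ofReal _),
      Complex.norm_real, Real.norm_of_nonneg (Real.sqrt_nonneg _),
      ← ENNReal.ofReal_pow (Real.sqrt_nonneg _), Real.sq_sqrt (by positivity),
      ENNReal.ofReal_add zero_le_one (abs_nonneg _), ENNReal.ofReal_one, add_mul, one_mul]
  simp only [h1]
  rw [lintegral_add_left (by fun_prop), lintegral_enorm_sq_fourierS hh hh2, mul_add]
  gcongr
  calc ∫⁻ σ, ENNReal.ofReal |σ| * ‖fourierS h σ‖ₑ ^ 2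
      ≤ ∫⁻ σ, ∫⁻ u in Ioi (0 : ℝ), 4 * (‖(Complex.exp (Complex.I * (u * σ : ℝ)) - 1) *
          fourierS h σ‖ₑ ^ 2 * ENNReal.ofReal ((u ^ 2)⁻¹)) := by
        refine lintegral_mono fun σ => ?_
        refine (mul_le_mul_left (le_lintegral_exp_sub_one σ) _).trans_eq ?_
        rw [← lintegral_const_mul _ (by fun_prop), ← lintegral_mul_const _ (by fun_prop)]
        refine lintegral_congr fun u => ?_
        rw [enorm_mul, mul_pow]
        ring
    _ = ∫⁻ u in Ioi (0 : ℝ), ∫⁻ σ, 4 * (‖(Complex.exp (Complex.I * (u * σ : ℝ)) - 1) *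
          fourierS h σ‖ₑ ^ 2 * ENNReal.ofReal ((u ^ 2)⁻¹)) :=
        lintegral_lintegral_swap (Measurable.aemeasurable (by fun_prop))
    _ = ENNReal.ofReal (2 * Real.pi) * (4 * gagliardo h) := by
        have h2 : ∀ u : ℝ, ∫⁻ σ, 4 * (‖(Complex.exp (Complex.I * (u * σ : ℝ)) - 1) *
            fourierS h σ‖ₑ ^ 2 * ENNReal.ofReal ((u ^ 2)⁻¹)) = (ENNReal.ofReal (2 * Real.pi) * 4) *
            ∫⁻ s : ℝ, ‖h (s + u) - h s‖ₑ ^ 2 * ENNReal.ofReal ((u ^ 2)⁻¹) := by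
          intro u
          have h3 := (hh.comp_add_right u).sub hh
          have h4 : MemLp (fun s => h (s + u) - h s) 2 :=
            (hh2.comp_measurePreserving (measurePreserving_add_right volume u)).sub hh2
          have h5 := lintegral_enorm_sq_fourierS h3 h4
          simp only [Pi.sub_apply] at h5
          change ∫⁻ σ, ‖fourierS (fun s => h (s + u) - h s) σ‖ₑ ^ 2 = _ at h5
          simp only [fourierS_sub_translate hh] at h5
          rw [lintegral_const_mul _ (by fun_prop), lintegral_mul_const _ (by fun_prop), h5,
            lintegral_mul_const'' _ (h4.1.enorm.pow_const 2)]
          ring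
        simp only [h2]
        rw [lintegral_const_mul' _ _ (ENNReal.mul_ne_top ENNReal.ofReal_ne_top (by simp)),
          gagliardo, mul_assoc]

theorem enorm_sub_sq_le (z w : ℂ) : ‖z - w‖ₑ ^ 2 ≤ 2 * ‖w‖ₑ ^ 2 + 2 * ‖z‖ₑ ^ 2 := by
  simp only [← ofReal_norm]
  rw [← ENNReal.ofReal_pow (norm_nonneg _), ← ENNReal.ofReal_pow (norm_nonneg _),
    ← ENNReal.ofReal_pow (norm_nonneg _), show (2 : ENNReal) = ENNReal.ofReal 2 by norm_num,
    ← ENNReal.ofReal_mul zero_le_two, ← ENNReal.ofReal_mul zero_le_two,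
    ← ENNReal.ofReal_add (by positivity) (by positivity)]
  refine ENNReal.ofReal_le_ofReal ?_
  have := norm_sub_le z w
  nlinarith [sq_nonneg (‖z‖ - ‖w‖), norm_nonneg (z - w), norm_nonneg z, norm_nonneg w]

/-- Cauchy–Schwarz over an interval of length `u` cancels one of the two powers of `u⁻¹`; after
translation the domain of integration no longer depends on `s`. -/
theorem enorm_sub_sq_le_lintegral {h k : ℝ → ℂ} (km : Measurable k) {s u : ℝ} (hu : 0 < u)
    (hk : ‖h (s + u) - h s‖ₑ ≤ ∫⁻ v in Ioc s (s + u), ‖k v‖ₑ) :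
    ‖h (s + u) - h s‖ₑ ^ 2 * ENNReal.ofReal ((u ^ 2)⁻¹) ≤
      ENNReal.ofReal u⁻¹ * ∫⁻ w in Ioc 0 u, ‖k (s + w)‖ₑ ^ 2 := by
  have h1 : ‖h (s + u) - h s‖ₑ ^ 2 ≤ ENNReal.ofReal u * ∫⁻ w in Ioc 0 u, ‖k (s + w)‖ₑ ^ 2 := by
    refine (pow_le_pow_left' hk 2).trans ?_
    refine (sq_lintegral_le _ (by fun_prop)).trans_eq ?_
    rw [Measure.restrict_apply_univ, Real.volume_Ioc, add_sub_cancel_left]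
    congr 1
    rw [← lintegral_indicator measurableSet_Ioc, ← lintegral_indicator measurableSet_Ioc,
      ← lintegral_add_left_eq_self _ s]
    refine lintegral_congr fun w => ?_
    simp [indicator, mem_Ioc]
  refine (mul_le_mul_left h1 _).trans_eq ?_
  rw [mul_right_comm, ← ENNReal.ofReal_mul hu.le]
  congr 2
  field_simp

/-- If `r` is a positive `1`-Lipschitz scale function and `k` dominates the derivative of `h`, then
the Gagliardo seminorm of `h` is controlled by the norms of `h` in `L²(1/r)` and `k` in `L²(r)`. -/
theorem gagliardo_le {h k : ℝ → ℂ} (hm : Measurable h) (km : Measurable k) {r : ℝ → ℝ}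
    (hr0 : ∀ s, 0 < r s) (hr : ∀ s s', |r s - r s'| ≤ |s - s'|)
    (hk : ∀ s u, 0 < u → ‖h (s + u) - h s‖ₑ ≤ ∫⁻ v in Ioc s (s + u), ‖k v‖ₑ) :
    gagliardo h ≤ 10 * (∫⁻ s, ‖h s‖ₑ ^ 2 * ENNReal.ofReal (r s)⁻¹) +
      ∫⁻ s, ‖k s‖ₑ ^ 2 * ENNReal.ofReal (r s) := by
  have rc : Continuous r := by
    refine (LipschitzWith.of_dist_le_mul (K := 1) fun s s' => ?_).continuous
    simpa [Real.dist_eq] using hr s s'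
  have rm : Measurable r := rc.measurable
  set w : ℝ → ℝ → ENNReal := fun c u => {u : ℝ | c < u}.indicator
    (fun u => ENNReal.ofReal ((u ^ 2)⁻¹)) u with hw
  have wm : ∀ f : ℝ → ℝ, Measurable f → Measurable fun p : ℝ × ℝ => w (f p.2) p.1 := by
    intro f hf
    have : MeasurableSet {p : ℝ × ℝ | f p.2 < p.1} :=
      measurableSet_lt (by fun_prop) (by fun_prop)
    have h2 : (fun p : ℝ × ℝ => w (f p.2) p.1) =
        {p : ℝ × ℝ | f p.2 < p.1}.indicator (fun p => ENNReal.ofReal ((p.1 ^ 2)⁻¹)) := by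
      ext p; simp [hw, indicator]
    rw [h2]
    exact Measurable.indicator (by fun_prop) this
  have wint : ∀ c, 0 < c → ∫⁻ u in Ioi (0 : ℝ), w c u = ENNReal.ofReal c⁻¹ := by
    intro c hc
    rw [← lintegral_Ioi_inv_sq hc, hw]
    simp only []
    rw [show {u : ℝ | c < u} = Ioi c from rfl, lintegral_indicator measurableSet_Ioi,
      Measure.restrict_restrict measurableSet_Ioi, inter_eq_left.2 (Ioi_subset_Ioi hc.le)]
  set q : ℝ → ℝ → ENNReal := fun u s => {s : ℝ | u ≤ r s}.indicator (fun s => ‖k s‖ₑ ^ 2) s with hq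
  have qm : Measurable fun p : ℝ × ℝ => q p.1 p.2 := by
    have : MeasurableSet {p : ℝ × ℝ | p.1 ≤ r p.2} :=
      measurableSet_le (by fun_prop) (by fun_prop)
    have h2 : (fun p : ℝ × ℝ => q p.1 p.2) =
        {p : ℝ × ℝ | p.1 ≤ r p.2}.indicator (fun p => ‖k p.2‖ₑ ^ 2) := by
      ext p; simp [hq, indicator]
    rw [h2]
    exact Measurable.indicator (by fun_prop) this
  have wm2 := wm (fun s => r s / 2) (by fun_prop)
  have wm3 := wm (fun s => r s / 3) (by fun_prop)
  have hm2 : Measurable fun p : ℝ × ℝ => 2 * ‖h p.2‖ₑ ^ 2 := by fun_prop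
  -- the pointwise splitting into two far parts and one near part
  have key : ∀ u ∈ Ioi (0 : ℝ), ∀ s, ‖h (s + u) - h s‖ₑ ^ 2 * ENNReal.ofReal ((u ^ 2)⁻¹) ≤
      2 * ‖h s‖ₑ ^ 2 * w (r s / 2) u + 2 * ‖h (s + u)‖ₑ ^ 2 * w (r (s + u) / 3) u +
        ENNReal.ofReal u⁻¹ * ∫⁻ v in Ioc 0 u, q u (s + v) := by
    intro u hu s
    have hu0 : 0 < u := hu
    -- The threshold `r(s)/2` leaves room for the Lipschitz bound: if `u > r(s)/2` then `r(s+u) ≤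
    -- r(s) + u < 3u`, while if `u ≤ r(s)/2` then `r(s+v) ≥ 2u - v ≥ u` for all `0 < v ≤ u`.
    rcases lt_or_ge (r s / 2) u with hfar | hnear
    · have h1 : r (s + u) / 3 < u := by
        have := (abs_le.1 (hr (s + u) s)).2
        rw [add_sub_cancel_left, abs_of_pos hu0] at this
        linarith
      refine le_trans ?_ le_self_add
      simp only [hw, indicator, mem_ofPred_eq, hfar, h1, if_true, ← add_mul]
      exact mul_le_mul_left (enorm_sub_sq_le _ _) _
    · refine le_trans ?_ le_add_self
      refine (enorm_sub_sq_le_lintegral km hu0 (hk s u hu0)).trans ?_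
      refine mul_le_mul_right (setLIntegral_mono' measurableSet_Ioc fun v hv => ?_) _
      have h1 : u ≤ r (s + v) := by
        have := (abs_le.1 (hr (s + v) s)).1
        rw [add_sub_cancel_left, abs_of_pos hv.1] at this
        linarith [hv.2]
      simp [hq, indicator, h1]
  calc gagliardo h ≤ ∫⁻ u in Ioi (0 : ℝ), ∫⁻ s : ℝ, (2 * ‖h s‖ₑ ^ 2 * w (r s / 2) u +
        2 * ‖h (s + u)‖ₑ ^ 2 * w (r (s + u) / 3) u +
        ENNReal.ofReal u⁻¹ * ∫⁻ v in Ioc 0 u, q u (s + v)) :=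
        setLIntegral_mono' measurableSet_Ioi fun u hu => lintegral_mono fun s => key u hu s
    _ = ∫⁻ u in Ioi (0 : ℝ), ((∫⁻ s : ℝ, 2 * ‖h s‖ₑ ^ 2 * w (r s / 2) u) +
        (∫⁻ s : ℝ, 2 * ‖h s‖ₑ ^ 2 * w (r s / 3) u) + ∫⁻ s, q u s) := by
        refine setLIntegral_congr_fun measurableSet_Ioi fun u hu => ?_
        have hu0 : 0 < u := hu
        have m1 : Measurable fun s => w (r s / 2) u := wm2.comp measurable_prodMk_left
        have m2 : Measurable fun s => w (r s / 3) u := wm3.comp measurable_prodMk_left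
        have m3 : Measurable fun s => w (r (s + u) / 3) u := m2.comp (measurable_add_const u)
        have m4 : Measurable (q u) := qm.comp measurable_prodMk_left
        have m5 : Measurable fun s => 2 * ‖h s‖ₑ ^ 2 * w (r s / 2) u :=
          (by fun_prop : Measurable fun s => 2 * ‖h s‖ₑ ^ 2).mul m1
        have m6 : Measurable fun s => 2 * ‖h (s + u)‖ₑ ^ 2 * w (r (s + u) / 3) u :=
          (by fun_prop : Measurable fun s => 2 * ‖h (s + u)‖ₑ ^ 2).mul m3
        rw [lintegral_add_left (by exact m5.add m6), lintegral_add_left m5]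
        congr 1
        · congr 1
          exact lintegral_add_right_eq_self (fun s => 2 * ‖h s‖ₑ ^ 2 * w (r s / 3) u) u
        · rw [lintegral_const_mul _ (Measurable.lintegral_prod_right' (f := fun p : ℝ × ℝ =>
            q u (p.1 + p.2)) (by fun_prop)),
            lintegral_lintegral_swap (Measurable.aemeasurable (by fun_prop))]
          simp only [lintegral_add_right_eq_self (q u)]
          rw [setLIntegral_const, Real.volume_Ioc, sub_zero, mul_comm, mul_assoc,
            ← ENNReal.ofReal_mul hu0.le, mul_inv_cancel₀ hu0.ne', ENNReal.ofReal_one, mul_one]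
    _ = (∫⁻ u in Ioi (0 : ℝ), ∫⁻ s : ℝ, 2 * ‖h s‖ₑ ^ 2 * w (r s / 2) u) +
        (∫⁻ u in Ioi (0 : ℝ), ∫⁻ s : ℝ, 2 * ‖h s‖ₑ ^ 2 * w (r s / 3) u) +
          ∫⁻ u in Ioi (0 : ℝ), ∫⁻ s, q u s := by
        have n1 : Measurable fun u => ∫⁻ s : ℝ, 2 * ‖h s‖ₑ ^ 2 * w (r s / 2) u :=
          Measurable.lintegral_prod_right' (f := fun p : ℝ × ℝ =>
            2 * ‖h p.2‖ₑ ^ 2 * w (r p.2 / 2) p.1) (hm2.mul wm2)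
        have n2 : Measurable fun u => ∫⁻ s : ℝ, 2 * ‖h s‖ₑ ^ 2 * w (r s / 3) u :=
          Measurable.lintegral_prod_right' (f := fun p : ℝ × ℝ =>
            2 * ‖h p.2‖ₑ ^ 2 * w (r p.2 / 3) p.1) (hm2.mul wm3)
        rw [lintegral_add_left (by exact n1.add n2), lintegral_add_left n1]
    _ = 10 * (∫⁻ s, ‖h s‖ₑ ^ 2 * ENNReal.ofReal (r s)⁻¹) +
      ∫⁻ s, ‖k s‖ₑ ^ 2 * ENNReal.ofReal (r s) := by
        -- The integral of `u⁻²` over `u > r/n` is `n/r`, so the thresholds `n = 2` and `n = 3`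
        -- together give `2·2 + 2·3 = 10`.
        have far : ∀ n : ℝ, 0 < n → (Measurable fun p : ℝ × ℝ => w (r p.2 / n) p.1) →
            ∫⁻ u in Ioi (0 : ℝ), ∫⁻ s : ℝ, 2 * ‖h s‖ₑ ^ 2 * w (r s / n) u =
              ENNReal.ofReal (2 * n) * ∫⁻ s, ‖h s‖ₑ ^ 2 * ENNReal.ofReal (r s)⁻¹ := by
          intro n hn hm'
          rw [lintegral_lintegral_swap (by exact (hm2.mul hm').aemeasurable),
            ← lintegral_const_mul _ (by fun_prop)]
          refine lintegral_congr fun s => ?_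
          have : Measurable (w (r s / n)) := hm'.comp (measurable_prodMk_right (y := s))
          rw [lintegral_const_mul _ this, wint _ (div_pos (hr0 s) hn), inv_div, div_eq_mul_inv,
            ENNReal.ofReal_mul hn.le, ENNReal.ofReal_mul zero_le_two, ENNReal.ofReal_ofNat]
          ring
        rw [far 2 two_pos wm2, far 3 three_pos wm3,
          lintegral_lintegral_swap qm.aemeasurable, ← add_mul,
          ← ENNReal.ofReal_add (by norm_num) (by norm_num)]
        congr 1
        · norm_num
        · refine lintegral_congr fun s => ?_
          have e : ∀ u, q u s = (Iic (r s)).indicator (fun _ => ‖k s‖ₑ ^ 2) u := by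
            intro u; simp [hq, indicator]
          simp only [e]
          rw [lintegral_indicator measurableSet_Iic, Measure.restrict_restrict measurableSet_Iic,
            setLIntegral_const, Iic_inter_Ioi, Real.volume_Ioc, sub_zero]

/-! ### Counting zeros, and change of variables along finitely-many-to-one maps -/

/-- The number of points of `Z` below `s`. -/
def countBelow (Z : Finset ℝ) (s : ℝ) : ℕ := (Z.filter (· < s)).card

theorem countBelow_le (Z : Finset ℝ) (s : ℝ) : countBelow Z s ≤ Z.card :=
  Finset.card_filter_le _ _

theorem countBelow_lt {Z : Finset ℝ} {s s' z : ℝ} (hz : z ∈ Z) (h1 : s ≤ z) (h2 : z < s') :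
    countBelow Z s < countBelow Z s' := by
  refine Finset.card_lt_card ⟨fun y hy => ?_, fun h => ?_⟩
  · rw [Finset.mem_filter] at hy ⊢
    exact ⟨hy.1, by linarith [hy.2]⟩
  · have := h (Finset.mem_filter.2 ⟨hz, h2⟩)
    exact absurd (Finset.mem_filter.1 this).2 (not_lt.2 h1)

theorem measurable_countBelow (Z : Finset ℝ) : Measurable (countBelow Z) := by
  have : countBelow Z = fun s => ∑ z ∈ Z, (Ioi z).indicator (fun _ => 1) s := by
    ext s
    simp [countBelow, indicator]
  rw [this]
  exact Finset.measurable_sum _ fun z _ => measurable_const.indicator measurableSet_Ioi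

/-- Rolle's theorem for a function with finitely many critical points in `J`: the number of
critical points below strictly increases between two points with equal values. -/
theorem countBelow_lt_of_eq {p q : ℝ} {f f' : ℝ → ℝ} {J : Set ℝ} {Z : Finset ℝ}
    (hJ : J.OrdConnected) (hJs : J ⊆ Icc p q) (hf : Continuous f)
    (hd : ∀ s ∈ Ioo p q, HasDerivAt f (f' s) s) (hZ : ∀ s ∈ J, f' s = 0 → s ∈ Z)
    {s s' : ℝ} (hs : s ∈ J) (hs' : s' ∈ J) (hlt : s < s') (heq : f s = f s') :
    countBelow Z s < countBelow Z s' := by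
  obtain ⟨z, hz, hz0⟩ := exists_hasDerivAt_eq_zero hlt hf.continuousOn heq fun x hx =>
    hd x ⟨(hJs hs).1.trans_lt hx.1, hx.2.trans_le (hJs hs').2⟩
  exact countBelow_lt (hZ z (hJ.out hs hs' ⟨hz.1.le, hz.2.le⟩) hz0) hz.1.le hz.2

/-- A function whose `n`-th derivative does not vanish on an interval has at most `n` zeros. -/
theorem exists_finset_zeros {p q : ℝ} {J : Set ℝ} (hJ : J.OrdConnected) (hJs : J ⊆ Icc p q)
    (n : ℕ) : ∀ f : ℕ → ℝ → ℝ, (∀ k < n, Continuous (f k)) →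
    (∀ k < n, ∀ s ∈ Ioo p q, HasDerivAt (f k) (f (k + 1) s) s) → (∀ s ∈ J, f n s ≠ 0) →
    ∃ Z : Finset ℝ, Z.card ≤ n ∧ ∀ s ∈ J, f 0 s = 0 → s ∈ Z := by
  induction n with
  | zero => exact fun f _ _ h => ⟨∅, by simp, fun s hs h0 => absurd h0 (h s hs)⟩
  | succ n ih =>
    intro f hc hd h
    obtain ⟨Z, hZc, hZ⟩ := ih (fun k => f (k + 1)) (fun k hk => hc _ (by omega))
      (fun k hk => hd _ (by omega)) h
    have hcard : {s | s ∈ J ∧ f 0 s = 0}.encard ≤ (n + 1 : ℕ) := by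
      -- `Z` contains the zeros of the derivative, so the counting function increases strictly
      -- between zeros of `f 0`. Its values lie in `{0, …, n}`, which allows at most `n + 1` zeros.
      have hinj : InjOn (countBelow Z) {s | s ∈ J ∧ f 0 s = 0} := by
        refine StrictMonoOn.injOn fun s hs s' hs' hlt => ?_
        exact countBelow_lt_of_eq hJ hJs (hc 0 (by omega)) (hd 0 (by omega)) hZ hs.1 hs'.1 hlt
          (hs.2.trans hs'.2.symm)
      have := encard_le_encard_of_injOn (t := (Finset.range (n + 1) : Set ℕ))
        (fun s _ => by
          simpa using Nat.lt_succ_of_le ((countBelow_le Z s).trans hZc)) hinj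
      rwa [encard_coe_eq_coe_finsetCard, Finset.card_range] at this
    have hfin : {s | s ∈ J ∧ f 0 s = 0}.Finite :=
      encard_lt_top_iff.1 (hcard.trans_lt (WithTop.coe_lt_top _))
    refine ⟨hfin.toFinset, ?_, fun s hs h0 => by simpa using ⟨hs, h0⟩⟩
    rw [hfin.encard_eq_coe_toFinset_card] at hcard
    exact_mod_cast hcard

theorem lintegral_biUnion_finset_le {α ι : Type*} [MeasurableSpace α] {μ : Measure α}
    (S : Finset ι) (P : ι → Set α) (g : α → ENNReal) :
    ∫⁻ x in ⋃ k ∈ S, P k, g x ∂μ ≤ ∑ k ∈ S, ∫⁻ x in P k, g x ∂μ := by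
  classical
  induction S using Finset.induction_on with
  | empty => simp
  | insert k S hk ih =>
    rw [Finset.set_biUnion_insert, Finset.sum_insert hk]
    exact (lintegral_union_le _ _ _).trans (add_le_add_right ih _)

/-- A change of variables along a function with finitely many critical points. -/
theorem lintegral_comp_mul_abs_deriv_le {p q : ℝ} {f f' : ℝ → ℝ} {J : Set ℝ} {Z : Finset ℝ}
    (hJ : J.OrdConnected) (hJs : J ⊆ Icc p q) (hf : Continuous f)
    (hd : ∀ s ∈ Ioo p q, HasDerivAt f (f' s) s) (hZ : ∀ s ∈ J, f' s = 0 → s ∈ Z)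
    (G : ℝ → ENNReal) :
    ∫⁻ s in J, G (f s) * ENNReal.ofReal |f' s| ≤ (Z.card + 1 : ℕ) * ∫⁻ y, G y := by
  set P : ℕ → Set ℝ := fun k => {s | s ∈ J ∧ s ∈ Ioo p q ∧ countBelow Z s = k} with hP
  have hPm : ∀ k, MeasurableSet (P k) := fun k =>
    hJ.measurableSet.inter (measurableSet_Ioo.inter
      (measurable_countBelow Z (measurableSet_singleton k)))
  have hPint : ∀ k, ∫⁻ s in P k, G (f s) * ENNReal.ofReal |f' s| ≤ ∫⁻ y, G y := by
    intro k
    -- Two points with the same value would be separated by a critical point, which changes the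
    -- count; hence each piece of constant count is mapped injectively.
    have hinj : InjOn f (P k) := by
      intro s hs s' hs' heq
      rcases lt_trichotomy s s' with h | h | h
      · have := countBelow_lt_of_eq hJ hJs hf hd hZ hs.1 hs'.1 h heq
        rw [hs.2.2, hs'.2.2] at this
        exact absurd this (lt_irrefl _)
      · exact h
      · have := countBelow_lt_of_eq hJ hJs hf hd hZ hs'.1 hs.1 h heq.symm
        rw [hs.2.2, hs'.2.2] at this
        exact absurd this (lt_irrefl _)
    have := lintegral_image_eq_lintegral_abs_deriv_mul (hPm k)
      (fun s hs => (hd s hs.2.1).hasDerivWithinAt) hinj G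
    simp only [mul_comm (G _)]
    rw [← this]
    exact setLIntegral_le_lintegral _ _
  -- Differentiability is known only in the open interval; the two endpoints form a null set.
  have hsub : J ⊆ (⋃ k ∈ Finset.range (Z.card + 1), P k) ∪ {p, q} := by
    intro s hs
    by_cases h : s ∈ Ioo p q
    · left
      simp only [mem_iUnion, Finset.mem_range]
      exact ⟨countBelow Z s, Nat.lt_succ_of_le (countBelow_le Z s), hs, h, rfl⟩
    · right
      have := hJs hs
      by_contra hne
      simp only [mem_insert_iff, mem_singleton_iff, not_or] at hne
      exact h ⟨lt_of_le_of_ne this.1 (Ne.symm hne.1), lt_of_le_of_ne this.2 hne.2⟩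
  calc ∫⁻ s in J, G (f s) * ENNReal.ofReal |f' s|
      ≤ ∫⁻ s in (⋃ k ∈ Finset.range (Z.card + 1), P k) ∪ {p, q},
          G (f s) * ENNReal.ofReal |f' s| := lintegral_mono_set hsub
    _ ≤ (∫⁻ s in ⋃ k ∈ Finset.range (Z.card + 1), P k, G (f s) * ENNReal.ofReal |f' s|) +
          ∫⁻ s in {p, q}, G (f s) * ENNReal.ofReal |f' s| := lintegral_union_le _ _ _
    _ = ∫⁻ s in ⋃ k ∈ Finset.range (Z.card + 1), P k, G (f s) * ENNReal.ofReal |f' s| := by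
        rw [setLIntegral_measure_zero {p, q} _ (Set.Finite.measure_zero (by simp) _), add_zero]
    _ ≤ ∑ k ∈ Finset.range (Z.card + 1), ∫⁻ s in P k, G (f s) * ENNReal.ofReal |f' s| :=
        lintegral_biUnion_finset_le _ _ _
    _ ≤ ∑ k ∈ Finset.range (Z.card + 1), ∫⁻ y, G y := Finset.sum_le_sum fun k _ => hPint k
    _ = _ := by simp

/-! ### Covers adapted to a phase, and the Lipschitz scale -/

/-- A finite cover of the set `U ⊆ [p, q]` by intervals in which the derivative `φ'` of a phase has
few zeros and either few points on each level or essentially constant size. -/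
structure PhaseCover (p q : ℝ) (φ' : ℝ → ℝ) (U : Set ℝ) (c κ : ℝ) (N n : ℕ) (J : ℕ → Set ℝ) :
    Prop where
  ordConnected : ∀ j < N, (J j).OrdConnected
  subset_Icc : ∀ j < N, J j ⊆ Icc p q
  cover : ∀ s ∈ U, ∃ j < N, ∀ s' ∈ Icc p q, |s - s'| < c → s' ∈ J j
  zeros : ∀ j < N, ∃ Z : Finset ℝ, Z.card ≤ n ∧ ∀ s ∈ J j, φ' s = 0 → s ∈ Z
  levels : ∀ j < N, (∀ v ∈ J j, ∀ v' ∈ J j, 1 + |φ' v'| ≤ κ * (1 + |φ' v|)) ∨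
    ∀ y, ∃ Z : Finset ℝ, Z.card ≤ n ∧ ∀ s ∈ J j, φ' s = y → s ∈ Z

theorem PhaseCover.lintegral_comp_le {p q : ℝ} {φ φ' : ℝ → ℝ} {U : Set ℝ} {c κ : ℝ} {N n : ℕ}
    {J : ℕ → Set ℝ} (h : PhaseCover p q φ' U c κ N n J) (hc : 0 < c) (hU : U ⊆ Icc p q)
    (hf : Continuous φ) (hd : ∀ s ∈ Ioo p q, HasDerivAt φ (φ' s) s) (G : ℝ → ENNReal) :
    ∫⁻ s in U, G (φ s) * ENNReal.ofReal |φ' s| ≤ (N * (n + 1) : ℕ) * ∫⁻ y, G y := by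
  have hsub : U ⊆ ⋃ j ∈ Finset.range N, J j := by
    intro s hs
    obtain ⟨j, hj, hcov⟩ := h.cover s hs
    simp only [mem_iUnion, Finset.mem_range]
    exact ⟨j, hj, hcov s (hU hs) (by simpa using hc)⟩
  calc ∫⁻ s in U, G (φ s) * ENNReal.ofReal |φ' s|
      ≤ ∫⁻ s in ⋃ j ∈ Finset.range N, J j, G (φ s) * ENNReal.ofReal |φ' s| :=
        lintegral_mono_set hsub
    _ ≤ ∑ j ∈ Finset.range N, ∫⁻ s in J j, G (φ s) * ENNReal.ofReal |φ' s| :=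
        lintegral_biUnion_finset_le _ _ _
    _ ≤ ∑ j ∈ Finset.range N, (n + 1 : ℕ) * ∫⁻ y, G y := by
        refine Finset.sum_le_sum fun j hj => ?_
        have hj := Finset.mem_range.1 hj
        obtain ⟨Z, hZn, hZ⟩ := h.zeros j hj
        refine (lintegral_comp_mul_abs_deriv_le (h.ordConnected j hj) (h.subset_Icc j hj) hf hd hZ
          G).trans ?_
        gcongr
    _ = _ := by simp [mul_assoc]

/-- The largest `1`-Lipschitz function below `1 / (1 + |φ'|)` on `[p, q]`. -/
def scale (p q : ℝ) (φ' : ℝ → ℝ) (s : ℝ) : ℝ :=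
  ⨅ x : Icc p q, (|s - x| + (1 + |φ' x|)⁻¹)

section Scale

variable {p q : ℝ} {φ' : ℝ → ℝ}

theorem bddBelow_scale (s : ℝ) :
    BddBelow (range fun x : Icc p q => |s - x| + (1 + |φ' x|)⁻¹) :=
  ⟨0, by rintro _ ⟨x, rfl⟩; positivity⟩

theorem scale_le (s : ℝ) {x : ℝ} (hx : x ∈ Icc p q) :
    scale p q φ' s ≤ |s - x| + (1 + |φ' x|)⁻¹ :=
  ciInf_le (bddBelow_scale s) (⟨x, hx⟩ : Icc p q)

theorem scale_le_inv {s : ℝ} (hs : s ∈ Icc p q) : scale p q φ' s ≤ (1 + |φ' s|)⁻¹ := by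
  simpa using scale_le s hs

theorem inv_le_scale (hpq : p ≤ q) {Ψ : ℝ} (hΨ : ∀ s ∈ Icc p q, 1 + |φ' s| ≤ Ψ) (s : ℝ) :
    Ψ⁻¹ ≤ scale p q φ' s := by
  have : Nonempty (Icc p q) := ⟨⟨p, left_mem_Icc.2 hpq⟩⟩
  refine le_ciInf fun x => ?_
  have : Ψ⁻¹ ≤ (1 + |φ' x|)⁻¹ := inv_anti₀ (by positivity) (hΨ x x.2)
  linarith [abs_nonneg (s - x)]

theorem abs_scale_sub_le (hpq : p ≤ q) (s s' : ℝ) :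
    |scale p q φ' s - scale p q φ' s'| ≤ |s - s'| := by
  have : Nonempty (Icc p q) := ⟨⟨p, left_mem_Icc.2 hpq⟩⟩
  have key : ∀ s s', scale p q φ' s - |s - s'| ≤ scale p q φ' s' := by
    intro s s'
    refine le_ciInf fun x => ?_
    have h1 := scale_le (φ' := φ') s x.2
    have h2 := abs_sub_le s s' x
    linarith
  have h1 := key s s'
  have h2 := key s' s
  rw [abs_sub_comm s' s] at h2
  exact abs_le.2 ⟨by linarith, by linarith⟩

theorem exists_lt_scale (hpq : p ≤ q) {s ρ : ℝ} (h : scale p q φ' s < ρ) :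
    ∃ x ∈ Icc p q, |s - x| + (1 + |φ' x|)⁻¹ < ρ := by
  have : Nonempty (Icc p q) := ⟨⟨p, left_mem_Icc.2 hpq⟩⟩
  obtain ⟨x, hx⟩ := exists_lt_of_ciInf_lt h
  exact ⟨x, x.2, hx⟩

/-- Where the scale is much smaller than `1 / (1 + |φ'|)`, there is a dyadic level of `1 + |φ'|`
close by. -/
theorem PhaseCover.exists_level {U : Set ℝ} {c κ : ℝ} {N n : ℕ} {J : ℕ → Set ℝ}
    (h : PhaseCover p q φ' U c κ N n J) (hU : U ⊆ Icc p q) (hpq : p ≤ q) (hκ : 2 ≤ κ)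
    (hφ' : Continuous φ') {s : ℝ} (hs : s ∈ U) (h0 : 0 < scale p q φ' s)
    (h1 : scale p q φ' s < (2 * κ * (1 + |φ' s|))⁻¹) (h2 : scale p q φ' s < c / 2) :
    ∃ j < N, (∀ y, ∃ Z : Finset ℝ, Z.card ≤ n ∧ ∀ s ∈ J j, φ' s = y → s ∈ Z) ∧
      ∃ m : ℕ, ∃ z ∈ J j, 1 + |φ' z| = 2 ^ m ∧ |s - z| ≤ (2 ^ m)⁻¹ ∧
        (scale p q φ' s)⁻¹ ≤ 4 * 2 ^ m := by
  set r := scale p q φ' s with hr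
  have hψ : ∀ s, 0 < 1 + |φ' s| := fun s => by positivity
  obtain ⟨s', hs', hlt⟩ := exists_lt_scale hpq (show scale p q φ' s < 2 * r by linarith)
  have ha := abs_nonneg (s - s')
  have hi : 0 < (1 + |φ' s'|)⁻¹ := inv_pos.2 (hψ s')
  obtain ⟨j, hj, hcov⟩ := h.cover s hs
  have hs'J : s' ∈ J j := hcov s' hs' (by linarith)
  have hsJ : s ∈ J j := hcov s (hU hs) (by simp; linarith)
  -- The near-minimizer `s'` satisfies `1+|φ'(s')| > x`, whereas `κ(1+|φ'(s)|) < x`. This excludes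
  -- the constant-size alternative on the interval. As `κ ≥ 2`, the power of two with `2^m ≤ x <
  -- 2^(m+1)` also lies between the two values, so it is attained between `s` and `s'`.
  set x : ℝ := (2 * r)⁻¹ with hx
  have hx1 : x < 1 + |φ' s'| := by
    rw [hx, inv_lt_comm₀ (by positivity) (hψ s')]
    linarith
  have hx2 : κ * (1 + |φ' s|) < x := by
    rw [hx, lt_inv_comm₀ (by nlinarith [hψ s]) (by positivity)]
    have : (κ * (1 + |φ' s|))⁻¹ = 2 * (2 * κ * (1 + |φ' s|))⁻¹ := by
      rw [mul_assoc, mul_inv 2]; ring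
    linarith
  have hx3 : 2 * (1 + |φ' s|) < x := by nlinarith [hψ s]
  refine ⟨j, hj, ?_, ?_⟩
  · rcases h.levels j hj with hl | hl
    · exact absurd (hl s hsJ s' hs'J) (by linarith)
    · exact hl
  obtain ⟨m, hm1, hm2⟩ := exists_nat_pow_near (x := x) (y := 2) (by linarith [abs_nonneg (φ' s)])
    one_lt_two
  have hpow : (2 : ℝ) ^ (m + 1) = 2 * 2 ^ m := by ring
  have hivt := intermediate_value_uIcc (a := s) (b := s') (f := fun s => 1 + |φ' s|)
    (by fun_prop)
  obtain ⟨z, hz, hzm⟩ := hivt (show (2 : ℝ) ^ m ∈ uIcc (1 + |φ' s|) (1 + |φ' s'|) by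
    rw [mem_uIcc]; left; constructor <;> linarith)
  refine ⟨m, z, ?_, hzm, ?_, ?_⟩
  · exact (h.ordConnected j hj).uIcc_subset hsJ hs'J hz
  · have h3 : |s - z| ≤ |s - s'| := by
      rw [abs_sub_comm s z, abs_sub_comm s s']
      exact abs_sub_left_of_mem_uIcc hz
    have h4 : 2 * r ≤ (2 ^ m)⁻¹ := by
      rw [le_inv_comm₀ (by positivity) (by positivity)]
      exact hm1
    linarith
  · have : r⁻¹ = 2 * x := by rw [hx, mul_inv]; ring
    linarith

/-- This is the source of the logarithm. The weight `W` is a sum of indicators of balls of radius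
`2^{-m}` with height `4·2^m`, centred at the points where `1+|φ'| = 2^m`. Each has integral `8`.
There are at most `2n` centres per interval and level, because both signs of `φ'` occur, and at most
`m₀ + 1` levels. -/
theorem PhaseCover.exists_weight {U : Set ℝ} {c κ : ℝ} {N n : ℕ} {J : ℕ → Set ℝ}
    (h : PhaseCover p q φ' U c κ N n J) (hU : U ⊆ Icc p q) (hpq : p ≤ q) (hκ : 2 ≤ κ)
    (hc : 0 < c) (hφ' : Continuous φ') {m₀ : ℕ} (hm₀ : ∀ s ∈ Icc p q, 1 + |φ' s| ≤ 2 ^ m₀) :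
    ∃ W : ℝ → ENNReal, Measurable W ∧ ∫⁻ s, W s ≤ (16 * N * n * (m₀ + 1) : ℕ) ∧
      ∀ s ∈ U, ENNReal.ofReal (scale p q φ' s)⁻¹ ≤
        ENNReal.ofReal (2 * κ * (1 + |φ' s|) + 2 / c) + W s := by
  classical
  have hr0 : ∀ s, 0 < scale p q φ' s := fun s =>
    (by positivity : (0 : ℝ) < ((2 : ℝ) ^ m₀)⁻¹).trans_le (inv_le_scale hpq hm₀ s)
  have hZ : ∀ j y, ∃ Z : Finset ℝ, Z.card ≤ n ∧
      (j < N → (∀ y, ∃ Z : Finset ℝ, Z.card ≤ n ∧ ∀ s ∈ J j, φ' s = y → s ∈ Z) →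
        ∀ s ∈ J j, φ' s = y → s ∈ Z) := by
    intro j y
    by_cases hl : ∀ y, ∃ Z : Finset ℝ, Z.card ≤ n ∧ ∀ s ∈ J j, φ' s = y → s ∈ Z
    · obtain ⟨Z, h1, h2⟩ := hl y
      exact ⟨Z, h1, fun _ _ => h2⟩
    -- The default is harmless: `exists_level` only produces intervals with few points on each
    -- level.
    · exact ⟨∅, by simp, fun _ h' => absurd h' hl⟩
  choose Z hZn hZ using hZ
  set Y : ℕ → ℕ → Finset ℝ := fun j m => Z j (2 ^ m - 1) ∪ Z j (1 - 2 ^ m) with hY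
  have hYn : ∀ j m, (Y j m).card ≤ 2 * n := fun j m =>
    (Finset.card_union_le _ _).trans (by linarith [hZn j (2 ^ m - 1), hZn j (1 - 2 ^ m)])
  set w : ℕ → ℝ → ℝ → ENNReal := fun m z =>
    (Metric.closedBall z (2 ^ m)⁻¹).indicator fun _ => ENNReal.ofReal (4 * 2 ^ m) with hw
  have wm : ∀ m z, Measurable (w m z) := fun m z =>
    measurable_const.indicator Metric.isClosed_closedBall.measurableSet
  have wint : ∀ m z, ∫⁻ s, w m z s = 8 := by
    intro m z
    rw [hw]
    simp only []
    rw [lintegral_indicator_const Metric.isClosed_closedBall.measurableSet, Real.volume_closedBall,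
      ← ENNReal.ofReal_mul (by positivity)]
    rw [show (4 * 2 ^ m * (2 * (2 ^ m)⁻¹) : ℝ) = 8 by field_simp; norm_num]
    norm_num
  refine ⟨fun s => ∑ j ∈ Finset.range N, ∑ m ∈ Finset.range (m₀ + 1), ∑ z ∈ Y j m, w m z s,
    by fun_prop, ?_, ?_⟩
  · rw [lintegral_finsetSum _ (by fun_prop)]
    calc ∑ j ∈ Finset.range N, ∫⁻ s, ∑ m ∈ Finset.range (m₀ + 1), ∑ z ∈ Y j m, w m z s
        ≤ ∑ j ∈ Finset.range N, ∑ m ∈ Finset.range (m₀ + 1), ((2 * n * 8 : ℕ) : ENNReal) := by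
          refine Finset.sum_le_sum fun j _ => ?_
          rw [lintegral_finsetSum _ (by fun_prop)]
          refine Finset.sum_le_sum fun m _ => ?_
          rw [lintegral_finsetSum _ (by fun_prop)]
          simp only [wint, Finset.sum_const, nsmul_eq_mul]
          exact_mod_cast Nat.mul_le_mul_right 8 (hYn j m)
      _ = _ := by
          simp only [Finset.sum_const, Finset.card_range, nsmul_eq_mul]
          push_cast
          ring
  · intro s hs
    by_cases h1 : scale p q φ' s < (2 * κ * (1 + |φ' s|))⁻¹ ∧ scale p q φ' s < c / 2
    · obtain ⟨j, hj, hl, m, z, hz, hzm, hsz, hle⟩ :=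
        h.exists_level hU hpq hκ hφ' hs (hr0 s) h1.1 h1.2
      refine le_trans ?_ le_add_self
      have hm : m ∈ Finset.range (m₀ + 1) := by
        have := hm₀ z (h.subset_Icc j hj hz)
        rw [hzm] at this
        have := (pow_le_pow_iff_right₀ (one_lt_two (α := ℝ))).1 this
        simpa using Nat.lt_succ_of_le this
      have hzY : z ∈ Y j m := by
        rcases abs_cases (φ' z) with ⟨h3, _⟩ | ⟨h3, _⟩
        · exact Finset.mem_union_left _ (hZ j _ hj hl z hz (by linarith))
        · exact Finset.mem_union_right _ (hZ j _ hj hl z hz (by linarith))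
      calc ENNReal.ofReal (scale p q φ' s)⁻¹ ≤ w m z s := by
            rw [hw]
            simp only []
            rw [indicator_of_mem (by simpa [Real.dist_eq] using hsz)]
            exact ENNReal.ofReal_le_ofReal hle
        _ ≤ ∑ z ∈ Y j m, w m z s := Finset.single_le_sum (f := fun z => w m z s)
            (fun _ _ => zero_le) hzY
        _ ≤ ∑ m ∈ Finset.range (m₀ + 1), ∑ z ∈ Y j m, w m z s :=
            Finset.single_le_sum (f := fun m => ∑ z ∈ Y j m, w m z s) (fun _ _ => zero_le) hm
        _ ≤ _ := Finset.single_le_sum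
            (f := fun j => ∑ m ∈ Finset.range (m₀ + 1), ∑ z ∈ Y j m, w m z s)
            (fun _ _ => zero_le) (Finset.mem_range.2 hj)
    · refine le_trans (ENNReal.ofReal_le_ofReal ?_) le_self_add
      have hψ : 0 < 2 * κ * (1 + |φ' s|) := by positivity
      rw [not_and_or, not_lt, not_lt] at h1
      rcases h1 with h1 | h1
      · have := inv_anti₀ (by positivity) h1
        rw [inv_inv] at this
        linarith [div_pos two_pos hc]
      · have := inv_anti₀ (by positivity) h1
        rw [inv_div] at this
        linarith

end Scale

/-! ### Construction of the cover from nondegeneracy -/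

theorem abs_sub_le_of_hasDerivAt {p q M : ℝ} {f f' : ℝ → ℝ} (hf : Continuous f)
    (hd : ∀ s ∈ Ioo p q, HasDerivAt f (f' s) s) (hM : ∀ s ∈ Icc p q, |f' s| ≤ M)
    {s v : ℝ} (hs : s ∈ Icc p q) (hv : v ∈ Icc p q) : |f v - f s| ≤ M * |v - s| := by
  wlog hlt : s < v generalizing s v
  · rcases (not_lt.1 hlt).eq_or_lt with h | h
    · simp [h]
    · rw [abs_sub_comm, abs_sub_comm v]
      exact this hv hs h
  obtain ⟨x, hx, hxs⟩ := exists_hasDerivAt_eq_slope f f' hlt hf.continuousOn fun x hx =>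
    hd x ⟨hs.1.trans_lt hx.1, hx.2.trans_le hv.2⟩
  have h0 : 0 < v - s := sub_pos.2 hlt
  rw [eq_div_iff h0.ne'] at hxs
  rw [← hxs, abs_mul]
  exact mul_le_mul_of_nonneg_right
    (hM x ⟨hs.1.trans hx.1.le, hx.2.le.trans hv.2⟩) (abs_nonneg _)

/-- The width of the intervals on which one of the derivatives of the phase does not vanish. -/
def coverWidth (A B : ℝ) (L : ℕ) : ℝ := (4 * A * B * L + 1)⁻¹

/-- The number of intervals of the cover. -/
def coverCard (p q A B : ℝ) (L : ℕ) : ℕ := ⌊(q - p) / coverWidth A B L⌋₊ + 1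

theorem coverWidth_pos {A B : ℝ} (hA : 0 < A) (hB : 0 < B) (L : ℕ) : 0 < coverWidth A B L := by
  unfold coverWidth; positivity

/-- If one of the first `L` derivatives of a phase is large at each point of `U`, with control of
the derivative of order `L + 1`, then `U` has a finite cover adapted to the phase. -/
theorem exists_phaseCover {p q : ℝ} {D : ℕ → ℝ → ℝ} {L : ℕ} (hL : 1 ≤ L) {A B Λ : ℝ}
    (hA : 0 < A) (hB0 : 0 < B) (hΛ : 0 < Λ) (hc : ∀ k ≤ L, Continuous (D k))
    (hd : ∀ k ≤ L, ∀ s ∈ Ioo p q, HasDerivAt (D k) (D (k + 1) s) s)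
    (hB : ∀ k, 1 ≤ k → k ≤ L + 1 → ∀ s ∈ Icc p q, |D k s| ≤ B * Λ) :
    ∃ J, PhaseCover p q (D 1)
      {s | s ∈ Icc p q ∧ A⁻¹ * Λ ≤ ∑ i ∈ Finset.Icc 1 L, |D i s|}
      (coverWidth A B L) (2 + 2 * A * B * L) (coverCard p q A B L) (L - 1) J := by
  classical
  set c := coverWidth A B L with hcdef
  have hc0 : 0 < c := coverWidth_pos hA hB0 L
  have hL0 : (0 : ℝ) < L := by exact_mod_cast hL
  -- The width is chosen so that a derivative of size `Λ/(AL)` at one point loses at most half of it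
  -- over a distance `2c`.
  have hcB : 2 * c * (B * Λ) ≤ Λ / (2 * A * L) := by
    rw [hcdef, coverWidth, le_div_iff₀ (by positivity)]
    have : 2 * (4 * A * B * L + 1)⁻¹ * (B * Λ) * (2 * A * L) =
        (4 * A * B * L) / (4 * A * B * L + 1) * Λ := by
      rw [div_eq_mul_inv]; ring
    rw [this]
    have h1 : (4 * A * B * L) / (4 * A * B * L + 1) ≤ 1 :=
      (div_le_one (by positivity)).2 (by linarith)
    nlinarith
  -- Each interval has length `3c` before truncation to `[p, q]`; a point assigned to it by the
  -- floor function lies in the middle third, so its `c`-neighbourhood in `[p, q]` stays inside.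
  set Q : ℕ → Set ℝ := fun j => Icc p q ∩ Icc (p + (j - 1) * c) (p + (j + 2) * c) with hQ
  set good : ℕ → Prop := fun j => ∃ i ∈ Finset.Icc 1 L, ∀ v ∈ Q j, Λ / (2 * A * L) ≤ |D i v|
    with hgood
  set J : ℕ → Set ℝ := fun j => if good j then Q j else ∅ with hJ
  have hQord : ∀ j, (J j).OrdConnected := by
    intro j
    by_cases h : good j
    · simpa only [hJ, h, if_true] using ordConnected_Icc.inter ordConnected_Icc
    · simpa only [hJ, h, if_false] using ordConnected_empty
  have hJQ : ∀ j, J j ⊆ Icc p q := by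
    intro j
    by_cases h : good j
    · simpa only [hJ, h, if_true] using inter_subset_left
    · simp only [hJ, h, if_false, empty_subset]
  have hpos : 0 < Λ / (2 * A * L) := by positivity
  have hlev : ∀ i ∈ Finset.Icc 1 L, 2 ≤ i → ∀ j, (∀ v ∈ J j, Λ / (2 * A * L) ≤ |D i v|) → ∀ y,
      ∃ Z : Finset ℝ, Z.card ≤ L - 1 ∧ ∀ s ∈ J j, D 1 s = y → s ∈ Z := by
    intro i hi h2 j hv y
    rw [Finset.mem_Icc] at hi
    obtain ⟨Z, hZc, hZ⟩ := exists_finset_zeros (hQord j) (hJQ j) (i - 1)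
      -- Only the first function of the chain is shifted by the level `y`; for `i ≥ 2` the
      -- nonvanishing top derivative is unaffected.
      (fun k s => D (k + 1) s - if k = 0 then y else 0)
      (fun k hk => by have := hc (k + 1) (by omega); fun_prop)
      (fun k hk s hs => by
        have := (hd (k + 1) (by omega) s hs).sub_const (if k = 0 then y else 0)
        simpa using this)
      (fun s hs => by
        have h3 := hv s hs
        rw [if_neg (by omega), sub_zero, show i - 1 + 1 = i by omega]
        exact abs_pos.1 (hpos.trans_le h3))
    refine ⟨Z, hZc.trans (by omega), fun s hs hy => hZ s hs ?_⟩
    simp [hy]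
  refine ⟨J, fun j _ => hQord j, fun j _ => hJQ j, ?_, ?_, ?_⟩
  · rintro s ⟨hs, hsum⟩
    set j := ⌊(s - p) / c⌋₊ with hj
    have hsp : 0 ≤ (s - p) / c := div_nonneg (by linarith [hs.1]) hc0.le
    have hj1 : (j : ℝ) * c ≤ s - p := by
      have := Nat.floor_le hsp
      rwa [le_div_iff₀ hc0] at this
    have hj2 : s - p < (j + 1) * c := by
      have := Nat.lt_floor_add_one ((s - p) / c)
      rwa [div_lt_iff₀ hc0] at this
    have hjg : good j := by
      -- Pigeonhole: one of the `L` terms is at least the average.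
      have : ∃ i ∈ Finset.Icc 1 L, Λ / (A * L) ≤ |D i s| := by
        by_contra! hcon
        have h1 : ∑ i ∈ Finset.Icc 1 L, |D i s| < ∑ i ∈ Finset.Icc 1 L, Λ / (A * L) :=
          Finset.sum_lt_sum_of_nonempty ⟨1, Finset.mem_Icc.2 ⟨le_rfl, hL⟩⟩ hcon
        rw [Finset.sum_const, Nat.card_Icc, nsmul_eq_mul, Nat.add_sub_cancel] at h1
        have h2 : (L : ℝ) * (Λ / (A * L)) = A⁻¹ * Λ := by field_simp
        linarith
      obtain ⟨i, hi, his⟩ := this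
      refine ⟨i, hi, fun v hv => ?_⟩
      rw [Finset.mem_Icc] at hi
      have h1 := abs_sub_le_of_hasDerivAt (hc i hi.2) (hd i hi.2)
        (hB (i + 1) (by omega) (by omega)) hs hv.1
      have h2 : |v - s| ≤ 2 * c := by
        have := hv.2
        rw [abs_le]
        constructor <;> nlinarith [this.1, this.2]
      have h3 : B * Λ * |v - s| ≤ Λ / (2 * A * L) :=
        (mul_le_mul_of_nonneg_left h2 (by positivity)).trans (by linarith)
      have h4 : Λ / (A * L) = 2 * (Λ / (2 * A * L)) := by field_simp
      have h5 := abs_sub_abs_le_abs_sub (D i s) (D i v)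
      rw [abs_sub_comm (D i s)] at h5
      linarith
    refine ⟨j, ?_, fun s' hs' hss' => ?_⟩
    · refine Nat.lt_succ_of_le (Nat.floor_le_floor ?_)
      gcongr
      exact hs.2
    · simp only [hJ, hjg, if_true]
      rw [abs_lt] at hss'
      refine ⟨hs', ?_, ?_⟩ <;> nlinarith [hss'.1, hss'.2]
  · intro j _
    by_cases h : good j
    · have h' := h
      obtain ⟨i, hi, hv⟩ := h
      have hJj : J j = Q j := by simp only [hJ, h', if_true]
      rw [← hJj] at hv
      by_cases h2 : 2 ≤ i
      · exact hlev i hi h2 j hv 0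
      · have h1 : i = 1 := by rw [Finset.mem_Icc] at hi; omega
        subst h1
        refine ⟨∅, by simp, fun s hs h0 => ?_⟩
        have := hv s hs
        rw [h0, abs_zero] at this
        linarith
    · refine ⟨∅, by simp, fun s hs => ?_⟩
      simp [hJ, h] at hs
  · intro j _
    by_cases h : good j
    · have h' := h
      obtain ⟨i, hi, hv⟩ := h
      have hJj : J j = Q j := by simp only [hJ, h', if_true]
      rw [← hJj] at hv
      by_cases h2 : 2 ≤ i
      · exact Or.inr (hlev i hi h2 j hv)
      · have h1 : i = 1 := by rw [Finset.mem_Icc] at hi; omega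
        subst h1
        -- Here `|φ'|` lies between `Λ/(2AL)` and `BΛ`, two bounds whose ratio is `2ABL`.
        refine Or.inl fun v hvJ v' hvJ' => ?_
        have h3 := hv v hvJ
        have h4 := hB 1 le_rfl (by omega) v' (hJQ j hvJ')
        have h5 : 2 * A * B * L * (Λ / (2 * A * L)) = B * Λ := by field_simp
        have h6 : 0 < 2 * A * B * L := by positivity
        nlinarith [abs_nonneg (D 1 v)]
    · refine Or.inl fun v hv => ?_
      simp [hJ, h] at hv

/-! ### One-dimensional oscillatory integrals -/

theorem norm_exp_neg_I_mul (x : ℝ) : ‖Complex.exp (-Complex.I * (x : ℂ))‖ = 1 := by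
  rw [show -Complex.I * (x : ℂ) = ((-x : ℝ) : ℂ) * Complex.I by push_cast; ring,
    Complex.norm_exp_ofReal_mul_I]

/-- The one dimensional oscillatory integral `∫_I e^{-itφ(s)} b(s, t) f(t) dt`. -/
def oscInt (φ : ℝ → ℝ) (b : ℝ → ℝ → ℂ) (f : ℝ → ℂ) (s : ℝ) : ℂ :=
  ∫ t in I, Complex.exp (-Complex.I * (t * φ s : ℝ)) * (b s t * f t)

section OscInt

variable {φ : ℝ → ℝ} {b b₁ : ℝ → ℝ → ℂ} {f : ℝ → ℂ}

theorem measurable_oscInt (hφ : Measurable φ) (hb : Measurable fun x : ℝ × ℝ => b x.1 x.2)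
    (hf : Measurable f) : Measurable (oscInt φ b f) := by
  have : Measurable (Function.uncurry fun s t : ℝ =>
      Complex.exp (-Complex.I * (t * φ s : ℝ)) * (b s t * f t)) := by
    unfold Function.uncurry
    fun_prop
  exact this.stronglyMeasurable.integral_prod_right.measurable

theorem enorm_sq_oscInt_le (hf : Measurable f) {K : ℝ} (hb : ∀ s t, ‖b s t‖ ≤ K) (s : ℝ) :
    ‖oscInt φ b f s‖ₑ ^ 2 ≤ ENNReal.ofReal (2 * K ^ 2) * ∫⁻ t in I, ‖f t‖ₑ ^ 2 := by
  have hK : 0 ≤ K := (norm_nonneg _).trans (hb 0 0)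
  have h1 : ‖oscInt φ b f s‖ₑ ≤ ∫⁻ t in I, ENNReal.ofReal K * ‖f t‖ₑ := by
    refine (enorm_integral_le_lintegral_enorm _).trans (lintegral_mono fun t => ?_)
    rw [enorm_mul, enorm_mul, ← ofReal_norm (Complex.exp _), norm_exp_neg_I_mul,
      ENNReal.ofReal_one, one_mul, ← ofReal_norm (b s t)]
    gcongr
    exact hb s t
  refine (pow_le_pow_left' h1 2).trans ((sq_lintegral_le _ (by fun_prop)).trans_eq ?_)
  simp only [mul_pow]
  rw [lintegral_const_mul _ (by fun_prop), Measure.restrict_apply_univ, Real.volume_Icc,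
    ← mul_assoc, ← ENNReal.ofReal_pow hK, ← ENNReal.ofReal_mul (by norm_num)]
  norm_num

theorem integrable_bddProd {α β : Type*} [MeasurableSpace α] [MeasurableSpace β] {μ : Measure α}
    {ν : Measure β} [IsFiniteMeasure μ] [IsFiniteMeasure ν] {F : α → β → ℂ}
    (hm : Measurable (Function.uncurry F)) {C : ℝ} (hC : ∀ x y, ‖F x y‖ ≤ C) :
    Integrable (Function.uncurry F) (μ.prod ν) :=
  Integrable.of_bound hm.aestronglyMeasurable C (.of_forall fun x => hC x.1 x.2)

/-- An amplitude which is the integral of its derivative can be removed from an oscillatory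
integral. -/
theorem enorm_oscInt_le {p q : ℝ} (hb₁c : Continuous fun x : ℝ × ℝ => b₁ x.1 x.2)
    (hd : ∀ s t, HasDerivAt (fun s => b s t) (b₁ s t) s) (hp : ∀ t, b p t = 0)
    (hf : Measurable f) {K F : ℝ} (hb₁ : ∀ s t, ‖b₁ s t‖ ≤ K) (hF : ∀ t, ‖f t‖ ≤ F)
    {s : ℝ} (hs : s ∈ Icc p q) :
    ‖oscInt φ b f s‖ₑ ≤ ∫⁻ v in Ioc p q, ‖fourierS (I.indicator fun t => b₁ v t * f t) (φ s)‖ₑ := by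
  have hK : 0 ≤ K := (norm_nonneg _).trans (hb₁ 0 0)
  -- Since `b(p,t) = 0`, the amplitude is the integral of `b₁(v,t)` over `v ∈ (p, s]`. After Fubini
  -- the inner integral depends on `s` only through `φ(s)`: it is a Fourier transform in `t`,
  -- evaluated at `φ(s)`.
  have h1 : oscInt φ b f s = ∫ v in Ioc p s, ∫ t in I,
      Complex.exp (-Complex.I * (t * φ s : ℝ)) * (b₁ v t * f t) := by
    have hm : Measurable fun x : ℝ × ℝ => b₁ x.1 x.2 := hb₁c.measurable
    rw [integral_integral_swap (integrable_bddProd (C := K * F) ?_ ?_)]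
    · refine integral_congr_ae (.of_forall fun t => ?_)
      simp only []
      rw [integral_const_mul, integral_mul_const]
      congr 2
      rw [← intervalIntegral.integral_of_le hs.1,
        intervalIntegral.integral_eq_sub_of_hasDerivAt (fun v _ => hd v t), hp, sub_zero]
      exact (hb₁c.comp (by fun_prop : Continuous fun v => (v, t))).intervalIntegrable _ _
    · unfold Function.uncurry
      fun_prop
    · intro v t
      rw [norm_mul, norm_exp_neg_I_mul, one_mul, norm_mul]
      gcongr
      · exact hb₁ v t
      · exact hF t
  rw [h1]
  refine (enorm_integral_le_lintegral_enorm _).trans ?_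
  refine (lintegral_mono_set (Ioc_subset_Ioc_right hs.2)).trans_eq (lintegral_congr fun v => ?_)
  rw [fourierS, ← integral_indicator measurableSet_Icc]
  congr 2 with t
  simp only [indicator]
  split_ifs <;> simp

/-- The `L²` bound for oscillatory integrals against the weight `|φ'|`. -/
theorem PhaseCover.lintegral_oscInt_le {p q : ℝ} {φ' : ℝ → ℝ} {U : Set ℝ} {c κ : ℝ} {N n : ℕ}
    {J : ℕ → Set ℝ} (h : PhaseCover p q φ' U c κ N n J) (hc : 0 < c) (hpq : p ≤ q)
    (hUm : MeasurableSet U) (hU : U ⊆ Icc p q)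
    (hφ : Continuous φ) (hφ' : Continuous φ') (hd : ∀ s ∈ Ioo p q, HasDerivAt φ (φ' s) s)
    (hb₁c : Continuous fun x : ℝ × ℝ => b₁ x.1 x.2)
    (hbd : ∀ s t, HasDerivAt (fun s => b s t) (b₁ s t) s) (hp : ∀ t, b p t = 0)
    (hf : Measurable f) {K F : ℝ} (hb₁ : ∀ s t, ‖b₁ s t‖ ≤ K) (hF : ∀ t, ‖f t‖ ≤ F) :
    ∫⁻ s in U, ‖oscInt φ b f s‖ₑ ^ 2 * ENNReal.ofReal |φ' s| ≤
      ENNReal.ofReal ((q - p) ^ 2 * (N * (n + 1)) * (2 * Real.pi) * K ^ 2) *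
        ∫⁻ t in I, ‖f t‖ₑ ^ 2 := by
  have hK : 0 ≤ K := (norm_nonneg _).trans (hb₁ 0 0)
  have hF0 : 0 ≤ F := (norm_nonneg _).trans (hF 0)
  have hb₁m : Measurable fun x : ℝ × ℝ => b₁ x.1 x.2 := hb₁c.measurable
  set u : ℝ → ℝ → ℂ := fun v => I.indicator fun t => b₁ v t * f t with hu
  have hum : Measurable fun x : ℝ × ℝ => u x.1 x.2 := by
    have : (fun x : ℝ × ℝ => u x.1 x.2) =
        (Prod.snd ⁻¹' I).indicator fun x : ℝ × ℝ => b₁ x.1 x.2 * f x.2 := by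
      ext x; simp [hu, indicator]
    rw [this]
    exact Measurable.indicator (by fun_prop) (measurable_snd measurableSet_Icc)
  have hGm : Measurable fun x : ℝ × ℝ => fourierS (u x.1) x.2 := by
    have : Measurable (Function.uncurry fun (x : ℝ × ℝ) (t : ℝ) =>
        Complex.exp (-Complex.I * (t * x.2 : ℝ)) * u x.1 t) := by
      unfold Function.uncurry
      have h2 : Measurable fun x : (ℝ × ℝ) × ℝ => u x.1.1 x.2 :=
        hum.comp (measurable_fst.fst.prodMk measurable_snd)
      exact Measurable.mul (by fun_prop) h2
    exact this.stronglyMeasurable.integral_prod_right.measurable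
  have huL : ∀ v r, MemLp (u v) r := by
    intro v r
    have h0 : MemLp (fun t => b₁ v t * f t) r (volume.restrict I) := by
      refine MemLp.of_bound ?_ (K * F) (.of_forall fun t => ?_)
      · have := hb₁m.comp (measurable_prodMk_left (x := v))
        exact (this.mul hf).aestronglyMeasurable
      · rw [norm_mul]
        exact mul_le_mul (hb₁ v t) (hF t) (norm_nonneg _) hK
    exact (memLp_indicator_iff_restrict measurableSet_Icc).2 h0
  have hplan : ∀ v, ∫⁻ y, ‖fourierS (u v) y‖ₑ ^ 2 ≤
      ENNReal.ofReal (2 * Real.pi * K ^ 2) * ∫⁻ t in I, ‖f t‖ₑ ^ 2 := by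
    intro v
    rw [lintegral_enorm_sq_fourierS (memLp_one_iff_integrable.1 (huL v 1)) (huL v 2),
      ENNReal.ofReal_mul (p := 2 * Real.pi) (by positivity), mul_assoc]
    refine mul_le_mul_right ?_ _
    rw [← lintegral_indicator measurableSet_Icc, ← lintegral_const_mul _
      (Measurable.indicator (by fun_prop) measurableSet_Icc)]
    refine lintegral_mono fun t => ?_
    simp only [hu, indicator]
    split_ifs
    · rw [enorm_mul, mul_pow, ENNReal.ofReal_pow hK, ← ofReal_norm (b₁ v t)]
      gcongr
      exact hb₁ v t
    · simp
  have hpt : ∀ s ∈ U, ‖oscInt φ b f s‖ₑ ^ 2 ≤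
      ENNReal.ofReal (q - p) * ∫⁻ v in Ioc p q, ‖fourierS (u v) (φ s)‖ₑ ^ 2 := by
    intro s hs
    refine (pow_le_pow_left' (enorm_oscInt_le hb₁c hbd hp hf hb₁ hF (hU hs)) 2).trans ?_
    have hm : Measurable fun v => fourierS (u v) (φ s) :=
      hGm.comp (measurable_prodMk_right (y := φ s))
    refine (sq_lintegral_le _ hm.enorm.aemeasurable).trans_eq ?_
    rw [Measure.restrict_apply_univ, Real.volume_Ioc]
  have hGm2 : Measurable fun x : ℝ × ℝ =>
      ‖fourierS (u x.2) (φ x.1)‖ₑ ^ 2 * ENNReal.ofReal |φ' x.1| := by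
    have := hGm.comp (measurable_snd.prodMk (hφ.measurable.comp measurable_fst))
    exact (this.enorm.pow_const 2).mul (by fun_prop)
  calc ∫⁻ s in U, ‖oscInt φ b f s‖ₑ ^ 2 * ENNReal.ofReal |φ' s|
      ≤ ∫⁻ s in U, ENNReal.ofReal (q - p) * ∫⁻ v in Ioc p q,
          ‖fourierS (u v) (φ s)‖ₑ ^ 2 * ENNReal.ofReal |φ' s| := by
        refine setLIntegral_mono' hUm fun s hs => ?_
        rw [lintegral_mul_const' _ _ ENNReal.ofReal_ne_top, ← mul_assoc]
        exact mul_le_mul_left (hpt s hs) _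
    _ = ENNReal.ofReal (q - p) * ∫⁻ v in Ioc p q, ∫⁻ s in U,
          ‖fourierS (u v) (φ s)‖ₑ ^ 2 * ENNReal.ofReal |φ' s| := by
        rw [lintegral_const_mul' _ _ ENNReal.ofReal_ne_top,
          lintegral_lintegral_swap (by exact hGm2.aemeasurable)]
    _ ≤ ENNReal.ofReal (q - p) * ∫⁻ _ in Ioc p q, (N * (n + 1) : ℕ) *
          (ENNReal.ofReal (2 * Real.pi * K ^ 2) * ∫⁻ t in I, ‖f t‖ₑ ^ 2) := by
        refine mul_le_mul_right (lintegral_mono fun v => ?_) _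
        -- For fixed `v` the factor `|φ'|` is the Jacobian of `y = φ(s)`, and Plancherel in `y`
        -- finishes.
        refine (h.lintegral_comp_le hc hU hφ hd fun y => ‖fourierS (u v) y‖ₑ ^ 2).trans ?_
        exact mul_le_mul_right (hplan v) _
    _ = _ := by
        have h0 : 0 ≤ q - p := sub_nonneg.2 hpq
        rw [setLIntegral_const, Real.volume_Ioc, ← ENNReal.ofReal_natCast, ← mul_assoc, ← mul_assoc,
          ← ENNReal.ofReal_mul (by positivity), mul_right_comm (ENNReal.ofReal _),
          ← ENNReal.ofReal_mul (by positivity)]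
        rw [← mul_assoc, ← ENNReal.ofReal_mul (by positivity)]
        congr 2
        push_cast
        ring

/-- The amplitude of the derivative of `e^{-itφ(s)} b(s, t)`, with the factor `t` truncated to
`[-1, 1]`. -/
def derivAmp (φ' : ℝ → ℝ) (b b₁ : ℝ → ℝ → ℂ) (s t : ℝ) : ℂ :=
  b₁ s t - Complex.I * φ' s * ((projIcc (-1 : ℝ) 1 (by norm_num) t : ℝ) * b s t)

theorem norm_projIcc_le (t : ℝ) : ‖((projIcc (-1 : ℝ) 1 (by norm_num) t : ℝ) : ℂ)‖ ≤ 1 := by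
  rw [Complex.norm_real, Real.norm_eq_abs]
  exact abs_le.2 (projIcc (-1 : ℝ) 1 (by norm_num) t).2

theorem norm_derivAmp_le {φ' : ℝ → ℝ} {p q K Φ : ℝ} (hΦ : ∀ s ∈ Icc p q, |φ' s| ≤ Φ)
    (hΦ0 : 0 ≤ Φ) (hb : ∀ s t, ‖b s t‖ ≤ K) (hb₁ : ∀ s t, ‖b₁ s t‖ ≤ K)
    (h0 : ∀ s t, s ∉ Ioo p q → b s t = 0) (s t : ℝ) :
    ‖derivAmp φ' b b₁ s t‖ ≤ K + Φ * K := by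
  have hK : 0 ≤ K := (norm_nonneg _).trans (hb 0 0)
  refine (norm_sub_le _ _).trans (add_le_add (hb₁ s t) ?_)
  by_cases hs : s ∈ Ioo p q
  · rw [norm_mul, norm_mul, Complex.norm_I, one_mul, Complex.norm_real, norm_mul,
      Real.norm_eq_abs]
    have h1 := hΦ s (Ioo_subset_Icc_self hs)
    have h2 := norm_projIcc_le t
    calc _ ≤ Φ * (1 * K) := by gcongr; exact hb s t
      _ = _ := by ring
  · rw [h0 s t hs]
    simp only [mul_zero, norm_zero]
    positivity

/-- The fundamental theorem of calculus for `e^{-itφ(s)} b(s, t)`, where the amplitude vanishes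
outside the interval in which the phase is differentiable. -/
theorem integral_exp_mul_derivAmp {p q : ℝ} {φ' : ℝ → ℝ} (hφ : Continuous φ)
    (hφ' : Continuous φ') (hd : ∀ s ∈ Ioo p q, HasDerivAt φ (φ' s) s)
    (hbc : Continuous fun x : ℝ × ℝ => b x.1 x.2) (hb₁c : Continuous fun x : ℝ × ℝ => b₁ x.1 x.2)
    (hbd : ∀ s ∈ Ioo p q, ∀ t, HasDerivAt (fun s => b s t) (b₁ s t) s)
    (h0 : ∀ s t, s ∉ Ioo p q → b s t = 0) (h₁0 : ∀ s t, s ∉ Ioo p q → b₁ s t = 0)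
    {t : ℝ} (ht : t ∈ I) {v w : ℝ} (hvw : v ≤ w) :
    ∫ s in Ioc v w, Complex.exp (-Complex.I * (t * φ s : ℝ)) * derivAmp φ' b b₁ s t =
      Complex.exp (-Complex.I * (t * φ w : ℝ)) * b w t -
        Complex.exp (-Complex.I * (t * φ v : ℝ)) * b v t := by
  have hbct : Continuous fun s => b s t := hbc.comp (by fun_prop : Continuous fun s => (s, t))
  have hb₁ct : Continuous fun s => b₁ s t := hb₁c.comp (by fun_prop : Continuous fun s => (s, t))
  rw [← intervalIntegral.integral_of_le hvw]
  -- The phase need not be differentiable at `p` and `q`, so these two points are excepted. Beyond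
  -- them the function vanishes locally.
  refine integral_eq_of_hasDerivAt_off_countable_of_le
    (fun s => Complex.exp (-Complex.I * (t * φ s : ℝ)) * b s t)
    (fun s => Complex.exp (-Complex.I * (t * φ s : ℝ)) * derivAmp φ' b b₁ s t) hvw
    (s := {p, q}) (by simp) (by fun_prop) (fun s hs => ?_) ?_
  · by_cases hsI : s ∈ Ioo p q
    · have h1 : HasDerivAt (fun s => Complex.exp (-Complex.I * (t * φ s : ℝ)))
          (Complex.exp (-Complex.I * (t * φ s : ℝ)) * (-Complex.I * (t * φ' s : ℝ))) s := by
        have h2 := (((hd s hsI).const_mul t).ofReal_comp).const_mul (-Complex.I)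
        exact h2.cexp
      have h2 : Complex.exp (-Complex.I * (t * φ s : ℝ)) * derivAmp φ' b b₁ s t =
          Complex.exp (-Complex.I * (t * φ s : ℝ)) * (-Complex.I * (t * φ' s : ℝ)) * b s t +
            Complex.exp (-Complex.I * (t * φ s : ℝ)) * b₁ s t := by
        rw [derivAmp, projIcc_of_mem _ ht]
        push_cast
        ring
      rw [h2]
      exact h1.mul (hbd s hsI t)
    · have hloc : ∀ᶠ s' in nhds s, s' ∉ Ioo p q := by
        have hmem : s ∈ (Icc p q)ᶜ := by
          intro hs'
          apply hs.2
          by_contra hne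
          simp only [mem_insert_iff, mem_singleton_iff, not_or] at hne
          exact hsI ⟨lt_of_le_of_ne hs'.1 (Ne.symm hne.1), lt_of_le_of_ne hs'.2 hne.2⟩
        filter_upwards [isClosed_Icc.isOpen_compl.mem_nhds hmem] with s' hs' h
        exact hs' (Ioo_subset_Icc_self h)
      have : Complex.exp (-Complex.I * (t * φ s : ℝ)) * derivAmp φ' b b₁ s t = 0 := by
        simp [derivAmp, h₁0 s t hsI, h0 s t hsI]
      rw [this]
      refine (hasDerivAt_const s (0 : ℂ)).congr_of_eventuallyEq ?_
      filter_upwards [hloc] with s' hs'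
      simp [h0 s' t hs']
  · refine Continuous.intervalIntegrable ?_ _ _
    unfold derivAmp
    fun_prop

/-- Fubini moves the fundamental theorem of calculus from the integrand to the integral. This
supplies the function `k` required by `gagliardo_le`, without differentiating under the integral
sign. -/
theorem oscInt_sub_oscInt {p q : ℝ} {φ' : ℝ → ℝ} (hφ : Continuous φ)
    (hφ' : Continuous φ') (hd : ∀ s ∈ Ioo p q, HasDerivAt φ (φ' s) s)
    (hbc : Continuous fun x : ℝ × ℝ => b x.1 x.2) (hb₁c : Continuous fun x : ℝ × ℝ => b₁ x.1 x.2)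
    (hbd : ∀ s t, HasDerivAt (fun s => b s t) (b₁ s t) s)
    (h0 : ∀ s t, s ∉ Ioo p q → b s t = 0) (h₁0 : ∀ s t, s ∉ Ioo p q → b₁ s t = 0)
    (hf : Measurable f) {K F Φ : ℝ}
    (hΦ : ∀ s ∈ Icc p q, |φ' s| ≤ Φ) (hΦ0 : 0 ≤ Φ) (hb : ∀ s t, ‖b s t‖ ≤ K)
    (hb₁ : ∀ s t, ‖b₁ s t‖ ≤ K) (hF : ∀ t, ‖f t‖ ≤ F) {v w : ℝ} (hvw : v ≤ w) :
    oscInt φ b f w - oscInt φ b f v = ∫ s in Ioc v w, oscInt φ (derivAmp φ' b b₁) f s := by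
  have hK : 0 ≤ K := (norm_nonneg _).trans (hb 0 0)
  have hbm : Measurable fun x : ℝ × ℝ => b x.1 x.2 := hbc.measurable
  have hb₁m : Measurable fun x : ℝ × ℝ => b₁ x.1 x.2 := hb₁c.measurable
  have hint : ∀ s, IntegrableOn (fun t => Complex.exp (-Complex.I * (t * φ s : ℝ)) *
      (b s t * f t)) I := by
    intro s
    have hm : Measurable fun t => b s t := hbm.comp (measurable_prodMk_left (x := s))
    refine Integrable.of_bound (Measurable.aestronglyMeasurable (by fun_prop)) (K * F)
      (.of_forall fun t => ?_)
    rw [norm_mul, norm_exp_neg_I_mul, one_mul, norm_mul]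
    exact mul_le_mul (hb s t) (hF t) (norm_nonneg _) hK
  unfold oscInt
  rw [integral_integral_swap (integrable_bddProd (C := (K + Φ * K) * F) ?_ ?_),
    ← integral_sub (hint w) (hint v)]
  · refine setIntegral_congr_fun measurableSet_Icc fun t ht => ?_
    have h1 := integral_exp_mul_derivAmp hφ hφ' hd hbc hb₁c (fun s _ => hbd s) h0 h₁0 ht hvw
    simp only [← mul_assoc]
    rw [integral_mul_const, h1]
    ring
  · unfold Function.uncurry derivAmp
    have := hφ.measurable
    have := hφ'.measurable
    have : Measurable fun t : ℝ => ((projIcc (-1 : ℝ) 1 (by norm_num) t : ℝ)) :=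
      (continuous_subtype_val.comp continuous_projIcc).measurable
    fun_prop
  · intro s t
    rw [norm_mul, norm_exp_neg_I_mul, one_mul, norm_mul]
    exact mul_le_mul (norm_derivAmp_le hΦ hΦ0 hb hb₁ h0 s t) (hF t) (norm_nonneg _)
      (by positivity)

end OscInt

/-! ### The bound at a fixed frequency -/

section Core

variable {φ φ' : ℝ → ℝ} {b b₁ : ℝ → ℝ → ℂ} {f : ℝ → ℂ}

/-- The large factor `φ'` is independent of `t` and leaves the integral, so the derivative is
expressed by oscillatory integrals with bounded amplitudes. -/
theorem oscInt_derivAmp (hb : Measurable fun x : ℝ × ℝ => b x.1 x.2)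
    (hb₁ : Measurable fun x : ℝ × ℝ => b₁ x.1 x.2) (hf : Measurable f) {K F : ℝ}
    (hbK : ∀ s t, ‖b s t‖ ≤ K) (hb₁K : ∀ s t, ‖b₁ s t‖ ≤ K) (hF : ∀ t, ‖f t‖ ≤ F) (s : ℝ) :
    oscInt φ (derivAmp φ' b b₁) f s = oscInt φ b₁ f s - Complex.I * φ' s *
      oscInt φ (fun s t => (projIcc (-1 : ℝ) 1 (by norm_num) t : ℝ) * b s t) f s := by
  have hK : 0 ≤ K := (norm_nonneg _).trans (hbK 0 0)
  have hint : ∀ u : ℝ → ℝ → ℂ, (Measurable fun x : ℝ × ℝ => u x.1 x.2) → (∀ s t, ‖u s t‖ ≤ K) →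
      IntegrableOn (fun t => Complex.exp (-Complex.I * (t * φ s : ℝ)) * (u s t * f t)) I := by
    intro u hu huK
    have hm : Measurable fun t => u s t := hu.comp (measurable_prodMk_left (x := s))
    refine Integrable.of_bound (Measurable.aestronglyMeasurable (by fun_prop)) (K * F)
      (.of_forall fun t => ?_)
    rw [norm_mul, norm_exp_neg_I_mul, one_mul, norm_mul]
    exact mul_le_mul (huK s t) (hF t) (norm_nonneg _) hK
  have hτ : Measurable fun t : ℝ => ((projIcc (-1 : ℝ) 1 (by norm_num) t : ℝ)) :=
    (continuous_subtype_val.comp continuous_projIcc).measurable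
  have h2 := hint (fun s t => (projIcc (-1 : ℝ) 1 (by norm_num) t : ℝ) * b s t) (by fun_prop)
    (fun s t => by
      rw [norm_mul]
      calc _ ≤ 1 * K := mul_le_mul (norm_projIcc_le t) (hbK s t) (norm_nonneg _) zero_le_one
        _ = K := one_mul K)
  unfold oscInt
  rw [← integral_const_mul, ← integral_sub (hint b₁ hb₁ hb₁K) (h2.const_mul _)]
  refine integral_congr_ae (.of_forall fun t => ?_)
  simp only [derivAmp]
  ring

/-- The constant in the `L² → H^{1/2}` bound for oscillatory integrals. -/
def coreConst (ℓ c κ : ℝ) (N n m₀ : ℕ) : ℝ :=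
  2 * ℓ + 40 * ((2 * κ + 2 / c) * (2 * ℓ) + 2 * κ * (ℓ ^ 2 * (N * (n + 1)) * (2 * Real.pi)) +
    32 * N * n * (m₀ + 1)) + 4 * (4 * ℓ + 2 * (ℓ ^ 2 * (N * (n + 1)) * (2 * Real.pi)))

/-- The `L² → H^{1/2}` bound for one dimensional oscillatory integrals. -/
theorem PhaseCover.lintegral_add_gagliardo_le {p q : ℝ} {U : Set ℝ} {c κ : ℝ} {N n : ℕ}
    {J : ℕ → Set ℝ} (h : PhaseCover p q φ' U c κ N n J) (hc : 0 < c) (hκ : 2 ≤ κ) (hpq : p ≤ q)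
    (hUm : MeasurableSet U) (hU : U ⊆ Icc p q)
    (hφ : Continuous φ) (hφ' : Continuous φ') (hd : ∀ s ∈ Ioo p q, HasDerivAt φ (φ' s) s)
    {m₀ : ℕ} (hm₀ : ∀ s ∈ Icc p q, 1 + |φ' s| ≤ 2 ^ m₀)
    (hbc : Continuous fun x : ℝ × ℝ => b x.1 x.2) (hb₁c : Continuous fun x : ℝ × ℝ => b₁ x.1 x.2)
    (hbd : ∀ s t, HasDerivAt (fun s => b s t) (b₁ s t) s)
    (h0 : ∀ s t, s ∉ Ioo p q → b s t = 0) (h₁0 : ∀ s t, s ∉ Ioo p q → b₁ s t = 0)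
    (hU0 : ∀ s t, s ∉ U → b s t = 0) (hU₁0 : ∀ s t, s ∉ U → b₁ s t = 0)
    (hf : Measurable f) {K F : ℝ} (hb : ∀ s t, ‖b s t‖ ≤ K) (hb₁ : ∀ s t, ‖b₁ s t‖ ≤ K)
    (hF : ∀ t, ‖f t‖ ≤ F) :
    (∫⁻ s, ‖oscInt φ b f s‖ₑ ^ 2) + 4 * gagliardo (oscInt φ b f) ≤
      ENNReal.ofReal (K ^ 2 * coreConst (q - p) c κ N n m₀) * ∫⁻ t in I, ‖f t‖ₑ ^ 2 := by
  have hK : 0 ≤ K := (norm_nonneg _).trans (hb 0 0)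
  have hℓ : 0 ≤ q - p := sub_nonneg.2 hpq
  have hκ0 : 0 ≤ κ := by linarith
  set X := ∫⁻ t in I, ‖f t‖ₑ ^ 2 with hX
  set τ : ℝ → ℝ := fun t => (projIcc (-1 : ℝ) 1 (by norm_num) t : ℝ) with hτ
  have hτc : Continuous τ := continuous_subtype_val.comp continuous_projIcc
  have hτ1 : ∀ t, ‖(τ t : ℂ)‖ ≤ 1 := norm_projIcc_le
  have hτK : ∀ (u : ℝ → ℝ → ℂ), (∀ s t, ‖u s t‖ ≤ K) → ∀ s t, ‖(τ t : ℂ) * u s t‖ ≤ K := by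
    intro u hu s t
    rw [norm_mul]
    calc _ ≤ 1 * K := mul_le_mul (hτ1 t) (hu s t) (norm_nonneg _) zero_le_one
      _ = K := one_mul K
  set H := oscInt φ b f with hH
  set P := oscInt φ b₁ f with hP
  set Q := oscInt φ (fun s t => (τ t : ℂ) * b s t) f with hQ
  set k := oscInt φ (derivAmp φ' b b₁) f with hk
  have hHm : Measurable H := measurable_oscInt hφ.measurable hbc.measurable hf
  have hPm : Measurable P := measurable_oscInt hφ.measurable hb₁c.measurable hf
  have hQm : Measurable Q := measurable_oscInt hφ.measurable
    (by fun_prop : Continuous fun x : ℝ × ℝ => (τ x.2 : ℂ) * b x.1 x.2).measurable hf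
  have hkeq : ∀ s, k s = P s - Complex.I * φ' s * Q s := fun s =>
    oscInt_derivAmp hbc.measurable hb₁c.measurable hf hb hb₁ hF s
  have hkm : Measurable k := by
    have := hφ'.measurable
    rw [show k = fun s => P s - Complex.I * φ' s * Q s from funext hkeq]
    fun_prop
  have hz : ∀ (u : ℝ → ℝ → ℂ), (∀ s t, s ∉ U → u s t = 0) → ∀ s ∉ U, oscInt φ u f s = 0 := by
    intro u hu s hs
    simp [oscInt, hu s _ hs]
  have hHz : ∀ s ∉ U, H s = 0 := hz b hU0
  have hkz : ∀ s ∉ U, k s = 0 := by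
    intro s hs
    rw [hkeq, hP, hQ, hz b₁ hU₁0 s hs,
      hz (fun s t => (τ t : ℂ) * b s t) (fun s t hs => by simp [hU0 s t hs]) s hs]
    simp
  have hres : ∀ g : ℝ → ENNReal, (∀ s ∉ U, g s = 0) → ∫⁻ s, g s = ∫⁻ s in U, g s := by
    intro g hg
    rw [← lintegral_indicator hUm]
    refine lintegral_congr fun s => ?_
    by_cases hs : s ∈ U
    · rw [indicator_of_mem hs]
    · rw [indicator_of_notMem hs, hg s hs]
  have hvol : volume U ≤ ENNReal.ofReal (q - p) := (measure_mono hU).trans_eq Real.volume_Icc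
  have hsup : ∀ u : ℝ → ℝ → ℂ, (∀ s t, ‖u s t‖ ≤ K) →
      ∫⁻ s in U, ‖oscInt φ u f s‖ₑ ^ 2 ≤ ENNReal.ofReal (2 * K ^ 2 * (q - p)) * X := by
    intro u hu
    calc ∫⁻ s in U, ‖oscInt φ u f s‖ₑ ^ 2 ≤ ∫⁻ _ in U, ENNReal.ofReal (2 * K ^ 2) * X :=
          lintegral_mono fun s => enorm_sq_oscInt_le hf hu s
      _ ≤ ENNReal.ofReal (2 * K ^ 2) * X * ENNReal.ofReal (q - p) := by
          rw [setLIntegral_const]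
          gcongr
      _ = _ := by rw [mul_right_comm, ← ENNReal.ofReal_mul (by positivity)]
  have hT0 : ∫⁻ s, ‖H s‖ₑ ^ 2 ≤ ENNReal.ofReal (2 * K ^ 2 * (q - p)) * X := by
    rw [hres _ (fun s hs => by simp [hHz s hs])]
    exact hsup b hb
  set V := (q - p) ^ 2 * (N * (n + 1)) * (2 * Real.pi) * K ^ 2 with hV
  have hV0 : 0 ≤ V := by positivity
  have hHV : ∫⁻ s in U, ‖H s‖ₑ ^ 2 * ENNReal.ofReal |φ' s| ≤ ENNReal.ofReal V * X :=
    h.lintegral_oscInt_le hc hpq hUm hU hφ hφ' hd hb₁c hbd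
      (fun t => h0 p t (by simp)) hf hb₁ hF
  -- The factor `τ(t)` does not involve `s`, so the amplitude `τ b` has derivative `τ b₁` with the
  -- same bound `K`.
  have hQV : ∫⁻ s in U, ‖Q s‖ₑ ^ 2 * ENNReal.ofReal |φ' s| ≤ ENNReal.ofReal V * X :=
    h.lintegral_oscInt_le hc hpq hUm hU hφ hφ' hd (b₁ := fun s t => (τ t : ℂ) * b₁ s t)
      (by fun_prop) (fun s t => (hbd s t).const_mul _)
      (fun t => by simp [h0 p t (by simp)]) hf (hτK b₁ hb₁) hF
  have hr0 : ∀ s, 0 < scale p q φ' s := fun s =>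
    (by positivity : (0 : ℝ) < ((2 : ℝ) ^ m₀)⁻¹).trans_le (inv_le_scale hpq hm₀ s)
  -- the part of the seminorm at distances above the scale
  have hT1 : ∫⁻ s, ‖H s‖ₑ ^ 2 * ENNReal.ofReal (scale p q φ' s)⁻¹ ≤
      ENNReal.ofReal ((2 * κ + 2 / c) * (2 * K ^ 2 * (q - p)) + 2 * κ * V +
        2 * K ^ 2 * (16 * N * n * (m₀ + 1))) * X := by
    obtain ⟨W, hWm, hWi, hW⟩ := h.exists_weight hU hpq hκ hc hφ' hm₀
    have hφm := hφ'.measurable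
    rw [hres _ (fun s hs => by simp [hHz s hs])]
    calc ∫⁻ s in U, ‖H s‖ₑ ^ 2 * ENNReal.ofReal (scale p q φ' s)⁻¹
        ≤ ∫⁻ s in U, (ENNReal.ofReal (2 * κ + 2 / c) * ‖H s‖ₑ ^ 2 +
            ENNReal.ofReal (2 * κ) * (‖H s‖ₑ ^ 2 * ENNReal.ofReal |φ' s|) +
            ENNReal.ofReal (2 * K ^ 2) * X * W s) := by
          refine setLIntegral_mono' hUm fun s hs => ?_
          refine (mul_le_mul_right (hW s hs) _).trans ?_
          rw [mul_add]
          refine add_le_add (le_of_eq ?_) (mul_le_mul_left (enorm_sq_oscInt_le hf hb s) _)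
          rw [show 2 * κ * (1 + |φ' s|) + 2 / c = (2 * κ + 2 / c) + 2 * κ * |φ' s| by ring,
            ENNReal.ofReal_add (by positivity) (by positivity),
            ENNReal.ofReal_mul (p := 2 * κ) (by positivity)]
          ring
      _ = ENNReal.ofReal (2 * κ + 2 / c) * (∫⁻ s in U, ‖H s‖ₑ ^ 2) +
            ENNReal.ofReal (2 * κ) * (∫⁻ s in U, ‖H s‖ₑ ^ 2 * ENNReal.ofReal |φ' s|) +
            ENNReal.ofReal (2 * K ^ 2) * X * ∫⁻ s in U, W s := by
          rw [lintegral_add_left (by fun_prop), lintegral_add_left (by fun_prop),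
            lintegral_const_mul _ (by fun_prop), lintegral_const_mul _ (by fun_prop),
            lintegral_const_mul _ hWm]
      _ ≤ ENNReal.ofReal (2 * κ + 2 / c) * (ENNReal.ofReal (2 * K ^ 2 * (q - p)) * X) +
            ENNReal.ofReal (2 * κ) * (ENNReal.ofReal V * X) +
            ENNReal.ofReal (2 * K ^ 2) * X * (16 * N * n * (m₀ + 1) : ℕ) := by
          gcongr
          · exact hsup b hb
          · exact (setLIntegral_le_lintegral _ _).trans hWi
      _ = _ := by
          rw [← ENNReal.ofReal_natCast, mul_right_comm (ENNReal.ofReal (2 * K ^ 2)), ← mul_assoc,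
            ← mul_assoc, ← ENNReal.ofReal_mul (by positivity), ← ENNReal.ofReal_mul (by positivity),
            ← ENNReal.ofReal_mul (by positivity), ← add_mul, ← add_mul,
            ← ENNReal.ofReal_add (by positivity) (by positivity),
            ← ENNReal.ofReal_add (by positivity) (by positivity)]
          congr 2
          push_cast
          ring
  -- the part of the seminorm at distances below the scale
  have hT2 : ∫⁻ s, ‖k s‖ₑ ^ 2 * ENNReal.ofReal (scale p q φ' s) ≤
      ENNReal.ofReal (2 * (2 * K ^ 2 * (q - p)) + 2 * V) * X := by
    have hφm := hφ'.measurable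
    rw [hres _ (fun s hs => by simp [hkz s hs])]
    calc ∫⁻ s in U, ‖k s‖ₑ ^ 2 * ENNReal.ofReal (scale p q φ' s)
        ≤ ∫⁻ s in U, (2 * (‖Q s‖ₑ ^ 2 * ENNReal.ofReal |φ' s|) + 2 * ‖P s‖ₑ ^ 2) := by
          refine setLIntegral_mono' hUm fun s hs => ?_
          have hr := scale_le_inv (φ' := φ') (hU hs)
          rw [hkeq]
          refine (mul_le_mul_left (enorm_sub_sq_le _ _) _).trans ?_
          rw [add_mul, mul_assoc, mul_assoc 2 (‖P s‖ₑ ^ 2)]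
          refine add_le_add (mul_le_mul_right ?_ _) (mul_le_mul_right ?_ _)
          · rw [enorm_mul, mul_pow, mul_comm (_ ^ 2), mul_assoc]
            refine mul_le_mul_right ?_ _
            rw [← ofReal_norm, norm_mul, Complex.norm_I, one_mul, Complex.norm_real,
              Real.norm_eq_abs, ← ENNReal.ofReal_pow (abs_nonneg _),
              ← ENNReal.ofReal_mul (by positivity)]
            refine ENNReal.ofReal_le_ofReal ?_
            calc |φ' s| ^ 2 * scale p q φ' s ≤ |φ' s| ^ 2 * (1 + |φ' s|)⁻¹ := by gcongr
              _ ≤ |φ' s| := by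
                rw [← div_eq_mul_inv, div_le_iff₀ (by positivity)]
                nlinarith [abs_nonneg (φ' s)]
          · calc ‖P s‖ₑ ^ 2 * ENNReal.ofReal (scale p q φ' s) ≤ ‖P s‖ₑ ^ 2 * 1 := by
                  gcongr
                  refine ENNReal.ofReal_le_one.2 (hr.trans (inv_le_one_of_one_le₀ ?_))
                  linarith [abs_nonneg (φ' s)]
              _ = _ := mul_one _
      _ = 2 * (∫⁻ s in U, ‖Q s‖ₑ ^ 2 * ENNReal.ofReal |φ' s|) + 2 * ∫⁻ s in U, ‖P s‖ₑ ^ 2 := by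
          rw [lintegral_add_left (by fun_prop), lintegral_const_mul _ (by fun_prop),
            lintegral_const_mul _ (by fun_prop)]
      _ ≤ 2 * (ENNReal.ofReal V * X) + 2 * (ENNReal.ofReal (2 * K ^ 2 * (q - p)) * X) := by
          gcongr
          exact hsup b₁ hb₁
      _ = _ := by
          rw [show (2 : ENNReal) = ENNReal.ofReal 2 by norm_num, ← mul_assoc, ← mul_assoc,
            ← ENNReal.ofReal_mul (by positivity), ← ENNReal.ofReal_mul (by positivity), ← add_mul,
            ← ENNReal.ofReal_add (by positivity) (by positivity), add_comm]
  have hΦ : ∀ s ∈ Icc p q, |φ' s| ≤ 2 ^ m₀ := fun s hs => by linarith [hm₀ s hs]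
  have hG := gagliardo_le hHm hkm hr0 (abs_scale_sub_le hpq) (fun s u hu => by
    rw [hH, oscInt_sub_oscInt hφ hφ' hd hbc hb₁c hbd h0 h₁0 hf hΦ (by positivity) hb hb₁ hF
      (by linarith)]
    exact enorm_integral_le_lintegral_enorm _)
  calc (∫⁻ s, ‖H s‖ₑ ^ 2) + 4 * gagliardo H
      ≤ ENNReal.ofReal (2 * K ^ 2 * (q - p)) * X + 4 * (10 *
        (ENNReal.ofReal ((2 * κ + 2 / c) * (2 * K ^ 2 * (q - p)) + 2 * κ * V +
        2 * K ^ 2 * (16 * N * n * (m₀ + 1))) * X) +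
          ENNReal.ofReal (2 * (2 * K ^ 2 * (q - p)) + 2 * V) * X) := by
        refine add_le_add hT0 (mul_le_mul_right (hG.trans ?_) _)
        exact add_le_add (mul_le_mul_right hT1 _) hT2
    _ = _ := by
        rw [show (4 : ENNReal) = ENNReal.ofReal 4 by norm_num,
          show (10 : ENNReal) = ENNReal.ofReal 10 by norm_num, ← mul_assoc,
          ← ENNReal.ofReal_mul (by positivity), ← add_mul,
          ← ENNReal.ofReal_add (by positivity) (by positivity), ← mul_assoc,
          ← ENNReal.ofReal_mul (by positivity), ← add_mul,
          ← ENNReal.ofReal_add (by positivity) (by positivity), coreConst]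
        congr 2
        rw [hV]
        ring

end Core

/-! ### The partial Fourier transform of Schwartz functions -/

theorem memLp_two_of_integrable_of_bound {α : Type*} [MeasurableSpace α] {μ : Measure α}
    {u : α → ℂ} (hu : Integrable u μ) {C : ℝ} (hC : ∀ x, ‖u x‖ ≤ C) : MemLp u 2 μ := by
  refine (memLp_two_iff_integrable_sq_norm hu.aestronglyMeasurable).2 ?_
  refine (hu.norm.const_mul C).mono' (hu.aestronglyMeasurable.norm.pow 2) (.of_forall fun x => ?_)
  rw [Real.norm_of_nonneg (by positivity), sq]
  exact mul_le_mul_of_nonneg_right (hC x) (norm_nonneg _)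

section FourierX

variable {d : ℕ}

/-- Uniform decay of a Schwartz function in the first variable. -/
theorem schwartz_norm_le (g : 𝓢(E d × ℝ, ℂ)) : ∃ C : ℝ, 0 ≤ C ∧ ∀ x t,
    ‖g (x, t)‖ ≤ C * (1 + ‖x‖) ^ (-((d : ℝ) + 1)) := by
  have h := g.one_add_le_sup_seminorm_apply (𝕜 := ℂ) (m := (d + 1, 0)) (k := d + 1) (n := 0)
    le_rfl le_rfl
  simp only [norm_iteratedFDeriv_zero] at h
  refine ⟨_, le_trans (by positivity) (h 0), fun x t => ?_⟩
  rw [Real.rpow_neg (by positivity), ← div_eq_mul_inv, le_div_iff₀ (by positivity)]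
  refine le_trans ?_ (h (x, t))
  rw [mul_comm, show (d : ℝ) + 1 = ((d + 1 : ℕ) : ℝ) by push_cast; ring, Real.rpow_natCast]
  gcongr
  exact norm_fst_le (x, t)

theorem integrable_one_add_norm_rpow :
    Integrable fun x : E d => (1 + ‖x‖) ^ (-((d : ℝ) + 1)) :=
  integrable_one_add_norm (by simp)

theorem integrable_schwartz_slice (g : 𝓢(E d × ℝ, ℂ)) (t : ℝ) :
    Integrable fun x : E d => g (x, t) := by
  obtain ⟨C, -, hC⟩ := schwartz_norm_le g
  refine (integrable_one_add_norm_rpow.const_mul C).mono'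
    (Continuous.aestronglyMeasurable ?_) (.of_forall fun x => hC x t)
  exact g.continuous.comp (by fun_prop)

theorem memLp_schwartz_slice (g : 𝓢(E d × ℝ, ℂ)) (t : ℝ) :
    MemLp (fun x : E d => g (x, t)) 2 := by
  obtain ⟨C, hC0, hC⟩ := schwartz_norm_le g
  refine memLp_two_of_integrable_of_bound (integrable_schwartz_slice g t) (C := C) fun x => ?_
  refine (hC x t).trans (mul_le_of_le_one_right hC0 ?_)
  exact Real.rpow_le_one_of_one_le_of_nonpos (by linarith [norm_nonneg x]) (by linarith)

theorem measurable_fourierX (g : 𝓢(E d × ℝ, ℂ)) :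
    Measurable fun y : E d × ℝ => fourierX g y.1 y.2 := by
  have : Continuous (Function.uncurry fun (y : E d × ℝ) (x : E d) =>
      Complex.exp (-Complex.I * (inner ℝ x y.1 : ℝ)) * g (x, y.2)) := by
    have := g.continuous
    unfold Function.uncurry
    fun_prop
  exact this.stronglyMeasurable.integral_prod_right.measurable

theorem exists_norm_fourierX_le (g : 𝓢(E d × ℝ, ℂ)) : ∃ F : ℝ, ∀ ξ t, ‖fourierX g ξ t‖ ≤ F := by
  obtain ⟨C, hC0, hC⟩ := schwartz_norm_le g
  refine ⟨∫ x : E d, C * (1 + ‖x‖) ^ (-((d : ℝ) + 1)), fun ξ t => ?_⟩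
  refine norm_integral_le_of_norm_le (integrable_one_add_norm_rpow.const_mul C)
    (.of_forall fun x => ?_)
  rw [norm_mul, norm_exp_neg_I_mul, one_mul]
  exact hC x t

theorem lintegral_fourierX_sq (g : 𝓢(E d × ℝ, ℂ)) (t : ℝ) :
    ∫⁻ ξ, ‖fourierX g ξ t‖ₑ ^ 2 = ENNReal.ofReal ((2 * Real.pi) ^ d) * ∫⁻ x, ‖g (x, t)‖ₑ ^ 2 := by
  have := lintegral_enorm_sq_integral_exp_neg (integrable_schwartz_slice g t)
    (memLp_schwartz_slice g t)
  rw [finrank_euclideanSpace_fin] at this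
  exact this

end FourierX

/-! ### Half derivatives of families of functions -/

/-- Tonelli's theorem for the `H^{1/2}` norm of a family of functions. -/
theorem lintegral_add_gagliardo_swap {Y : Type*} [MeasurableSpace Y] {ν : Measure Y} [SFinite ν]
    {F : Y → ℝ → ℂ} (hF : Measurable fun z : Y × ℝ => F z.1 z.2) :
    ∫⁻ y, ((∫⁻ s, ‖F y s‖ₑ ^ 2) + 4 * gagliardo (F y)) ∂ν =
      (∫⁻ s, ∫⁻ y, ‖F y s‖ₑ ^ 2 ∂ν) + 4 * ∫⁻ u in Ioi (0 : ℝ), ∫⁻ s : ℝ,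
        (∫⁻ y, ‖F y (s + u) - F y s‖ₑ ^ 2 ∂ν) * ENNReal.ofReal ((u ^ 2)⁻¹) := by
  have h1 : Measurable fun z : Y × ℝ => ‖F z.1 z.2‖ₑ ^ 2 := hF.enorm.pow_const 2
  have h2 : Measurable fun z : (Y × ℝ) × ℝ =>
      ‖F z.1.1 (z.2 + z.1.2) - F z.1.1 z.2‖ₑ ^ 2 * ENNReal.ofReal ((z.1.2 ^ 2)⁻¹) := by
    have h3 : Measurable fun z : (Y × ℝ) × ℝ => F z.1.1 (z.2 + z.1.2) :=
      hF.comp (measurable_fst.fst.prodMk (measurable_snd.add measurable_fst.snd))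
    have h4 : Measurable fun z : (Y × ℝ) × ℝ => F z.1.1 z.2 :=
      hF.comp (measurable_fst.fst.prodMk measurable_snd)
    exact ((h3.sub h4).enorm.pow_const 2).mul (by fun_prop)
  have h5 : Measurable fun z : Y × ℝ => ∫⁻ s, ‖F z.1 (s + z.2) - F z.1 s‖ₑ ^ 2 *
      ENNReal.ofReal ((z.2 ^ 2)⁻¹) := h2.lintegral_prod_right'
  have e1 : ∫⁻ y, (∫⁻ s, ‖F y s‖ₑ ^ 2) ∂ν = ∫⁻ s, ∫⁻ y, ‖F y s‖ₑ ^ 2 ∂ν :=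
    lintegral_lintegral_swap (f := fun y s => ‖F y s‖ₑ ^ 2) h1.aemeasurable
  have e2 : ∫⁻ y, gagliardo (F y) ∂ν = ∫⁻ u in Ioi (0 : ℝ), ∫⁻ y, (∫⁻ s : ℝ,
      ‖F y (s + u) - F y s‖ₑ ^ 2 * ENNReal.ofReal ((u ^ 2)⁻¹)) ∂ν :=
    lintegral_lintegral_swap (f := fun y u => ∫⁻ s : ℝ,
      ‖F y (s + u) - F y s‖ₑ ^ 2 * ENNReal.ofReal ((u ^ 2)⁻¹)) h5.aemeasurable
  have e3 : ∀ u : ℝ, ∫⁻ y, (∫⁻ s : ℝ, ‖F y (s + u) - F y s‖ₑ ^ 2 *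
      ENNReal.ofReal ((u ^ 2)⁻¹)) ∂ν = ∫⁻ s : ℝ, (∫⁻ y, ‖F y (s + u) - F y s‖ₑ ^ 2 ∂ν) * ENNReal.ofReal ((u ^ 2)⁻¹) := by
    intro u
    have h6 : Measurable fun z : Y × ℝ => ‖F z.1 (z.2 + u) - F z.1 z.2‖ₑ ^ 2 *
        ENNReal.ofReal ((u ^ 2)⁻¹) := by
      have h3 : Measurable fun z : Y × ℝ => F z.1 (z.2 + u) :=
        hF.comp (measurable_fst.prodMk (measurable_snd.add_const u))
      exact ((h3.sub hF).enorm.pow_const 2).mul_const _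
    have e4 := lintegral_lintegral_swap (μ := ν) (ν := (volume : Measure ℝ))
      (f := fun y s => ‖F y (s + u) - F y s‖ₑ ^ 2 * ENNReal.ofReal ((u ^ 2)⁻¹)) h6.aemeasurable
    rw [e4]
    refine lintegral_congr fun s => ?_
    rw [lintegral_mul_const' _ _ ENNReal.ofReal_ne_top]
  rw [lintegral_add_left h1.lintegral_prod_right', lintegral_const_mul' _ _ (by simp), e1, e2]
  simp only [e3]

/-- The half derivative of a function with integrable and bounded Fourier data. -/
theorem lintegral_halfDeriv_sq_le {h : ℝ → ℂ} (hh : Integrable h) (hh2 : MemLp h 2)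
    (hi : Integrable (halfDerivFourier h)) (hi2 : MemLp (halfDerivFourier h) 2) :
    ∫⁻ s, ‖halfDeriv h s‖ₑ ^ 2 ≤ (∫⁻ s, ‖h s‖ₑ ^ 2) + 4 * gagliardo h := by
  have h1 := lintegral_enorm_sq_integral_exp hi hi2
  simp only [Module.finrank_self, pow_one] at h1
  have h2 : ∀ s, ‖halfDeriv h s‖ₑ ^ 2 = ENNReal.ofReal ((2 * Real.pi)⁻¹ ^ 2) *
      ‖∫ σ : ℝ, Complex.exp (Complex.I * (inner ℝ s σ : ℝ)) * halfDerivFourier h σ‖ₑ ^ 2 := by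
    intro s
    rw [halfDeriv, enorm_mul, mul_pow]
    congr 1
    · rw [← ofReal_norm, ENNReal.ofReal_pow (by positivity)]
      congr 2
      rw [norm_inv, norm_mul, Complex.norm_real, Real.norm_of_nonneg Real.pi_pos.le]
      norm_num
    · simp only [RCLike.inner_apply, conj_trivial, mul_comm s]
  simp only [h2]
  rw [lintegral_const_mul' _ _ ENNReal.ofReal_ne_top, h1]
  calc _ ≤ ENNReal.ofReal ((2 * Real.pi)⁻¹ ^ 2) * (ENNReal.ofReal (2 * Real.pi) *
        (ENNReal.ofReal (2 * Real.pi) * ((∫⁻ s, ‖h s‖ₑ ^ 2) + 4 * gagliardo h))) := by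
        gcongr
        exact lintegral_halfDerivFourier_sq_le hh hh2
    _ = _ := by
        rw [← mul_assoc, ← mul_assoc, ← ENNReal.ofReal_mul (by positivity),
          ← ENNReal.ofReal_mul (by positivity)]
        have : (2 * Real.pi)⁻¹ ^ 2 * (2 * Real.pi) * (2 * Real.pi) = 1 := by
          have := Real.pi_pos
          field_simp
        rw [this, ENNReal.ofReal_one, one_mul]

/-! ### Admissible data and the reduction to fixed frequency -/

/-- A curve `γ 0` with derivatives `γ k` in `(p, q)` and an amplitude `a` with `s`-derivatives
`a₁` and `a₂`, which is supported where one of the first `L` derivatives of the phase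
`⟨γ 0 s, ξ⟩` is comparable to `‖ξ‖`. All functions are defined and continuous everywhere. -/
structure Admissible {d : ℕ} (p q : ℝ) (L : ℕ) (A B K R : ℝ) (γ : ℕ → ℝ → E d)
    (a a₁ a₂ : E d × ℝ × ℝ → ℂ) : Prop where
  le : p ≤ q
  one_le : 1 ≤ L
  A_pos : 0 < A
  B_pos : 0 < B
  K_nonneg : 0 ≤ K
  R_nonneg : 0 ≤ R
  γ_continuous : ∀ k ≤ L + 1, Continuous (γ k)
  γ_hasDerivAt : ∀ k ≤ L, ∀ s ∈ Ioo p q, HasDerivAt (γ k) (γ (k + 1) s) s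
  γ_norm_le : ∀ k, 1 ≤ k → k ≤ L + 1 → ∀ s ∈ Icc p q, ‖γ k s‖ ≤ B
  continuous : Continuous a
  continuous₁ : Continuous a₁
  continuous₂ : Continuous a₂
  hasDerivAt : ∀ ξ s t, HasDerivAt (fun s => a (ξ, s, t)) (a₁ (ξ, s, t)) s
  hasDerivAt₁ : ∀ ξ s t, HasDerivAt (fun s => a₁ (ξ, s, t)) (a₂ (ξ, s, t)) s
  norm_le : ∀ x, ‖a x‖ ≤ K
  norm_le₁ : ∀ x, ‖a₁ x‖ ≤ K
  norm_le₂ : ∀ x, ‖a₂ x‖ ≤ K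
  zero : ∀ ξ s t, s ∉ Ioo p q → a (ξ, s, t) = 0
  zero₁ : ∀ ξ s t, s ∉ Ioo p q → a₁ (ξ, s, t) = 0
  zero₂ : ∀ ξ s t, s ∉ Ioo p q → a₂ (ξ, s, t) = 0
  freq : ∀ ξ s t, R < ‖ξ‖ → a (ξ, s, t) = 0
  nondeg : ∀ ξ s t, s ∈ Icc p q → a (ξ, s, t) ≠ 0 ∨ a₁ (ξ, s, t) ≠ 0 →
    A⁻¹ * ‖ξ‖ ≤ ∑ i ∈ Finset.Icc 1 L, |inner ℝ (γ i s) ξ|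

variable {d : ℕ} {p q : ℝ} {L : ℕ} {A B K R : ℝ} {γ : ℕ → ℝ → E d} {a a₁ a₂ : E d × ℝ × ℝ → ℂ}

theorem measurable_curry_left {α β δ : Type*} [MeasurableSpace α] [MeasurableSpace β]
    [MeasurableSpace δ] {u : α → β → δ} (hu : Measurable fun z : α × β => u z.1 z.2) (x : α) :
    Measurable (u x) :=
  hu.comp measurable_prodMk_left

theorem measurable_curry_right {α β δ : Type*} [MeasurableSpace α] [MeasurableSpace β]
    [MeasurableSpace δ] {u : α → β → δ} (hu : Measurable fun z : α × β => u z.1 z.2) (y : β) :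
    Measurable fun x => u x y :=
  hu.comp measurable_prodMk_right

theorem measurable_comp₂ {α β δ ε : Type*} [MeasurableSpace α] [MeasurableSpace β]
    [MeasurableSpace δ] [MeasurableSpace ε] {u : α → β → δ}
    (hu : Measurable fun z : α × β => u z.1 z.2) {f : ε → α} {g : ε → β} (hf : Measurable f)
    (hg : Measurable g) : Measurable fun e => u (f e) (g e) :=
  hu.comp (hf.prodMk hg)

namespace Admissible

/-- The partial Fourier transform of `𝒜[a, γ] g`, up to a constant factor. -/
def osc (γ₀ : ℝ → E d) (a : E d × ℝ × ℝ → ℂ) (g : E d × ℝ → ℂ) (ξ : E d) (s : ℝ) : ℂ :=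
  oscInt (fun s => inner ℝ (γ₀ s) ξ) (fun s t => a (ξ, s, t)) (fourierX g ξ) s

theorem phase_bound (h : Admissible p q L A B K R γ a a₁ a₂) {k : ℕ} (h1 : 1 ≤ k) (h2 : k ≤ L + 1)
    {s : ℝ} (hs : s ∈ Icc p q) (ξ : E d) : |inner ℝ (γ k s) ξ| ≤ B * ‖ξ‖ :=
  (abs_real_inner_le_norm _ _).trans
    (mul_le_mul_of_nonneg_right (h.γ_norm_le k h1 h2 s hs) (norm_nonneg _))

theorem phase_hasDerivAt (h : Admissible p q L A B K R γ a a₁ a₂) {k : ℕ} (hk : k ≤ L)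
    {s : ℝ} (hs : s ∈ Ioo p q) (ξ : E d) :
    HasDerivAt (fun s => inner ℝ (γ k s) ξ) (inner ℝ (γ (k + 1) s) ξ) s := by
  simpa using (h.γ_hasDerivAt k hk s hs).inner ℝ (hasDerivAt_const s ξ)

theorem phase_continuous (h : Admissible p q L A B K R γ a a₁ a₂) {k : ℕ} (hk : k ≤ L + 1)
    (ξ : E d) : Continuous fun s => inner ℝ (γ k s) ξ := by
  have := h.γ_continuous k hk
  fun_prop

theorem measurable_slice (g : 𝓢(E d × ℝ, ℂ)) (ξ : E d) : Measurable (fourierX g ξ) :=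
  measurable_curry_left (u := fourierX g) (measurable_fourierX g) ξ

/-- The squared norm bound at a fixed frequency. -/
def sqConst (ℓ A B K : ℝ) (L m₀ : ℕ) : ℝ :=
  K ^ 2 * coreConst ℓ (coverWidth A B L) (2 + 2 * A * B * L) (coverCard 0 ℓ A B L) (L - 1) m₀

/-- The one-dimensional bound with `Λ = ‖ξ‖`, which must be positive. The cover depends on `ξ`, but
its width and cardinality do not, and `m₀` depends on the frequency only through `R`. -/
theorem osc_sq_le (h : Admissible p q L A B K R γ a a₁ a₂) {m₀ : ℕ} (hm₀ : 1 + B * R ≤ 2 ^ m₀)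
    (g : 𝓢(E d × ℝ, ℂ)) {ξ : E d} (hξ : ξ ≠ 0) :
    (∫⁻ s, ‖osc (γ 0) a g ξ s‖ₑ ^ 2) + 4 * gagliardo (osc (γ 0) a g ξ) ≤
      ENNReal.ofReal (sqConst (q - p) A B K L m₀) * ∫⁻ t in I, ‖fourierX g ξ t‖ₑ ^ 2 := by
  rcases lt_or_ge R ‖ξ‖ with hR | hR
  · have : osc (γ 0) a g ξ = fun _ => 0 := by
      ext s
      simp [osc, oscInt, h.freq ξ s _ hR]
    simp [this, gagliardo]
  have hpos : 0 < ‖ξ‖ := norm_pos_iff.2 hξ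
  obtain ⟨J, hJ⟩ := exists_phaseCover (p := p) (q := q) (D := fun k s => inner ℝ (γ k s) ξ)
    h.one_le h.A_pos h.B_pos hpos (fun k hk => h.phase_continuous (by omega) ξ)
    (fun k hk s hs => h.phase_hasDerivAt hk hs ξ) (fun k h1 h2 s hs => h.phase_bound h1 h2 hs ξ)
  obtain ⟨F, hF⟩ := exists_norm_fourierX_le g
  have hL := h.one_le
  have hUm : MeasurableSet {s | s ∈ Icc p q ∧
      A⁻¹ * ‖ξ‖ ≤ ∑ i ∈ Finset.Icc 1 L, |inner ℝ (γ i s) ξ|} := by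
    have : MeasurableSet {s | A⁻¹ * ‖ξ‖ ≤ ∑ i ∈ Finset.Icc 1 L, |inner ℝ (γ i s) ξ|} := by
      refine measurableSet_le measurable_const ?_
      refine Finset.measurable_sum _ fun i hi => ?_
      have := (h.phase_continuous (k := i) (by have := (Finset.mem_Icc.1 hi).2; omega) ξ).measurable
      fun_prop
    exact measurableSet_Icc.inter this
  have hc := h.continuous
  have hc₁ := h.continuous₁
  have hκ : 2 ≤ 2 + 2 * A * B * L := by
    have := h.A_pos
    have := h.B_pos
    linarith [show 0 ≤ 2 * A * B * L by positivity]
  have hzero : ∀ s t, s ∉ {s | s ∈ Icc p q ∧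
      A⁻¹ * ‖ξ‖ ≤ ∑ i ∈ Finset.Icc 1 L, |inner ℝ (γ i s) ξ|} →
      a (ξ, s, t) = 0 ∧ a₁ (ξ, s, t) = 0 := by
    intro s t hs
    by_cases hsI : s ∈ Icc p q
    · by_contra hne
      exact hs ⟨hsI, h.nondeg ξ s t hsI (by tauto)⟩
    · have : s ∉ Ioo p q := fun h' => hsI (Ioo_subset_Icc_self h')
      exact ⟨h.zero ξ s t this, h.zero₁ ξ s t this⟩
  have key := hJ.lintegral_add_gagliardo_le (φ := fun s => inner ℝ (γ 0 s) ξ)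
    (b := fun s t => a (ξ, s, t)) (b₁ := fun s t => a₁ (ξ, s, t)) (f := fourierX g ξ)
    (coverWidth_pos h.A_pos h.B_pos L) hκ h.le
    hUm (fun s hs => hs.1) (h.phase_continuous (by omega) ξ) (h.phase_continuous (by omega) ξ)
    (fun s hs => h.phase_hasDerivAt (by omega) hs ξ) (m₀ := m₀)
    (fun s hs => by
      have h1 := h.phase_bound le_rfl (by omega) hs ξ
      have h2 := mul_le_mul_of_nonneg_left hR h.B_pos.le
      linarith)
    (by fun_prop) (by fun_prop) (h.hasDerivAt ξ) (h.zero ξ) (h.zero₁ ξ)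
    (fun s t hs => (hzero s t hs).1) (fun s t hs => (hzero s t hs).2)
    (measurable_slice g ξ) (fun s t => h.norm_le _) (fun s t => h.norm_le₁ _) (hF ξ)
  have hcard : coverCard p q A B L = coverCard 0 (q - p) A B L := by simp [coverCard]
  rw [hcard] at key
  exact key

theorem measurable_osc (h : Admissible p q L A B K R γ a a₁ a₂) (g : 𝓢(E d × ℝ, ℂ)) :
    Measurable fun z : E d × ℝ => osc (γ 0) a g z.1 z.2 := by
  have hc := h.continuous.measurable
  have hγ := (h.γ_continuous 0 (by omega)).measurable
  have hf := measurable_fourierX g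
  have : Measurable (Function.uncurry fun (z : E d × ℝ) (t : ℝ) =>
      Complex.exp (-Complex.I * (t * inner ℝ (γ 0 z.2) z.1 : ℝ)) *
        (a (z.1, z.2, t) * fourierX g z.1 t)) := by
    unfold Function.uncurry
    have h2 : Measurable fun z : (E d × ℝ) × ℝ => fourierX g z.1.1 z.2 :=
      hf.comp (measurable_fst.fst.prodMk measurable_snd)
    refine Measurable.mul (by fun_prop) (Measurable.mul (by fun_prop) h2)
  exact this.stronglyMeasurable.integral_prod_right.measurable

theorem osc_bounded (h : Admissible p q L A B K R γ a a₁ a₂) (g : 𝓢(E d × ℝ, ℂ)) :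
    ∃ C, ∀ ξ s, ‖osc (γ 0) a g ξ s‖ ≤ C := by
  obtain ⟨F, hF⟩ := exists_norm_fourierX_le g
  refine ⟨K * F * (volume.restrict I).real univ, fun ξ s => ?_⟩
  refine norm_integral_le_of_norm_le_const (.of_forall fun t => ?_)
  rw [norm_mul, norm_exp_neg_I_mul, one_mul, norm_mul]
  exact mul_le_mul (h.norm_le _) (hF ξ t) (norm_nonneg _) h.K_nonneg

theorem osc_eq_zero (h : Admissible p q L A B K R γ a a₁ a₂) (g : 𝓢(E d × ℝ, ℂ)) {ξ : E d}
    (hξ : ξ ∉ Metric.closedBall 0 R) (s : ℝ) : osc (γ 0) a g ξ s = 0 := by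
  have : R < ‖ξ‖ := by simpa using hξ
  simp [osc, oscInt, h.freq ξ s _ this]

theorem integrable_osc (h : Admissible p q L A B K R γ a a₁ a₂) (g : 𝓢(E d × ℝ, ℂ)) (s : ℝ) :
    Integrable fun ξ => osc (γ 0) a g ξ s := by
  obtain ⟨C, hC⟩ := h.osc_bounded g
  have hm : Measurable fun ξ => osc (γ 0) a g ξ s :=
    measurable_curry_right (u := osc (γ 0) a g) (h.measurable_osc g) s
  have h1 : IntegrableOn (fun ξ => osc (γ 0) a g ξ s) (Metric.closedBall 0 R) :=
    Measure.integrableOn_of_bounded (M := C) (measure_closedBall_lt_top).ne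
      hm.aestronglyMeasurable (.of_forall fun ξ => hC ξ s)
  exact (integrableOn_iff_integrable_of_support_subset fun ξ hξ => by
    by_contra hn
    exact hξ (h.osc_eq_zero g hn s)).1 h1

theorem memLp_osc (h : Admissible p q L A B K R γ a a₁ a₂) (g : 𝓢(E d × ℝ, ℂ)) (s : ℝ) :
    MemLp (fun ξ => osc (γ 0) a g ξ s) 2 := by
  obtain ⟨C, hC⟩ := h.osc_bounded g
  exact memLp_two_of_integrable_of_bound (h.integrable_osc g s) fun ξ => hC ξ s

/-- The integrand of `𝒜[a, γ] g`. -/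
def kern (γ₀ : ℝ → E d) (a : E d × ℝ × ℝ → ℂ) (g : E d × ℝ → ℂ) (x : E d) (s : ℝ)
    (y : E d × ℝ) : ℂ :=
  Complex.exp (Complex.I * (inner ℝ (x - y.2 • γ₀ s) y.1 : ℝ)) * a (y.1, s, y.2) *
    fourierX g y.1 y.2

/-- The measure on frequencies and times over which the kernel is integrated. -/
def kernMeasure (d : ℕ) (R : ℝ) : Measure (E d × ℝ) :=
  ((volume : Measure (E d)).restrict (Metric.closedBall 0 R)).prod (volume.restrict I)

instance (R : ℝ) : IsFiniteMeasure ((volume : Measure (E d)).restrict (Metric.closedBall 0 R)) :=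
  ⟨by simpa using measure_closedBall_lt_top⟩

instance (R : ℝ) : IsFiniteMeasure (kernMeasure d R) := by
  unfold kernMeasure; infer_instance

theorem norm_exp_I_mul (x : ℝ) : ‖Complex.exp (Complex.I * (x : ℂ))‖ = 1 := by
  rw [mul_comm, Complex.norm_exp_ofReal_mul_I]

theorem kern_eq (γ₀ : ℝ → E d) (a : E d × ℝ × ℝ → ℂ) (g : E d × ℝ → ℂ) (x : E d) (s : ℝ)
    (ξ : E d) (t : ℝ) : kern γ₀ a g x s (ξ, t) = Complex.exp (Complex.I * (inner ℝ x ξ : ℝ)) *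
      (Complex.exp (-Complex.I * (t * inner ℝ (γ₀ s) ξ : ℝ)) * (a (ξ, s, t) * fourierX g ξ t)) := by
  rw [kern, inner_sub_left, inner_smul_left, ← mul_assoc, ← mul_assoc, ← Complex.exp_add]
  congr 3
  simp only [conj_trivial]
  push_cast
  ring

theorem measurable_kern (h : Admissible p q L A B K R γ a a₁ a₂) (g : 𝓢(E d × ℝ, ℂ)) :
    Measurable fun z : (E d × ℝ) × (E d × ℝ) => kern (γ 0) a g z.1.1 z.1.2 z.2 := by
  have hc := h.continuous.measurable
  have hγ := (h.γ_continuous 0 (by omega)).measurable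
  have hf := measurable_fourierX g
  unfold kern
  refine Measurable.mul (Measurable.mul (by fun_prop) (by fun_prop)) ?_
  exact hf.comp measurable_snd

theorem kern_bounded (h : Admissible p q L A B K R γ a a₁ a₂) (g : 𝓢(E d × ℝ, ℂ)) :
    ∃ C, ∀ x s y, ‖kern (γ 0) a g x s y‖ ≤ C := by
  obtain ⟨F, hF⟩ := exists_norm_fourierX_le g
  refine ⟨K * F, fun x s y => ?_⟩
  rw [kern, norm_mul, norm_mul, norm_exp_I_mul, one_mul]
  exact mul_le_mul (h.norm_le _) (hF _ _) (norm_nonneg _) h.K_nonneg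

theorem integrable_kern (h : Admissible p q L A B K R γ a a₁ a₂) (g : 𝓢(E d × ℝ, ℂ)) (x : E d)
    (s : ℝ) : Integrable (kern (γ 0) a g x s) (kernMeasure d R) := by
  obtain ⟨C, hC⟩ := h.kern_bounded g
  exact Integrable.of_bound ((h.measurable_kern g).comp
    (measurable_prodMk_left (x := (x, s)))).aestronglyMeasurable C (.of_forall fun y => hC x s y)

/-- The frequency cutoff confines the integral to a finite measure on which the kernel is bounded,
so Fubini applies from here on without further decay estimates. -/
theorem avg_eq_integral_kern (h : Admissible p q L A B K R γ a a₁ a₂) (g : 𝓢(E d × ℝ, ℂ))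
    (x : E d) (s : ℝ) : avg a (γ 0) g x s = ∫ y, kern (γ 0) a g x s y ∂(kernMeasure d R) := by
  have hi := h.integrable_kern g x s
  unfold kernMeasure at hi ⊢
  rw [integral_prod_symm _ hi, avg]
  refine integral_congr_ae (.of_forall fun t => ?_)
  symm
  refine setIntegral_eq_integral_of_forall_compl_eq_zero fun ξ hξ => ?_
  have : R < ‖ξ‖ := by simpa using hξ
  simp [kern, h.freq ξ s t this]

theorem avg_eq_integral_osc (h : Admissible p q L A B K R γ a a₁ a₂) (g : 𝓢(E d × ℝ, ℂ))
    (x : E d) (s : ℝ) : avg a (γ 0) g x s =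
      ∫ ξ, Complex.exp (Complex.I * (inner ℝ x ξ : ℝ)) * osc (γ 0) a g ξ s := by
  have hi := h.integrable_kern g x s
  rw [h.avg_eq_integral_kern]
  unfold kernMeasure at hi ⊢
  have e := setIntegral_eq_integral_of_forall_compl_eq_zero (μ := volume)
    (s := Metric.closedBall (0 : E d) R)
    (f := fun ξ => Complex.exp (Complex.I * (inner ℝ x ξ : ℝ)) * osc (γ 0) a g ξ s)
    fun ξ hξ => by rw [h.osc_eq_zero g hξ, mul_zero]
  rw [integral_prod _ hi, ← e]
  refine integral_congr_ae (.of_forall fun ξ => ?_)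
  simp only [kern_eq, osc, oscInt]
  rw [integral_const_mul]

theorem measurable_avg (h : Admissible p q L A B K R γ a a₁ a₂) (g : 𝓢(E d × ℝ, ℂ)) :
    Measurable fun z : E d × ℝ => avg a (γ 0) g z.1 z.2 := by
  simp only [h.avg_eq_integral_kern]
  exact (h.measurable_kern g).stronglyMeasurable.integral_prod_right'.measurable

theorem avg_bounded (h : Admissible p q L A B K R γ a a₁ a₂) (g : 𝓢(E d × ℝ, ℂ)) :
    ∃ C, ∀ x s, ‖avg a (γ 0) g x s‖ ≤ C := by
  obtain ⟨C, hC⟩ := h.kern_bounded g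
  refine ⟨C * (kernMeasure d R).real univ, fun x s => ?_⟩
  rw [h.avg_eq_integral_kern]
  exact norm_integral_le_of_norm_le_const (.of_forall fun y => hC x s y)

theorem avg_eq_zero (h : Admissible p q L A B K R γ a a₁ a₂) (g : 𝓢(E d × ℝ, ℂ)) (x : E d)
    {s : ℝ} (hs : s ∉ Ioo p q) : avg a (γ 0) g x s = 0 := by
  simp [avg, h.zero _ s _ hs]

theorem integrable_avg (h : Admissible p q L A B K R γ a a₁ a₂) (g : 𝓢(E d × ℝ, ℂ)) (x : E d) :
    Integrable (avg a (γ 0) g x) := by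
  obtain ⟨C, hC⟩ := h.avg_bounded g
  have hm : Measurable (avg a (γ 0) g x) :=
    measurable_curry_left (u := avg a (γ 0) g) (h.measurable_avg g) x
  have h1 : IntegrableOn (avg a (γ 0) g x) (Ioo p q) :=
    Measure.integrableOn_of_bounded (M := C) (by simp) hm.aestronglyMeasurable
      (.of_forall fun s => hC x s)
  exact (integrableOn_iff_integrable_of_support_subset fun s hs => by
    by_contra hn
    exact hs (h.avg_eq_zero g x hn)).1 h1

theorem memLp_avg (h : Admissible p q L A B K R γ a a₁ a₂) (g : 𝓢(E d × ℝ, ℂ)) (x : E d) :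
    MemLp (avg a (γ 0) g x) 2 := by
  obtain ⟨C, hC⟩ := h.avg_bounded g
  exact memLp_two_of_integrable_of_bound (h.integrable_avg g x) fun s => hC x s

/-- The `L²` norm and the Gagliardo seminorm involve only values and differences in `s`, both of
which commute with Plancherel in `x`. One factor `(2π)^d` comes from synthesis in `ξ`, the other
from `fourierX`. -/
theorem lintegral_avg_add_gagliardo_le (h : Admissible p q L A B K R γ a a₁ a₂) (hd : 1 ≤ d)
    {m₀ : ℕ} (hm₀ : 1 + B * R ≤ 2 ^ m₀) (g : 𝓢(E d × ℝ, ℂ)) :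
    ∫⁻ x, ((∫⁻ s, ‖avg a (γ 0) g x s‖ₑ ^ 2) + 4 * gagliardo (avg a (γ 0) g x)) ≤
      ENNReal.ofReal (((2 * Real.pi) ^ d) ^ 2 * sqConst (q - p) A B K L m₀) *
        ∫⁻ z : E d × ℝ, ‖g z‖ₑ ^ 2 := by
  -- Nontriviality makes the excluded frequency `ξ = 0` a null set.
  have : Nontrivial (E d) := by
    have : Nonempty (Fin d) := ⟨⟨0, hd⟩⟩
    infer_instance
  set P := ENNReal.ofReal ((2 * Real.pi) ^ d) with hP
  have hP1 : ∀ s, ∫⁻ x, ‖avg a (γ 0) g x s‖ₑ ^ 2 = P * ∫⁻ ξ, ‖osc (γ 0) a g ξ s‖ₑ ^ 2 := by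
    intro s
    have := lintegral_enorm_sq_integral_exp (h.integrable_osc g s) (h.memLp_osc g s)
    rw [finrank_euclideanSpace_fin] at this
    rw [hP, ← this]
    simp only [h.avg_eq_integral_osc]
  have hP2 : ∀ s s', ∫⁻ x, ‖avg a (γ 0) g x s - avg a (γ 0) g x s'‖ₑ ^ 2 =
      P * ∫⁻ ξ, ‖osc (γ 0) a g ξ s - osc (γ 0) a g ξ s'‖ₑ ^ 2 := by
    intro s s'
    have := lintegral_enorm_sq_integral_exp ((h.integrable_osc g s).sub (h.integrable_osc g s'))
      ((h.memLp_osc g s).sub (h.memLp_osc g s'))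
    rw [finrank_euclideanSpace_fin] at this
    simp only [Pi.sub_apply] at this
    rw [hP, ← this]
    refine lintegral_congr fun x => ?_
    congr 2
    have hint : ∀ s, Integrable fun ξ => Complex.exp (Complex.I * (inner ℝ x ξ : ℝ)) *
        osc (γ 0) a g ξ s := fun s =>
      (h.integrable_osc g s).bdd_mul (c := 1) (Continuous.aestronglyMeasurable (by fun_prop))
        (.of_forall fun ξ => (norm_exp_I_mul _).le)
    simp only [mul_sub]
    rw [h.avg_eq_integral_osc, h.avg_eq_integral_osc, ← integral_sub (hint s) (hint s')]
  have hPtop : P ≠ ⊤ := ENNReal.ofReal_ne_top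
  calc ∫⁻ x, ((∫⁻ s, ‖avg a (γ 0) g x s‖ₑ ^ 2) + 4 * gagliardo (avg a (γ 0) g x))
      = P * ∫⁻ ξ, ((∫⁻ s, ‖osc (γ 0) a g ξ s‖ₑ ^ 2) + 4 * gagliardo (osc (γ 0) a g ξ)) := by
        rw [lintegral_add_gagliardo_swap (h.measurable_avg g),
          lintegral_add_gagliardo_swap (h.measurable_osc g)]
        simp only [hP1, hP2, mul_assoc]
        rw [mul_add, lintegral_const_mul' _ _ hPtop]
        congr 1
        simp only [lintegral_const_mul' _ _ hPtop]
        ring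
    _ ≤ P * ∫⁻ ξ, ENNReal.ofReal (sqConst (q - p) A B K L m₀) *
          ∫⁻ t in I, ‖fourierX g ξ t‖ₑ ^ 2 := by
        refine mul_le_mul_right (lintegral_mono_ae ?_) _
        have h0 : ∀ᵐ ξ : E d, ξ ≠ 0 := by
          simp [ae_iff]
        filter_upwards [h0] with ξ hξ using h.osc_sq_le hm₀ g hξ
    _ = P * (ENNReal.ofReal (sqConst (q - p) A B K L m₀) *
          ∫⁻ t in I, P * ∫⁻ x, ‖g (x, t)‖ₑ ^ 2) := by
        have hm : Measurable fun y : E d × ℝ => ‖fourierX g y.1 y.2‖ₑ ^ 2 :=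
          (measurable_fourierX g).enorm.pow_const 2
        rw [lintegral_const_mul' _ _ ENNReal.ofReal_ne_top]
        have := lintegral_lintegral_swap (μ := (volume : Measure (E d)))
          (ν := volume.restrict I) (f := fun ξ t => ‖fourierX g ξ t‖ₑ ^ 2) hm.aemeasurable
        rw [this]
        simp only [lintegral_fourierX_sq, hP]
    _ ≤ P * (ENNReal.ofReal (sqConst (q - p) A B K L m₀) *
          (P * ∫⁻ z : E d × ℝ, ‖g z‖ₑ ^ 2)) := by
        rw [lintegral_const_mul' _ _ hPtop]
        gcongr
        refine (setLIntegral_le_lintegral _ _).trans_eq ?_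
        rw [Measure.volume_eq_prod, lintegral_prod_symm']
        exact (g.continuous.measurable.enorm.pow_const 2)
    _ = _ := by
        rw [ENNReal.ofReal_mul (by positivity), ENNReal.ofReal_pow (by positivity), ← hP]
        ring

end Admissible

/-! ### Decay in the variable dual to `s` -/

section IntegrationByParts

variable {φ φ' φ'' : ℝ → ℝ} {b b₁ b₂ : ℝ → ℝ → ℂ} {p q : ℝ}

/-- The Fourier integral over `(p, q]` of `e^{-itφ(s)} b(s, t)`. -/
def phaseFourier (p q : ℝ) (φ : ℝ → ℝ) (b : ℝ → ℝ → ℂ) (σ t : ℝ) : ℂ :=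
  ∫ s in Ioc p q, Complex.exp (-Complex.I * (s * σ : ℝ)) *
    (Complex.exp (-Complex.I * (t * φ s : ℝ)) * b s t)

theorem continuous_derivAmp (hφ' : Continuous φ')
    (hbc : Continuous fun x : ℝ × ℝ => b x.1 x.2) (hb₁c : Continuous fun x : ℝ × ℝ => b₁ x.1 x.2) :
    Continuous fun x : ℝ × ℝ => derivAmp φ' b b₁ x.1 x.2 := by
  have : Continuous fun t : ℝ => ((projIcc (-1 : ℝ) 1 (by norm_num) t : ℝ)) :=
    continuous_subtype_val.comp continuous_projIcc
  unfold derivAmp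
  fun_prop

theorem mul_phaseFourier (hpq : p ≤ q) (hφ : Continuous φ)
    (hφ' : Continuous φ') (hd : ∀ s ∈ Ioo p q, HasDerivAt φ (φ' s) s)
    (hbc : Continuous fun x : ℝ × ℝ => b x.1 x.2) (hb₁c : Continuous fun x : ℝ × ℝ => b₁ x.1 x.2)
    (hbd : ∀ s ∈ Ioo p q, ∀ t, HasDerivAt (fun s => b s t) (b₁ s t) s)
    (h0 : ∀ s t, s ∉ Ioo p q → b s t = 0) (h₁0 : ∀ s t, s ∉ Ioo p q → b₁ s t = 0)
    {t : ℝ} (ht : t ∈ I) (σ : ℝ) :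
    Complex.I * σ * phaseFourier p q φ b σ t = phaseFourier p q φ (derivAmp φ' b b₁) σ t := by
  have hbct : Continuous fun s => b s t := hbc.comp (by fun_prop : Continuous fun s => (s, t))
  have hDc : Continuous fun s => derivAmp φ' b b₁ s t :=
    (continuous_derivAmp hφ' hbc hb₁c).comp (by fun_prop : Continuous fun s => (s, t))
  -- The fundamental theorem of calculus with `e^{-isσ}` absorbed into the amplitude; the boundary
  -- terms vanish, and the derivative of the exponential contributes the factor `iσ`.
  have key := integral_exp_mul_derivAmp (p := p) (q := q) hφ hφ' hd
    (b := fun s t => Complex.exp (-Complex.I * (s * σ : ℝ)) * b s t)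
    (b₁ := fun s t => Complex.exp (-Complex.I * (s * σ : ℝ)) * (b₁ s t - Complex.I * σ * b s t))
    (by fun_prop) (by fun_prop)
    (fun s hs t => by
      have h1 : HasDerivAt (fun s : ℝ => Complex.exp (-Complex.I * (s * σ : ℝ)))
          (Complex.exp (-Complex.I * (s * σ : ℝ)) * (-Complex.I * (1 * σ : ℝ))) s :=
        ((((hasDerivAt_id s).mul_const σ).ofReal_comp).const_mul (-Complex.I)).cexp
      have h2 := h1.mul (hbd s hs t)
      have h3 : Complex.exp (-Complex.I * (s * σ : ℝ)) * (b₁ s t - Complex.I * σ * b s t) =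
          Complex.exp (-Complex.I * (s * σ : ℝ)) * (-Complex.I * (1 * σ : ℝ)) * b s t +
            Complex.exp (-Complex.I * (s * σ : ℝ)) * b₁ s t := by
        push_cast
        ring
      rw [h3]
      exact h2)
    (fun s t hs => by simp [h0 s t hs]) (fun s t hs => by simp [h0 s t hs, h₁0 s t hs]) ht hpq
  rw [h0 p t (by simp), h0 q t (by simp)] at key
  simp only [mul_zero, sub_zero] at key
  have i1 : IntegrableOn (fun s => Complex.exp (-Complex.I * (s * σ : ℝ)) *
      (Complex.exp (-Complex.I * (t * φ s : ℝ)) * derivAmp φ' b b₁ s t)) (Ioc p q) :=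
    (Continuous.integrableOn_Icc (by fun_prop)).mono_set Ioc_subset_Icc_self
  have i2 : IntegrableOn (fun s => Complex.I * σ * (Complex.exp (-Complex.I * (s * σ : ℝ)) *
      (Complex.exp (-Complex.I * (t * φ s : ℝ)) * b s t))) (Ioc p q) :=
    (Continuous.integrableOn_Icc (by fun_prop)).mono_set Ioc_subset_Icc_self
  unfold phaseFourier
  rw [← integral_const_mul, ← sub_eq_zero, ← neg_eq_zero, neg_sub, ← integral_sub i1 i2, ← key]
  refine integral_congr_ae (.of_forall fun s => ?_)
  simp only [derivAmp]
  ring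

theorem norm_phaseFourier_le (hpq : p ≤ q) {C : ℝ} (hb : ∀ s t, ‖b s t‖ ≤ C) (σ t : ℝ) :
    ‖phaseFourier p q φ b σ t‖ ≤ C * (q - p) := by
  have h1 := norm_setIntegral_le_of_norm_le_const (μ := volume) (s := Ioc p q) (C := C)
    (f := fun s => Complex.exp (-Complex.I * (s * σ : ℝ)) *
      (Complex.exp (-Complex.I * (t * φ s : ℝ)) * b s t)) (by simp) fun s _ => by
    rw [norm_mul, norm_mul, norm_exp_neg_I_mul, norm_exp_neg_I_mul, one_mul, one_mul]
    exact hb s t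
  rwa [Real.volume_real_Ioc_of_le hpq] at h1

/-- Quadratic decay of the Fourier integral of a twice differentiable function. -/
theorem sq_mul_norm_phaseFourier_le (hpq : p ≤ q) (hφ : Continuous φ)
    (hφ' : Continuous φ') (hφ'' : Continuous φ'') (hd : ∀ s ∈ Ioo p q, HasDerivAt φ (φ' s) s)
    (hd' : ∀ s ∈ Ioo p q, HasDerivAt φ' (φ'' s) s)
    (hbc : Continuous fun x : ℝ × ℝ => b x.1 x.2) (hb₁c : Continuous fun x : ℝ × ℝ => b₁ x.1 x.2)
    (hb₂c : Continuous fun x : ℝ × ℝ => b₂ x.1 x.2)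
    (hbd : ∀ s t, HasDerivAt (fun s => b s t) (b₁ s t) s)
    (hb₁d : ∀ s t, HasDerivAt (fun s => b₁ s t) (b₂ s t) s)
    (h0 : ∀ s t, s ∉ Ioo p q → b s t = 0) (h₁0 : ∀ s t, s ∉ Ioo p q → b₁ s t = 0)
    (h₂0 : ∀ s t, s ∉ Ioo p q → b₂ s t = 0) {K Φ : ℝ} (hΦ0 : 0 ≤ Φ)
    (hΦ : ∀ s ∈ Icc p q, |φ' s| ≤ Φ) (hΦ' : ∀ s ∈ Icc p q, |φ'' s| ≤ Φ)
    (hb : ∀ s t, ‖b s t‖ ≤ K) (hb₁ : ∀ s t, ‖b₁ s t‖ ≤ K) (hb₂ : ∀ s t, ‖b₂ s t‖ ≤ K)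
    {t : ℝ} (ht : t ∈ I) (σ : ℝ) :
    σ ^ 2 * ‖phaseFourier p q φ b σ t‖ ≤ (1 + Φ) * (1 + 2 * Φ) * K * (q - p) := by
  have hK : 0 ≤ K := (norm_nonneg _).trans (hb 0 0)
  set c := derivAmp φ' b b₁ with hc
  -- Differentiating `b₁ - iφ'τb` gives `b₂ - iφ'τb₁` and the extra term `-iφ''τb`, which again has
  -- the form of a `derivAmp`.
  set c₁ : ℝ → ℝ → ℂ := fun s t => derivAmp φ'' b (derivAmp φ' b₁ b₂) s t with hc₁
  have hcc : Continuous fun x : ℝ × ℝ => c x.1 x.2 := continuous_derivAmp hφ' hbc hb₁c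
  have hcc₁ : Continuous fun x : ℝ × ℝ => c₁ x.1 x.2 :=
    continuous_derivAmp hφ'' hbc (continuous_derivAmp hφ' hb₁c hb₂c)
  have hcd : ∀ s ∈ Ioo p q, ∀ t, HasDerivAt (fun s => c s t) (c₁ s t) s := by
    intro s hs t
    have h1 := (hb₁d s t).sub ((((hd' s hs).ofReal_comp).const_mul Complex.I).mul
      ((hbd s t).const_mul ((projIcc (-1 : ℝ) 1 (by norm_num) t : ℝ) : ℂ)))
    have h2 : c₁ s t = b₂ s t - (Complex.I * φ'' s *
        ((projIcc (-1 : ℝ) 1 (by norm_num) t : ℝ) * b s t) + Complex.I * φ' s *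
          ((projIcc (-1 : ℝ) 1 (by norm_num) t : ℝ) * b₁ s t)) := by
      simp only [hc₁, derivAmp]
      ring
    rw [h2]
    exact h1
  have hc0 : ∀ s t, s ∉ Ioo p q → c s t = 0 := fun s t hs => by
    simp [hc, derivAmp, h0 s t hs, h₁0 s t hs]
  have hc₁0 : ∀ s t, s ∉ Ioo p q → c₁ s t = 0 := fun s t hs => by
    simp [hc₁, derivAmp, h0 s t hs, h₁0 s t hs, h₂0 s t hs]
  have hcK : ∀ s t, ‖c s t‖ ≤ (1 + 2 * Φ) * K := fun s t =>
    (norm_derivAmp_le hΦ hΦ0 hb hb₁ h0 s t).trans (by nlinarith)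
  have hc₁K : ∀ s t, ‖c₁ s t‖ ≤ (1 + 2 * Φ) * K := by
    have h1 : ∀ s t, ‖derivAmp φ' b₁ b₂ s t‖ ≤ K + Φ * K :=
      norm_derivAmp_le hΦ hΦ0 hb₁ hb₂ h₁0
    intro s t
    have h3 : ‖Complex.I * φ'' s * ((projIcc (-1 : ℝ) 1 (by norm_num) t : ℝ) * b s t)‖ ≤ Φ * K := by
      by_cases hs : s ∈ Ioo p q
      · rw [norm_mul, norm_mul, Complex.norm_I, one_mul, Complex.norm_real, norm_mul,
          Real.norm_eq_abs]
        have h1 := hΦ' s (Ioo_subset_Icc_self hs)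
        have h2 := norm_projIcc_le t
        calc _ ≤ Φ * (1 * K) := by gcongr; exact hb s t
          _ = _ := by ring
      · rw [h0 s t hs]
        simp only [mul_zero, norm_zero]
        positivity
    calc ‖c₁ s t‖ ≤ (K + Φ * K) + Φ * K := (norm_sub_le _ _).trans (add_le_add (h1 s t) h3)
      _ = _ := by ring
  have e1 := mul_phaseFourier hpq hφ hφ' hd hbc hb₁c (fun s _ => hbd s) h0 h₁0 ht σ
  have e2 := mul_phaseFourier hpq hφ hφ' hd hcc hcc₁ hcd hc0 hc₁0 ht σ
  rw [← e1] at e2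
  have e3 := congrArg norm e2
  rw [norm_mul, norm_mul, norm_mul, norm_mul, Complex.norm_I, one_mul, Complex.norm_real,
    ← mul_assoc, Real.norm_eq_abs, ← sq, sq_abs] at e3
  rw [e3]
  refine (norm_phaseFourier_le hpq (norm_derivAmp_le hΦ hΦ0 hcK hc₁K hc0) σ t).trans (le_of_eq ?_)
  ring

end IntegrationByParts

/-! ### Absolute convergence of the half derivative -/

namespace Admissible

variable {d : ℕ} {p q : ℝ} {L : ℕ} {A B K R : ℝ} {γ : ℕ → ℝ → E d} {a a₁ a₂ : E d × ℝ × ℝ → ℂ}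

theorem fourierS_avg (h : Admissible p q L A B K R γ a a₁ a₂) (g : 𝓢(E d × ℝ, ℂ)) (x : E d)
    (σ : ℝ) : fourierS (avg a (γ 0) g x) σ =
      ∫ y, Complex.exp (Complex.I * (inner ℝ x y.1 : ℝ)) * fourierX g y.1 y.2 *
        phaseFourier p q (fun s => inner ℝ (γ 0 s) y.1) (fun s t => a (y.1, s, t)) σ y.2
          ∂(kernMeasure d R) := by
  obtain ⟨C, hC⟩ := h.kern_bounded g
  have e1 : fourierS (avg a (γ 0) g x) σ = ∫ s in Ioc p q, ∫ y,
      Complex.exp (-Complex.I * (s * σ : ℝ)) * kern (γ 0) a g x s y ∂(kernMeasure d R) := by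
    rw [fourierS, ← setIntegral_eq_integral_of_forall_compl_eq_zero (s := Ioc p q)]
    · refine integral_congr_ae (.of_forall fun s => ?_)
      simp only []
      rw [integral_const_mul, h.avg_eq_integral_kern]
    · intro s hs
      rw [h.avg_eq_zero g x fun h' => hs (Ioo_subset_Ioc_self h'), mul_zero]
  rw [e1, integral_integral_swap (integrable_bddProd (C := C) ?_ ?_)]
  · refine integral_congr_ae (.of_forall fun y => ?_)
    simp only []
    rw [phaseFourier, ← integral_const_mul]
    refine integral_congr_ae (.of_forall fun s => ?_)
    simp only []
    rw [show y = (y.1, y.2) from rfl, kern_eq]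
    ring
  · have h1 : Measurable fun z : ℝ × (E d × ℝ) => kern (γ 0) a g x z.1 z.2 :=
      measurable_comp₂ (u := fun z : E d × ℝ => kern (γ 0) a g z.1 z.2) (h.measurable_kern g)
        (f := fun z : ℝ × (E d × ℝ) => (x, z.1)) (by fun_prop) measurable_snd
    unfold Function.uncurry
    exact Measurable.mul (by fun_prop) h1
  · intro s y
    rw [norm_mul, norm_exp_neg_I_mul, one_mul]
    exact hC x s y

/-- The trivial bound and two integrations by parts, integrated over a finite measure. The constant
may depend on `R` and `g`, as it serves only to justify the integrals. -/
theorem fourierS_avg_decay (h : Admissible p q L A B K R γ a a₁ a₂) (g : 𝓢(E d × ℝ, ℂ)) :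
    ∃ C, ∀ x σ, (1 + σ ^ 2) * ‖fourierS (avg a (γ 0) g x) σ‖ ≤ C := by
  obtain ⟨F, hF⟩ := exists_norm_fourierX_le g
  have hF0 : 0 ≤ F := (norm_nonneg _).trans (hF 0 0)
  have hL := h.one_le
  have hB := h.B_pos
  have hR := h.R_nonneg
  have hc := h.continuous
  have hc₁ := h.continuous₁
  have hc₂ := h.continuous₂
  set C' := F * (K * (q - p) + (1 + B * R) * (1 + 2 * (B * R)) * K * (q - p)) with hC'
  refine ⟨C' * (kernMeasure d R).real univ, fun x σ => ?_⟩
  have hpt : ∀ᵐ y ∂(kernMeasure d R), ‖((1 + σ ^ 2 : ℝ) : ℂ) *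
      (Complex.exp (Complex.I * (inner ℝ x y.1 : ℝ)) * fourierX g y.1 y.2 *
        phaseFourier p q (fun s => inner ℝ (γ 0 s) y.1) (fun s t => a (y.1, s, t)) σ y.2)‖ ≤ C' := by
    unfold kernMeasure
    rw [Measure.prod_restrict]
    filter_upwards [ae_restrict_mem (Metric.isClosed_closedBall.measurableSet.prod
      measurableSet_Icc)] with y hy
    have hyR : ‖y.1‖ ≤ R := by simpa using hy.1
    have hΦ : ∀ k, 1 ≤ k → k ≤ L + 1 → ∀ s ∈ Icc p q, |inner ℝ (γ k s) y.1| ≤ B * R :=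
      fun k h1 h2 s hs => (h.phase_bound h1 h2 hs y.1).trans
        (mul_le_mul_of_nonneg_left hyR hB.le)
    have h1 := norm_phaseFourier_le (φ := fun s => inner ℝ (γ 0 s) y.1) h.le
      (b := fun s t => a (y.1, s, t)) (fun s t => h.norm_le _) σ y.2
    have h2 := sq_mul_norm_phaseFourier_le (φ := fun s => inner ℝ (γ 0 s) y.1)
      (φ' := fun s => inner ℝ (γ 1 s) y.1) (φ'' := fun s => inner ℝ (γ 2 s) y.1)
      (b := fun s t => a (y.1, s, t)) (b₁ := fun s t => a₁ (y.1, s, t))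
      (b₂ := fun s t => a₂ (y.1, s, t)) h.le (h.phase_continuous (by omega) _)
      (h.phase_continuous (by omega) _) (h.phase_continuous (by omega) _)
      (fun s hs => h.phase_hasDerivAt (by omega) hs _)
      (fun s hs => h.phase_hasDerivAt (by omega) hs _) (by fun_prop) (by fun_prop) (by fun_prop)
      (h.hasDerivAt _) (h.hasDerivAt₁ _) (h.zero _) (h.zero₁ _) (h.zero₂ _) (Φ := B * R)
      (by positivity) (hΦ 1 le_rfl (by omega)) (hΦ 2 (by omega) (by omega))
      (fun s t => h.norm_le _) (fun s t => h.norm_le₁ _) (fun s t => h.norm_le₂ _) hy.2 σ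
    rw [norm_mul, norm_mul, norm_mul, norm_exp_I_mul, one_mul, Complex.norm_real,
      Real.norm_of_nonneg (by positivity), mul_left_comm, hC']
    refine mul_le_mul (hF _ _) ?_ (by positivity) hF0
    linarith
  have := norm_integral_le_of_norm_le_const hpt
  rw [integral_const_mul, ← h.fourierS_avg g x σ, norm_mul, Complex.norm_real,
    Real.norm_of_nonneg (by positivity)] at this
  exact this

/-- Quadratic decay against the growth of the multiplier leaves `(1+|σ|)^{-3/2}`, which is
integrable and bounded, hence square integrable. -/
theorem halfDerivFourier_avg (h : Admissible p q L A B K R γ a a₁ a₂) (g : 𝓢(E d × ℝ, ℂ))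
    (x : E d) : Integrable (halfDerivFourier (avg a (γ 0) g x)) ∧
      MemLp (halfDerivFourier (avg a (γ 0) g x)) 2 := by
  obtain ⟨C, hC⟩ := h.fourierS_avg_decay g
  have hcont : Continuous (halfDerivFourier (avg a (γ 0) g x)) := by
    have := continuous_fourierS (h.integrable_avg g x)
    unfold halfDerivFourier
    fun_prop
  have hC0 : 0 ≤ C := le_trans (by positivity) (hC 0 0)
  have hle : ∀ σ, ‖halfDerivFourier (avg a (γ 0) g x) σ‖ ≤ 2 * C * (1 + ‖σ‖) ^ (-(3 / 2 : ℝ)) := by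
    intro σ
    have hpos : 0 < 1 + |σ| := by positivity
    rw [halfDerivFourier, norm_mul, Complex.norm_real, Real.norm_of_nonneg (Real.sqrt_nonneg _),
      Real.norm_eq_abs, Real.rpow_neg hpos.le, ← div_eq_mul_inv, le_div_iff₀ (by positivity),
      Real.sqrt_eq_rpow, mul_right_comm, ← Real.rpow_add hpos]
    norm_num
    have h1 := hC x σ
    have h2 : (1 + |σ|) ^ 2 ≤ 2 * (1 + σ ^ 2) := by
      rw [← sq_abs σ]; nlinarith [sq_nonneg (1 - |σ|)]
    calc (1 + |σ|) ^ 2 * ‖fourierS (avg a (γ 0) g x) σ‖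
        ≤ 2 * (1 + σ ^ 2) * ‖fourierS (avg a (γ 0) g x) σ‖ := by gcongr
      _ ≤ 2 * C := by rw [mul_assoc]; gcongr
  have hint : Integrable (halfDerivFourier (avg a (γ 0) g x)) := by
    have h1 : Integrable fun σ : ℝ => (1 + ‖σ‖) ^ (-(3 / 2 : ℝ)) :=
      integrable_one_add_norm (by norm_num)
    exact (h1.const_mul (2 * C)).mono' hcont.aestronglyMeasurable (.of_forall hle)
  refine ⟨hint, memLp_two_of_integrable_of_bound hint (C := 2 * C) fun σ => ?_⟩
  refine (hle σ).trans (mul_le_of_le_one_right (by positivity) ?_)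
  exact Real.rpow_le_one_of_one_le_of_nonpos (by linarith [norm_nonneg σ]) (by norm_num)

theorem measurable_halfAvg (h : Admissible p q L A B K R γ a a₁ a₂) (g : 𝓢(E d × ℝ, ℂ)) :
    Measurable (halfAvg a (γ 0) g) := by
  have h1 : Measurable fun z : E d × ℝ => fourierS (avg a (γ 0) g z.1) z.2 := by
    have : Measurable (Function.uncurry fun (z : E d × ℝ) (s : ℝ) =>
        Complex.exp (-Complex.I * (s * z.2 : ℝ)) * avg a (γ 0) g z.1 s) := by
      unfold Function.uncurry
      refine Measurable.mul (by fun_prop) ?_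
      exact measurable_comp₂ (u := avg a (γ 0) g) (h.measurable_avg g) measurable_fst.fst
        measurable_snd
    exact this.stronglyMeasurable.integral_prod_right.measurable
  have h2 : Measurable (Function.uncurry fun (z : E d × ℝ) (σ : ℝ) =>
      Complex.exp (Complex.I * (z.2 * σ : ℝ)) * halfDerivFourier (avg a (γ 0) g z.1) σ) := by
    unfold Function.uncurry halfDerivFourier
    refine Measurable.mul (by fun_prop) (Measurable.mul (by fun_prop) ?_)
    exact measurable_comp₂ (u := fun x => fourierS (avg a (γ 0) g x)) h1 measurable_fst.fst
      measurable_snd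
  exact h2.stronglyMeasurable.integral_prod_right.measurable.const_mul _

theorem lintegral_halfAvg_sq_le (h : Admissible p q L A B K R γ a a₁ a₂) (hd : 1 ≤ d)
    {m₀ : ℕ} (hm₀ : 1 + B * R ≤ 2 ^ m₀) (g : 𝓢(E d × ℝ, ℂ)) :
    ∫⁻ z, ‖halfAvg a (γ 0) g z‖ₑ ^ 2 ≤
      ENNReal.ofReal (((2 * Real.pi) ^ d) ^ 2 * sqConst (q - p) A B K L m₀) *
        ∫⁻ z : E d × ℝ, ‖g z‖ₑ ^ 2 := by
  refine le_trans ?_ (h.lintegral_avg_add_gagliardo_le hd hm₀ g)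
  have hm : AEMeasurable (fun z => ‖halfAvg a (γ 0) g z‖ₑ ^ 2)
      ((volume : Measure (E d)).prod (volume : Measure ℝ)) :=
    ((h.measurable_halfAvg g).enorm.pow_const 2).aemeasurable
  rw [Measure.volume_eq_prod, lintegral_prod (fun z => ‖halfAvg a (γ 0) g z‖ₑ ^ 2) hm]
  refine lintegral_mono fun x => ?_
  obtain ⟨h1, h2⟩ := h.halfDerivFourier_avg g x
  change ∫⁻ s, ‖halfDeriv (avg a (γ 0) g x) s‖ₑ ^ 2 ≤ _
  exact lintegral_halfDeriv_sq_le (h.integrable_avg g x) (h.memLp_avg g x) h1 h2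

end Admissible

/-! ### Linearity and extension to `L²` -/

section Linearity

theorem integrable_exp_neg_mul {V : Type*} [NormedAddCommGroup V] [MeasurableSpace V]
    [BorelSpace V] [SecondCountableTopology V] {μ : Measure V} {f : V → ℂ} (hf : Integrable f μ)
    {θ : V → ℝ} (hθ : Continuous θ) :
    Integrable (fun x => Complex.exp (-Complex.I * (θ x : ℝ)) * f x) μ :=
  hf.bdd_mul (c := 1) (Continuous.aestronglyMeasurable (by fun_prop))
    (.of_forall fun x => (norm_exp_neg_I_mul _).le)

variable {d : ℕ}

theorem fourierX_add (g g' : 𝓢(E d × ℝ, ℂ)) (ξ : E d) (t : ℝ) :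
    fourierX (⇑(g + g')) ξ t = fourierX g ξ t + fourierX g' ξ t := by
  unfold fourierX
  rw [← integral_add (integrable_exp_neg_mul (integrable_schwartz_slice g t) (by fun_prop))
    (integrable_exp_neg_mul (integrable_schwartz_slice g' t) (by fun_prop))]
  simp only [add_apply, mul_add]

theorem fourierX_smul (c : ℂ) (g : E d × ℝ → ℂ) (ξ : E d) (t : ℝ) :
    fourierX (c • g) ξ t = c * fourierX g ξ t := by
  unfold fourierX
  rw [← integral_const_mul]
  simp only [Pi.smul_apply, smul_eq_mul, mul_left_comm]

theorem avg_smul (a : E d × ℝ × ℝ → ℂ) (γ : ℝ → E d) (c : ℂ) (g : E d × ℝ → ℂ) (x : E d) (s : ℝ) :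
    avg a γ (c • g) x s = c * avg a γ g x s := by
  unfold avg
  simp only [fourierX_smul, mul_left_comm, integral_const_mul]

theorem halfDeriv_const_mul (c : ℂ) (h : ℝ → ℂ) (s : ℝ) :
    halfDeriv (fun s => c * h s) s = c * halfDeriv h s := by
  unfold halfDeriv halfDerivFourier fourierS
  simp only [mul_left_comm _ c, integral_const_mul]

theorem halfDerivFourier_add {h h' : ℝ → ℂ} (hh : Integrable h) (hh' : Integrable h') (σ : ℝ) :
    halfDerivFourier (fun s => h s + h' s) σ = halfDerivFourier h σ + halfDerivFourier h' σ := by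
  unfold halfDerivFourier fourierS
  rw [← mul_add, ← integral_add (integrable_exp_neg_mul hh (θ := fun s => s * σ) (by fun_prop))
    (integrable_exp_neg_mul hh' (θ := fun s => s * σ) (by fun_prop))]
  simp only [mul_add]

theorem halfDeriv_add {h h' : ℝ → ℂ} (hh : Integrable h) (hh' : Integrable h')
    (hi : Integrable (halfDerivFourier h)) (hi' : Integrable (halfDerivFourier h')) (s : ℝ) :
    halfDeriv (fun s => h s + h' s) s = halfDeriv h s + halfDeriv h' s := by
  have hint : ∀ {u : ℝ → ℂ}, Integrable u →
      Integrable fun σ : ℝ => Complex.exp (Complex.I * (s * σ : ℝ)) * u σ := fun hu =>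
    hu.bdd_mul (c := 1) (Continuous.aestronglyMeasurable (by fun_prop))
      (.of_forall fun x => (Admissible.norm_exp_I_mul _).le)
  unfold halfDeriv
  simp only [halfDerivFourier_add hh hh', mul_add]
  rw [integral_add (hint hi) (hint hi'), mul_add]

theorem halfAvg_smul (a : E d × ℝ × ℝ → ℂ) (γ : ℝ → E d) (c : ℂ) (g : E d × ℝ → ℂ)
    (z : E d × ℝ) : halfAvg a γ (c • g) z = c * halfAvg a γ g z := by
  unfold halfAvg
  rw [← halfDeriv_const_mul]
  congr 1
  ext s
  exact avg_smul a γ c g z.1 s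

end Linearity

namespace Admissible

variable {d : ℕ} {p q : ℝ} {L : ℕ} {A B K R : ℝ} {γ : ℕ → ℝ → E d} {a a₁ a₂ : E d × ℝ × ℝ → ℂ}

theorem avg_add (h : Admissible p q L A B K R γ a a₁ a₂) (g g' : 𝓢(E d × ℝ, ℂ)) (x : E d)
    (s : ℝ) : avg a (γ 0) (⇑(g + g')) x s = avg a (γ 0) g x s + avg a (γ 0) g' x s := by
  rw [h.avg_eq_integral_kern (g + g'), h.avg_eq_integral_kern g, h.avg_eq_integral_kern g',
    ← integral_add (h.integrable_kern g x s) (h.integrable_kern g' x s)]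
  refine integral_congr_ae (.of_forall fun y => ?_)
  simp only [kern, fourierX_add, mul_add]

theorem halfAvg_add (h : Admissible p q L A B K R γ a a₁ a₂) (g g' : 𝓢(E d × ℝ, ℂ))
    (z : E d × ℝ) :
    halfAvg a (γ 0) (⇑(g + g')) z = halfAvg a (γ 0) g z + halfAvg a (γ 0) g' z := by
  unfold halfAvg
  rw [← halfDeriv_add (h.integrable_avg g z.1) (h.integrable_avg g' z.1)
    (h.halfDerivFourier_avg g z.1).1 (h.halfDerivFourier_avg g' z.1).1]
  congr 1
  ext s
  exact h.avg_add g g' z.1 s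

theorem eLpNorm_halfAvg_le (h : Admissible p q L A B K R γ a a₁ a₂) (hd : 1 ≤ d)
    {m₀ : ℕ} (hm₀ : 1 + B * R ≤ 2 ^ m₀) {M : ℝ} (hM0 : 0 ≤ M)
    (hM : ((2 * Real.pi) ^ d) ^ 2 * sqConst (q - p) A B K L m₀ ≤ M ^ 2) (g : 𝓢(E d × ℝ, ℂ)) :
    eLpNorm (halfAvg a (γ 0) g) 2 volume ≤ ENNReal.ofReal M * eLpNorm g 2 volume := by
  have h1 := h.lintegral_halfAvg_sq_le hd hm₀ g
  rw [lintegral_enorm_sq_eq, lintegral_enorm_sq_eq] at h1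
  have h2 : eLpNorm (halfAvg a (γ 0) g) 2 volume ^ 2 ≤
      (ENNReal.ofReal M * eLpNorm g 2 volume) ^ 2 := by
    refine h1.trans ?_
    rw [mul_pow (ENNReal.ofReal M), ← ENNReal.ofReal_pow hM0]
    exact mul_le_mul_left (ENNReal.ofReal_le_ofReal hM) _
  exact (ENNReal.pow_right_strictMono two_ne_zero).le_iff_le.1 h2

theorem halfAvgNormLE (h : Admissible p q L A B K R γ a a₁ a₂) (hd : 1 ≤ d)
    {m₀ : ℕ} (hm₀ : 1 + B * R ≤ 2 ^ m₀) {M : ℝ} (hM0 : 0 ≤ M)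
    (hM : ((2 * Real.pi) ^ d) ^ 2 * sqConst (q - p) A B K L m₀ ≤ M ^ 2) :
    HalfAvgNormLE a (γ 0) M := by
  refine ⟨fun g x => (h.halfDerivFourier_avg g x).1, ?_⟩
  have hle := h.eLpNorm_halfAvg_le hd hm₀ hM0 hM
  have hmem : ∀ g : 𝓢(E d × ℝ, ℂ), MemLp (halfAvg a (γ 0) g) 2 volume := fun g =>
    ⟨(h.measurable_halfAvg g).aestronglyMeasurable,
      (hle g).trans_lt (ENNReal.mul_lt_top ENNReal.ofReal_lt_top (g.memLp 2 volume).2)⟩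
  -- The operator on Schwartz functions is bounded relative to the embedding `e` into `L²`, whose
  -- range is dense, so it extends with the same norm bound.
  let S : 𝓢(E d × ℝ, ℂ) →ₗ[ℂ] Lp ℂ 2 (volume : Measure (E d × ℝ)) :=
    { toFun := fun g => (hmem g).toLp _
      map_add' := fun g g' => by
        rw [← MemLp.toLp_add]
        exact MemLp.toLp_congr _ _ (.of_forall fun z => h.halfAvg_add g g' z)
      map_smul' := fun c g => by
        rw [RingHom.id_apply, ← MemLp.toLp_const_smul]
        exact MemLp.toLp_congr _ _ (.of_forall fun z => halfAvg_smul a (γ 0) c g z) }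
  have : (volume : Measure (E d × ℝ)).IsAddHaarMeasure :=
    inferInstanceAs ((volume : Measure (E d)).prod (volume : Measure ℝ)).IsAddHaarMeasure
  let e : 𝓢(E d × ℝ, ℂ) →ₗ[ℂ] Lp ℂ 2 (volume : Measure (E d × ℝ)) :=
    (SchwartzMap.toLpCLM ℂ ℂ 2 (volume : Measure (E d × ℝ))).toLinearMap
  have he : ∀ g, e g = g.toLp 2 volume := fun g => rfl
  have hdense : DenseRange e :=
    SchwartzMap.denseRange_toLpCLM (F := ℂ) (μ := (volume : Measure (E d × ℝ)))
      ENNReal.ofNat_ne_top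
  have hnorm : ∀ g, ‖S g‖ ≤ M * ‖e g‖ := by
    intro g
    have h1 : ‖S g‖ = (eLpNorm (halfAvg a (γ 0) g) 2 volume).toReal :=
      Lp.norm_toLp _ (hmem g)
    have h2 : ‖e g‖ = (eLpNorm g 2 volume).toReal := Lp.norm_toLp _ (g.memLp 2 volume)
    rw [h1, h2]
    have h3 := ENNReal.toReal_mono
      (ENNReal.mul_ne_top ENNReal.ofReal_ne_top (g.memLp 2 volume).2.ne) (hle g)
    rwa [ENNReal.toReal_mul, ENNReal.toReal_ofReal hM0] at h3
  refine ⟨S.extendOfNorm e, LinearMap.opNorm_extendOfNorm_le hdense hM0 hnorm, fun g => ?_⟩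
  rw [← he, LinearMap.extendOfNorm_eq hdense ⟨M, hnorm⟩]
  exact (hmem g).coeFn_toLp

end Admissible

/-! ### Growth of the constants with the frequency -/

namespace Admissible

/-- The number of dyadic levels enters only through the weight of `exists_weight`, hence linearly
and with a factor `L - 1`. -/
theorem exists_sqConst_le {ℓ A B : ℝ} (hℓ : 0 ≤ ℓ) (hA : 0 < A) (hB : 0 < B) (K T : ℝ)
    (hT : 0 ≤ T) (L : ℕ) : ∃ α β : ℝ, 0 ≤ α ∧ 0 ≤ β ∧ ∀ m₀ : ℕ,
      T * sqConst ℓ A B K L m₀ = α + β * (L - 1 : ℕ) * (m₀ + 1) := by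
  have hc := coverWidth_pos hA hB L
  set c := coverWidth A B L
  set N := coverCard 0 ℓ A B L
  set κ : ℝ := 2 + 2 * A * B * L
  have hκ : 0 ≤ κ := by positivity
  set n := L - 1
  have hpi := Real.pi_pos
  refine ⟨T * (K ^ 2 * (2 * ℓ + 40 * ((2 * κ + 2 / c) * (2 * ℓ) +
    2 * κ * (ℓ ^ 2 * (N * (n + 1)) * (2 * Real.pi))) +
    4 * (4 * ℓ + 2 * (ℓ ^ 2 * (N * (n + 1)) * (2 * Real.pi))))),
    T * (K ^ 2 * (40 * (32 * N))), by positivity, by positivity, fun m₀ => ?_⟩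
  unfold sqConst coreConst
  ring

theorem exists_pow_two_ge {b : ℝ} (hb : 0 ≤ b) : ∃ c : ℝ, 0 ≤ c ∧ ∀ u : ℝ, 2 ≤ u →
    ∃ m : ℕ, 1 + b * u ≤ 2 ^ m ∧ (m : ℝ) + 1 ≤ c * (Real.log u / Real.log 2) := by
  obtain ⟨n, hn⟩ := pow_unbounded_of_one_lt (1 + b) one_lt_two
  -- With `w = log u / log 2 ≥ 1` and `m = n + ⌈w⌉`, one has `m + 1 ≤ n + w + 2 ≤ (n + 3) w`.
  refine ⟨n + 3, by positivity, fun u hu => ?_⟩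
  have hl2 : 0 < Real.log 2 := Real.log_pos one_lt_two
  have hw : 1 ≤ Real.log u / Real.log 2 := by
    rw [one_le_div hl2]; exact Real.log_le_log two_pos hu
  have hlog : Real.log u ≤ ⌈Real.log u / Real.log 2⌉₊ * Real.log 2 := by
    rw [← div_le_iff₀ hl2]; exact Nat.le_ceil _
  refine ⟨n + ⌈Real.log u / Real.log 2⌉₊, ?_, ?_⟩
  · have h1 : u ≤ 2 ^ ⌈Real.log u / Real.log 2⌉₊ := by
      rw [← Real.log_le_log_iff (by linarith) (by positivity), Real.log_pow]
      exact hlog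
    rw [pow_add]
    calc 1 + b * u ≤ (1 + b) * u := by nlinarith
      _ ≤ _ := by gcongr
  · have h2 := Nat.ceil_lt_add_one (zero_le_one.trans hw)
    push_cast
    nlinarith [Nat.cast_nonneg (α := ℝ) n]

/-- The constants of the half derivative bound grow like a power of the logarithm of the
frequency. -/
theorem exists_const {ℓ A B : ℝ} (hℓ : 0 ≤ ℓ) (hA : 0 < A) (hB : 0 < B) (K : ℝ) {T c₀ : ℝ}
    (hT : 0 ≤ T) (hc₀ : 0 ≤ c₀) (L : ℕ) (hL : 1 ≤ L) : ∃ M : ℝ, 0 ≤ M ∧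
      ∀ u R : ℝ, 2 ≤ u → R ≤ c₀ * u → ∃ m₀ : ℕ, 1 + B * R ≤ 2 ^ m₀ ∧
        T * sqConst ℓ A B K L m₀ ≤ (M * Real.log u ^ (((L : ℝ) - 1) / 2)) ^ 2 := by
  obtain ⟨α, β, hα, hβ, hS⟩ := exists_sqConst_le hℓ hA hB K T hT L
  obtain ⟨c, hc, hm⟩ := exists_pow_two_ge (mul_nonneg hB.le hc₀)
  have hl2 : 0 < Real.log 2 := Real.log_pos one_lt_two
  set G := α + β * (L - 1 : ℕ) * c
  have hG : 0 ≤ G := by positivity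
  refine ⟨Real.sqrt (G / Real.log 2 ^ (L - 1)), Real.sqrt_nonneg _, fun u R hu hR => ?_⟩
  obtain ⟨m, hm1, hm2⟩ := hm u hu
  refine ⟨m, ?_, ?_⟩
  · calc 1 + B * R ≤ 1 + B * (c₀ * u) := by gcongr
      _ ≤ _ := by rw [← mul_assoc]; exact hm1
  have hw : 1 ≤ Real.log u / Real.log 2 := by
    rw [one_le_div hl2]; exact Real.log_le_log two_pos hu
  have hlu : 0 < Real.log u := Real.log_pos (by linarith)
  have hrpow : (Real.log u ^ (((L : ℝ) - 1) / 2)) ^ 2 = Real.log u ^ (L - 1) := by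
    rw [← Real.rpow_natCast, ← Real.rpow_mul hlu.le, ← Real.rpow_natCast]
    congr 1
    push_cast [Nat.cast_sub hL]
    ring
  rw [mul_pow, Real.sq_sqrt (by positivity), hrpow, hS, div_mul_eq_mul_div, mul_div_assoc,
    ← div_pow]
  set w := Real.log u / Real.log 2
  have hw1 : 1 ≤ w ^ (L - 1) := one_le_pow₀ hw
  -- For `L = 1` the coefficient kills the logarithm; for `L ≥ 2` a single power of `w ≥ 1` is below
  -- `w^(L-1)`.
  have h3 : ((L - 1 : ℕ) : ℝ) * w ≤ (L - 1 : ℕ) * w ^ (L - 1) := by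
    rcases Nat.eq_zero_or_pos (L - 1) with h | h
    · simp [h]
    · exact mul_le_mul_of_nonneg_left (le_self_pow₀ hw h.ne') (Nat.cast_nonneg _)
  calc α + β * (L - 1 : ℕ) * (m + 1) ≤ α + β * (L - 1 : ℕ) * (c * w) := by gcongr
    _ = α * 1 + β * c * ((L - 1 : ℕ) * w) := by ring
    _ ≤ α * w ^ (L - 1) + β * c * ((L - 1 : ℕ) * w ^ (L - 1)) := by gcongr
    _ = G * w ^ (L - 1) := by ring

end Admissible

/-! ### Changing symbols and curves where the operator does not see them -/

section Transfer

variable {d : ℕ}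

theorem avg_congr {a a' : E d × ℝ × ℝ → ℂ} {γ γ' : ℝ → E d} {s : ℝ}
    (h : ∀ ξ, ∀ t ∈ I, a (ξ, s, t) = a' (ξ, s, t))
    (hγ : γ s = γ' s ∨ ∀ ξ, ∀ t ∈ I, a (ξ, s, t) = 0) (g : E d × ℝ → ℂ) (x : E d) :
    avg a γ g x s = avg a' γ' g x s := by
  unfold avg
  refine setIntegral_congr_fun measurableSet_Icc fun t ht => ?_
  rcases hγ with hγ | hγ
  · simp only [hγ, h _ t ht]
  · simp only [← h _ t ht, hγ _ t ht]
    simp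

/-- The operator sees the symbol only for `t ∈ I` and the curve only where the symbol is not
identically zero. Globally continuous extensions can therefore replace the given data. -/
theorem HalfAvgNormLE.congr {a a' : E d × ℝ × ℝ → ℂ} {γ γ' : ℝ → E d} {M M' : ℝ}
    (H : HalfAvgNormLE a γ M) (hM : M ≤ M') (h : ∀ ξ s, ∀ t ∈ I, a (ξ, s, t) = a' (ξ, s, t))
    (hγ : ∀ s, γ s = γ' s ∨ ∀ ξ, ∀ t ∈ I, a (ξ, s, t) = 0) : HalfAvgNormLE a' γ' M' := by
  have key : ∀ (g : E d × ℝ → ℂ) (x : E d), avg a γ g x = avg a' γ' g x := fun g x =>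
    funext fun s => avg_congr (h · s) (hγ s) g x
  have key' : ∀ g : E d × ℝ → ℂ, halfAvg a γ g = halfAvg a' γ' g := fun g =>
    funext fun z => by unfold halfAvg; rw [key]
  obtain ⟨h1, T, hT, h2⟩ := H
  exact ⟨fun g x => key g x ▸ h1 g x, T, hT.trans hM, fun g => key' g ▸ h2 g⟩

end Transfer

section ExtendedCurve

variable {d : ℕ} {p q : ℝ}

/-- The `k`-th derivative of a curve on `[p, q]`, extended by constants. -/
def extDeriv (γ : ℝ → E d) (p q : ℝ) (hpq : p ≤ q) (k : ℕ) (s : ℝ) : E d :=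
  iteratedDerivWithin k γ (Icc p q) (projIcc p q hpq s)

theorem extDeriv_of_mem (γ : ℝ → E d) (hpq : p ≤ q) (k : ℕ) {s : ℝ} (hs : s ∈ Icc p q) :
    extDeriv γ p q hpq k s = iteratedDerivWithin k γ (Icc p q) s := by
  rw [extDeriv, projIcc_of_mem hpq hs]

theorem continuous_extDeriv {γ : ℝ → E d} (hpq : p < q) {n : WithTop ℕ∞} {k : ℕ}
    (hγ : ContDiffOn ℝ n γ (Icc p q)) (hk : (k : WithTop ℕ∞) ≤ n) :
    Continuous (extDeriv γ p q hpq.le k) :=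
  (hγ.continuousOn_iteratedDerivWithin hk (uniqueDiffOn_Icc hpq)).comp_continuous
    (continuous_subtype_val.comp continuous_projIcc) fun s => (projIcc p q hpq.le s).2

theorem hasDerivAt_extDeriv {γ : ℝ → E d} (hpq : p < q) {n : WithTop ℕ∞} {k : ℕ}
    (hγ : ContDiffOn ℝ n γ (Icc p q)) (hk : (k : WithTop ℕ∞) < n) {s : ℝ} (hs : s ∈ Ioo p q) :
    HasDerivAt (extDeriv γ p q hpq.le k) (extDeriv γ p q hpq.le (k + 1) s) s := by
  have hs' := Ioo_subset_Icc_self hs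
  have h1 := (hγ.differentiableOn_iteratedDerivWithin hk (uniqueDiffOn_Icc hpq) s
    hs').hasDerivWithinAt
  rw [← iteratedDerivWithin_succ] at h1
  have hn := Icc_mem_nhds hs.1 hs.2
  rw [extDeriv_of_mem _ _ _ hs']
  refine (h1.hasDerivAt hn).congr_of_eventuallyEq ?_
  filter_upwards [hn] with r hr using extDeriv_of_mem _ _ _ hr

end ExtendedCurve

theorem eq_zero_of_notMem_Ioo {F : Type*} [TopologicalSpace F] [T1Space F] [Zero F] {p q : ℝ}
    {f : ℝ → F} (hf : Continuous f) (h : ∀ s ∉ Icc p q, f s = 0) {s : ℝ} (hs : s ∉ Ioo p q) :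
    f s = 0 := by
  have hsub : closure (Icc p q)ᶜ ⊆ f ⁻¹' {0} :=
    closure_minimal (fun r hr => h r hr) (isClosed_singleton.preimage hf)
  exact hsub (by rw [closure_compl, interior_Icc]; exact hs)

/-! ### Symbols of type `(lam, A, L)` -/

section Symbol

variable {d : ℕ} {a : E d × ℝ × ℝ → ℂ}

/-- The partial derivative of a symbol in `s`. -/
def sDeriv (a : E d × ℝ × ℝ → ℂ) (x : E d × ℝ × ℝ) : ℂ := deriv (fun s => a (x.1, s, x.2.2)) x.2.1

/-- The extension of a symbol by constants to `t ∉ I`. -/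
def extendT (a : E d × ℝ × ℝ → ℂ) (x : E d × ℝ × ℝ) : ℂ :=
  a (x.1, x.2.1, projIcc (-1 : ℝ) 1 (by norm_num) x.2.2)

theorem uniqueDiffOn_strip : UniqueDiffOn ℝ (univ ×ˢ univ ×ˢ I : Set (E d × ℝ × ℝ)) :=
  uniqueDiffOn_univ.prod (uniqueDiffOn_univ.prod (uniqueDiffOn_Icc (by norm_num)))

theorem continuous_extendT (ha : ContinuousOn a (univ ×ˢ univ ×ˢ I)) : Continuous (extendT a) :=
  ha.comp_continuous (by fun_prop) fun x =>
    ⟨mem_univ _, mem_univ _, (projIcc (-1 : ℝ) 1 (by norm_num) x.2.2).2⟩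

theorem extendT_of_mem (a : E d × ℝ × ℝ → ℂ) (ξ : E d) (s : ℝ) {t : ℝ} (ht : t ∈ I) :
    extendT a (ξ, s, t) = a (ξ, s, t) := by
  simp only [extendT, projIcc_of_mem _ ht]

/-- A line in the `s` direction stays in the strip even when `t` is an endpoint of `I`, so the
derivative within the strip gives a two-sided derivative in `s`. -/
theorem hasDerivAt_fderivWithin (ha : DifferentiableOn ℝ a (univ ×ˢ univ ×ˢ I)) (ξ : E d) (s : ℝ)
    {t : ℝ} (ht : t ∈ I) : HasDerivAt (fun s => a (ξ, s, t))
      (fderivWithin ℝ a (univ ×ˢ univ ×ˢ I) (ξ, s, t) (0, 1, 0)) s := by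
  have hmem : ∀ s, (ξ, s, t) ∈ (univ ×ˢ univ ×ˢ I : Set (E d × ℝ × ℝ)) := fun s =>
    ⟨mem_univ _, mem_univ _, ht⟩
  have hf : HasDerivAt (fun s : ℝ => (ξ, s, t)) ((0, 1, 0) : E d × ℝ × ℝ) s :=
    (hasDerivAt_const s ξ).prodMk ((hasDerivAt_id s).prodMk (hasDerivAt_const s t))
  exact (ha _ (hmem s)).hasFDerivWithinAt.comp_hasDerivAt s hf (.of_forall hmem)

theorem hasDerivAt_sDeriv (ha : DifferentiableOn ℝ a (univ ×ˢ univ ×ˢ I)) (ξ : E d) (s : ℝ)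
    {t : ℝ} (ht : t ∈ I) : HasDerivAt (fun s => a (ξ, s, t)) (sDeriv a (ξ, s, t)) s :=
  (hasDerivAt_fderivWithin ha ξ s ht).differentiableAt.hasDerivAt

theorem contDiffOn_sDeriv {m n : WithTop ℕ∞} (ha : ContDiffOn ℝ n a (univ ×ˢ univ ×ˢ I))
    (hmn : m + 1 ≤ n) : ContDiffOn ℝ m (sDeriv a) (univ ×ˢ univ ×ˢ I) := by
  have hn : n ≠ 0 := by
    rintro rfl
    simp at hmn
  refine ((ha.fderivWithin uniqueDiffOn_strip hmn).clm_apply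
    (contDiffOn_const (c := ((0, 1, 0) : E d × ℝ × ℝ)))).congr fun x hx => ?_
  exact (hasDerivAt_fderivWithin (ha.differentiableOn hn) x.1 x.2.1 hx.2.2).deriv

theorem hasDerivAt_extendT (ha : DifferentiableOn ℝ a (univ ×ˢ univ ×ˢ I)) (ξ : E d) (s t : ℝ) :
    HasDerivAt (fun s => extendT a (ξ, s, t)) (extendT (sDeriv a) (ξ, s, t)) s :=
  hasDerivAt_sDeriv ha ξ s (projIcc (-1 : ℝ) 1 (by norm_num) t).2

theorem iteratedDeriv_two_eq_sDeriv (a : E d × ℝ × ℝ → ℂ) (x : E d × ℝ × ℝ) :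
    iteratedDeriv 2 (fun s => a (x.1, s, x.2.2)) x.2.1 = sDeriv (sDeriv a) x := by
  rw [iteratedDeriv_succ, iteratedDeriv_one]
  rfl

namespace IsSymbolOfType

variable {C : ℝ} {K : ℕ → ℝ} {lam A : ℝ} {L : ℕ} {γ : ℝ → E d}

/-- The complement of the support is open. This upgrades bounds assumed only on the support to
bounds for all `s`, since every `s`-derivative vanishes off it. -/
theorem eventually_eq_zero (h : IsSymbolOfType C K lam A L γ a) {x : E d × ℝ × ℝ}
    (ht : x.2.2 ∈ I) (hx : x ∉ symbolSupport a) :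
    (fun s => a (x.1, s, x.2.2)) =ᶠ[nhds x.2.1] fun _ => 0 := by
  have ho : IsOpen {s : ℝ | (x.1, s, x.2.2) ∉ symbolSupport a} :=
    (isClosed_closure.isOpen_compl).preimage (by fun_prop :
      Continuous fun s : ℝ => (x.1, s, x.2.2))
  filter_upwards [ho.mem_nhds hx] with s hs
  by_cases hsI : s ∈ I
  · by_contra hne
    exact hs (subset_closure ⟨hsI, ht, hne⟩)
  · exact h.eq_zero _ _ _ ht hsI

theorem iteratedDeriv_eq_zero (h : IsSymbolOfType C K lam A L γ a) {x : E d × ℝ × ℝ}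
    (ht : x.2.2 ∈ I) (hx : x ∉ symbolSupport a) (β : ℕ) :
    iteratedDeriv β (fun s => a (x.1, s, x.2.2)) x.2.1 = 0 := by
  rw [(h.eventually_eq_zero ht hx).iteratedDeriv_eq]
  simp

theorem norm_iteratedDeriv_le (h : IsSymbolOfType C K lam A L γ a) {x : E d × ℝ × ℝ}
    (ht : x.2.2 ∈ I) {β : ℕ} (hβ : β ≤ 3 * d) :
    ‖iteratedDeriv β (fun s => a (x.1, s, x.2.2)) x.2.1‖ ≤ |K β| := by
  by_cases hx : x ∈ symbolSupport a
  · exact (h.deriv_le β hβ x hx).trans (le_abs_self _)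
  · simp [h.iteratedDeriv_eq_zero ht hx]

theorem notMem_symbolSupport {x : E d × ℝ × ℝ} (hs : x.2.1 ∉ I) : x ∉ symbolSupport a := fun hx =>
  hs (closure_minimal (t := {y : E d × ℝ × ℝ | y.2.1 ∈ I}) (fun _ hy => hy.1)
    (isClosed_Icc.preimage (by fun_prop)) hx)

/-- Symbols of type `(lam, A, L)`, extended to all `t`, are admissible amplitudes. -/
theorem admissible {B : ℝ} (hA : 0 < A) (hB : 0 < B) (hL : 1 ≤ L) (hLd : L ≤ d) (hC : 0 ≤ C)
    (hlam : 0 ≤ lam) (hγ : IsModelCurve B L γ) (h : IsSymbolOfType C K lam A L γ a) :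
    Admissible (-1) 1 L A B (|K 0| + |K 1| + |K 2|) (2 * C * lam)
      (extDeriv γ (-1) 1 (by norm_num)) (extendT a) (extendT (sDeriv a))
      (extendT (sDeriv (sDeriv a))) := by
  have hlt : (-1 : ℝ) < 1 := by norm_num
  have h2 : ContDiffOn ℝ 2 a (univ ×ˢ univ ×ˢ I) := h.contDiffOn.of_le (by
    have : 2 ≤ 3 * d := by omega
    exact_mod_cast this)
  have h1 : ContDiffOn ℝ 1 (sDeriv a) (univ ×ˢ univ ×ˢ I) :=
    contDiffOn_sDeriv h2 (by norm_num [one_add_one_eq_two])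
  have h0 : ContDiffOn ℝ 0 (sDeriv (sDeriv a)) (univ ×ˢ univ ×ˢ I) :=
    contDiffOn_sDeriv h1 (by norm_num)
  have hmem : ∀ t : ℝ, (projIcc (-1 : ℝ) 1 hlt.le t : ℝ) ∈ I := fun t =>
    (projIcc (-1 : ℝ) 1 hlt.le t).2
  have c0 := continuous_extendT h2.continuousOn
  have c1 := continuous_extendT h1.continuousOn
  have c2 := continuous_extendT h0.continuousOn
  have hz0 : ∀ ξ s t, (ξ, s, (projIcc (-1 : ℝ) 1 hlt.le t : ℝ)) ∉ symbolSupport a →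
      extendT a (ξ, s, t) = 0 := fun ξ s t hx => by
    have := h.iteratedDeriv_eq_zero (hmem t) hx 0
    rwa [iteratedDeriv_zero] at this
  have hz1 : ∀ ξ s t, (ξ, s, (projIcc (-1 : ℝ) 1 hlt.le t : ℝ)) ∉ symbolSupport a →
      extendT (sDeriv a) (ξ, s, t) = 0 := fun ξ s t hx => by
    have := h.iteratedDeriv_eq_zero (hmem t) hx 1
    rwa [iteratedDeriv_one] at this
  have hz2 : ∀ ξ s t, (ξ, s, (projIcc (-1 : ℝ) 1 hlt.le t : ℝ)) ∉ symbolSupport a →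
      extendT (sDeriv (sDeriv a)) (ξ, s, t) = 0 := fun ξ s t hx => by
    have := h.iteratedDeriv_eq_zero (hmem t) hx 2
    rwa [iteratedDeriv_two_eq_sDeriv] at this
  exact
  { le := hlt.le
    one_le := hL
    A_pos := hA
    B_pos := hB
    K_nonneg := by positivity
    R_nonneg := by positivity
    γ_continuous := fun k hk => continuous_extDeriv hlt hγ.contDiffOn (by
      have : k ≤ 2 * d := by omega
      exact_mod_cast this)
    γ_hasDerivAt := fun k hk s hs => hasDerivAt_extDeriv hlt hγ.contDiffOn (by
      have : k < 2 * d := by omega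
      exact_mod_cast this) hs
    γ_norm_le := fun k _ hk s _ => hγ.norm_le k (by omega) _ (hmem s)
    continuous := c0
    continuous₁ := c1
    continuous₂ := c2
    hasDerivAt := hasDerivAt_extendT (h2.differentiableOn (by norm_num))
    hasDerivAt₁ := hasDerivAt_extendT (h1.differentiableOn (by norm_num))
    norm_le := fun x => by
      have := h.norm_iteratedDeriv_le (x := (x.1, x.2.1, _)) (hmem x.2.2) (β := 0) (by omega)
      rw [iteratedDeriv_zero] at this
      exact this.trans (by linarith [abs_nonneg (K 1), abs_nonneg (K 2)])
    norm_le₁ := fun x => by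
      have := h.norm_iteratedDeriv_le (x := (x.1, x.2.1, _)) (hmem x.2.2) (β := 1) (by omega)
      rw [iteratedDeriv_one] at this
      exact this.trans (by linarith [abs_nonneg (K 0), abs_nonneg (K 2)])
    norm_le₂ := fun x => by
      have := h.norm_iteratedDeriv_le (x := (x.1, x.2.1, _)) (hmem x.2.2) (β := 2) (by omega)
      rw [iteratedDeriv_two_eq_sDeriv] at this
      exact this.trans (by linarith [abs_nonneg (K 1), abs_nonneg (K 0)])
    zero := fun ξ s t hs => eq_zero_of_notMem_Ioo (f := fun s => extendT a (ξ, s, t))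
      (c0.comp (by fun_prop)) (fun r hr => hz0 _ _ _ (notMem_symbolSupport hr)) hs
    zero₁ := fun ξ s t hs => eq_zero_of_notMem_Ioo (f := fun s => extendT (sDeriv a) (ξ, s, t))
      (c1.comp (by fun_prop)) (fun r hr => hz1 _ _ _ (notMem_symbolSupport hr)) hs
    zero₂ := fun ξ s t hs => eq_zero_of_notMem_Ioo
      (f := fun s => extendT (sDeriv (sDeriv a)) (ξ, s, t))
      (c2.comp (by fun_prop)) (fun r hr => hz2 _ _ _ (notMem_symbolSupport hr)) hs
    freq := fun ξ s t hR => hz0 _ _ _ fun hx => (h.freq_supp _ hx).2.not_gt hR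
    -- A nonzero `a` or `a₁` forces the point into the closed support, where the type condition
    -- holds.
    nondeg := fun ξ s t hs hne => by
      have hx : (ξ, s, (projIcc (-1 : ℝ) 1 hlt.le t : ℝ)) ∈ symbolSupport a := by
        by_contra hx
        exact hne.elim (· (hz0 _ _ _ hx)) (· (hz1 _ _ _ hx))
      simp only [extDeriv_of_mem γ _ _ hs]
      exact (h.nondeg _ hx).1 }

end IsSymbolOfType

/-- The half derivative bound for symbols of type `(lam, A, L)`. -/
theorem exists_halfAvgNormLE_of_isSymbolOfType (d : ℕ) {C : ℝ} (K : ℕ → ℝ) (hC : 0 ≤ C) {A B : ℝ}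
    (hA : 0 < A) (hB : 0 < B) : ∃ M : ℝ, ∀ L : ℕ, 1 ≤ L → L ≤ d → ∀ lam : ℝ, 2 ≤ lam →
      ∀ γ : ℝ → E d, IsModelCurve B L γ → ∀ a : E d × ℝ × ℝ → ℂ,
        IsSymbolOfType C K lam A L γ a →
          HalfAvgNormLE a γ (M * Real.log lam ^ (((L : ℝ) - 1) / 2)) := by
  have hT : (0 : ℝ) ≤ ((2 * Real.pi) ^ d) ^ 2 := by positivity
  choose! M hM0 hM using fun L hL => Admissible.exists_const (ℓ := 1 - (-1)) (by norm_num) hA hB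
    (|K 0| + |K 1| + |K 2|) hT (mul_nonneg zero_le_two hC : 0 ≤ 2 * C) L hL
  -- Summing over the finitely many values of `L` makes the constant independent of `L`.
  refine ⟨∑ L ∈ Finset.Icc 1 d, M L, fun L hL hLd lam hlam γ hγ a ha => ?_⟩
  have hlog : 0 ≤ Real.log lam := Real.log_nonneg (by linarith)
  obtain ⟨m₀, hm₀, hle⟩ := hM L hL lam (2 * C * lam) hlam le_rfl
  have H := (ha.admissible hA hB hL hLd hC (by linarith) hγ).halfAvgNormLE (hL.trans hLd) hm₀
    (mul_nonneg (hM0 L hL) (Real.rpow_nonneg hlog _)) hle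
  refine H.congr ?_ (fun ξ s t ht => extendT_of_mem a ξ s ht) fun s => ?_
  · gcongr
    exact Finset.single_le_sum (f := M) (fun i hi => hM0 i (Finset.mem_Icc.1 hi).1)
      (Finset.mem_Icc.2 ⟨hL, hLd⟩)
  · by_cases hs : s ∈ I
    · left
      rw [extDeriv_of_mem _ _ _ hs, iteratedDerivWithin_zero]
    · right
      intro ξ t ht
      rw [extendT_of_mem a ξ s ht]
      exact ha.eq_zero ξ s t ht hs

end Symbol

/-! ### Dyadic pieces of the averaging operator -/

section Dyadic

variable {d : ℕ}

/-- The symbol `ψ(δ|ξ|) ζ(s) χ(t) η(|ξ|)` for `lam = 0` and `ψ(δ|ξ|) ζ(s) χ(t) β(|ξ|/lam)` for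
`lam ≠ 0`. -/
def cutoffSymbol (ψ : ℝ → ℂ) (χ η β : ℝ → ℝ) (δ lam : ℝ) (ζ : ℝ → ℝ) (x : E d × ℝ × ℝ) : ℂ :=
  ψ (δ * ‖x.1‖) * ζ x.2.1 * χ x.2.2 *
    (if lam = 0 then (η ‖x.1‖ : ℂ) else (β (‖x.1‖ / lam) : ℂ))

variable {ψ : ℝ → ℂ} {χ η β : ℝ → ℝ} {δ lam : ℝ}

theorem continuous_cutoffSymbol (hψ : Continuous ψ) (hχ : Continuous χ) (hη : Continuous η)
    (hβ : Continuous β) {ζ : ℝ → ℝ} (hζ : Continuous ζ) :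
    Continuous (cutoffSymbol (d := d) ψ χ η β δ lam ζ) := by
  unfold cutoffSymbol
  split_ifs <;> fun_prop

theorem norm_cutoffSymbol_le {Kψ Kχ Kη Kβ Kζ : ℝ} {ζ : ℝ → ℝ} (hψ : ∀ r, ‖ψ r‖ ≤ Kψ)
    (hχ : ∀ r, ‖χ r‖ ≤ Kχ) (hη : ∀ r, ‖η r‖ ≤ Kη) (hβ : ∀ r, ‖β r‖ ≤ Kβ) (hζ : ∀ r, ‖ζ r‖ ≤ Kζ)
    (x : E d × ℝ × ℝ) :
    ‖cutoffSymbol ψ χ η β δ lam ζ x‖ ≤ Kψ * Kζ * Kχ * (Kη + Kβ) := by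
  have h0 : ∀ {F : Type} [SeminormedAddCommGroup F] {f : ℝ → F} {c : ℝ}, (∀ r, ‖f r‖ ≤ c) → 0 ≤ c :=
    fun h => (norm_nonneg _).trans (h 0)
  have hη0 := h0 hη
  have hβ0 := h0 hβ
  have hψ0 := h0 hψ
  have hχ0 := h0 hχ
  have hζ0 := h0 hζ
  unfold cutoffSymbol
  rw [norm_mul, norm_mul, norm_mul, Complex.norm_real, Complex.norm_real]
  have h1 : ‖(if lam = 0 then (η ‖x.1‖ : ℂ) else (β (‖x.1‖ / lam) : ℂ))‖ ≤ Kη + Kβ := by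
    split_ifs
    · rw [Complex.norm_real]; linarith [hη ‖x.1‖]
    · rw [Complex.norm_real]; linarith [hβ (‖x.1‖ / lam)]
  gcongr
  exacts [hψ _, hζ _, hχ _]

theorem hasDerivAt_cutoffSymbol {ζ ζ' : ℝ → ℝ} (hζ : ∀ s, HasDerivAt ζ (ζ' s) s) (ξ : E d)
    (s t : ℝ) : HasDerivAt (fun s => cutoffSymbol ψ χ η β δ lam ζ (ξ, s, t))
      (cutoffSymbol ψ χ η β δ lam ζ' (ξ, s, t)) s := by
  have h : HasDerivAt (fun s => (ζ s : ℂ)) (ζ' s) s := (hζ s).ofReal_comp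
  simp only [cutoffSymbol]
  generalize (if lam = 0 then (η ‖ξ‖ : ℂ) else (β (‖ξ‖ / lam) : ℂ)) = c
  exact ((h.const_mul _).mul_const _).mul_const c

theorem cutoffSymbol_eq_zero {ζ : ℝ → ℝ} {s : ℝ} (h : ζ s = 0) (ξ : E d) (t : ℝ) :
    cutoffSymbol ψ χ η β δ lam ζ (ξ, s, t) = 0 := by
  simp [cutoffSymbol, h]

theorem cutoffSymbol_eq_zero_of_lt (hη : tsupport η ⊆ {r | |r| ≤ 2})
    (hβ : tsupport β ⊆ {r | 1 / 2 ≤ |r| ∧ |r| ≤ 2}) (hlam : 0 ≤ lam) (ζ : ℝ → ℝ) (ξ : E d)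
    (s t : ℝ) (hξ : 2 + 2 * lam < ‖ξ‖) : cutoffSymbol ψ χ η β δ lam ζ (ξ, s, t) = 0 := by
  unfold cutoffSymbol
  split_ifs with h
  · have : η ‖ξ‖ = 0 := image_eq_zero_of_notMem_tsupport fun hm => by
      have h2 : |‖ξ‖| ≤ 2 := hη hm
      rw [abs_norm] at h2
      linarith
    simp [this]
  · have hpos : 0 < lam := lt_of_le_of_ne hlam (Ne.symm h)
    have : β (‖ξ‖ / lam) = 0 := image_eq_zero_of_notMem_tsupport fun hm => by
      have h2 : |‖ξ‖ / lam| ≤ 2 := (hβ hm).2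
      rw [abs_of_nonneg (by positivity), div_le_iff₀ hpos] at h2
      linarith
    simp [this]

/-- If the sum vanished, `ξ` would be orthogonal to `d` linearly independent vectors. -/
theorem sum_abs_inner_pos {v : ℕ → E d} (hv : (Matrix.of fun i j : Fin d => v (j + 1) i).det ≠ 0)
    {ξ : E d} (hξ : ξ ≠ 0) : 0 < ∑ i ∈ Finset.Icc 1 d, |inner ℝ (v i) ξ| := by
  refine lt_of_le_of_ne (Finset.sum_nonneg fun _ _ => abs_nonneg _) fun h => hξ ?_
  have h0 := (Finset.sum_eq_zero_iff_of_nonneg fun _ _ => abs_nonneg _).1 h.symm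
  have hvec := Matrix.eq_zero_of_vecMul_eq_zero hv (v := fun i => ξ i) (by
    ext j
    have := abs_eq_zero.1 (h0 (j + 1) (Finset.mem_Icc.2 ⟨by omega, j.2⟩))
    rw [PiLp.inner_apply] at this
    simpa [Matrix.vecMul, dotProduct] using this)
  ext i
  exact congrFun hvec i

/-- A curve with nonvanishing torsion is uniformly nondegenerate. -/
theorem exists_nondeg {γ : ℕ → ℝ → E d} {p q : ℝ} (hc : ∀ k, 1 ≤ k → k ≤ d → Continuous (γ k))
    (hdet : ∀ s ∈ Icc p q, (Matrix.of fun i j : Fin d => γ (j + 1) s i).det ≠ 0) :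
    ∃ A : ℝ, 0 < A ∧ ∀ (ξ : E d), ∀ s ∈ Icc p q,
      A⁻¹ * ‖ξ‖ ≤ ∑ i ∈ Finset.Icc 1 d, |inner ℝ (γ i s) ξ| := by
  have hcont : Continuous fun z : ℝ × E d => ∑ i ∈ Finset.Icc 1 d, |inner ℝ (γ i z.1) z.2| := by
    refine continuous_finsetSum _ fun i hi => ?_
    have := hc i (Finset.mem_Icc.1 hi).1 (Finset.mem_Icc.1 hi).2
    fun_prop
  -- Compactness of `[p, q]` times the unit sphere gives a positive lower bound; homogeneity in `ξ`
  -- then removes the normalization.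
  obtain ⟨c, hc0, hle⟩ := (isCompact_Icc.prod
    (isCompact_sphere (0 : E d) 1)).exists_forall_le' (s := Icc p q ×ˢ Metric.sphere (0 : E d) 1)
    hcont.continuousOn (a := 0)
    fun z hz => sum_abs_inner_pos (v := fun i => γ i z.1) (hdet z.1 hz.1) fun h0 => by
      have := hz.2
      simp [h0] at this
  refine ⟨c⁻¹, inv_pos.2 hc0, fun ξ s hs => ?_⟩
  rw [inv_inv]
  rcases eq_or_ne ξ 0 with rfl | hξ
  · simp
  have hn : 0 < ‖ξ‖ := norm_pos_iff.2 hξ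
  have h1 := hle (s, ‖ξ‖⁻¹ • ξ) ⟨hs, by simp [norm_smul, hn.ne']⟩
  simp only [inner_smul_right, abs_mul, abs_inv, abs_norm, ← Finset.mul_sum] at h1
  rwa [le_inv_mul_iff₀ hn, mul_comm] at h1

theorem exists_norm_le {γ : ℕ → ℝ → E d} {p q : ℝ} {n : ℕ} (hc : ∀ k ≤ n, Continuous (γ k)) :
    ∃ B : ℝ, 0 < B ∧ ∀ k ≤ n, ∀ s ∈ Icc p q, ‖γ k s‖ ≤ B := by
  choose! b hb using fun k (hk : k ≤ n) =>
    isCompact_Icc.exists_bound_of_continuousOn (s := Icc p q) (hc k hk).continuousOn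
  refine ⟨∑ k ∈ Finset.range (n + 1), |b k| + 1, by positivity, fun k hk s hs => ?_⟩
  have := Finset.single_le_sum (f := fun k => |b k|) (fun _ _ => abs_nonneg _)
    (Finset.mem_range.2 (Nat.lt_succ_of_le hk))
  linarith [hb k hk s hs, le_abs_self (b k)]

/-- The half derivative bound for the dyadic pieces of the averaging operator. -/
theorem exists_halfAvgNormLE_dyadicSymbol (hd : 1 ≤ d) {γ : ℝ → E d}
    (hγ : ContDiffOn ℝ ∞ γ (Icc (-2) 2))
    (hdet : ∀ s ∈ Icc (-2 : ℝ) 2, (Matrix.of fun i j : Fin d =>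
      iteratedDerivWithin ((j : ℕ) + 1) γ (Icc (-2) 2) s i).det ≠ 0)
    (hψ : ContDiff ℝ ∞ ψ) (hψs : tsupport ψ ⊆ Icc (-1) 1) (hχ : ContDiff ℝ ∞ χ)
    (hχs : ∀ r ∉ Icc (-2 : ℝ) 2, χ r = 0) (hη : ContDiff ℝ ∞ η)
    (hηs : tsupport η ⊆ {r | |r| ≤ 2}) (hβ : ContDiff ℝ ∞ β)
    (hβs : tsupport β ⊆ {r | 1 / 2 ≤ |r| ∧ |r| ≤ 2}) :
    ∃ M : ℝ, ∀ lam : ℝ, 0 ≤ lam → ∀ δ : ℝ,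
      HalfAvgNormLE (dyadicSymbol (d := d) ψ χ η β δ lam) γ
        (M * Real.log (2 + lam) ^ (((d : ℝ) - 1) / 2)) := by
  have hlt : (-2 : ℝ) < 2 := by norm_num
  have hγc : ∀ k, Continuous (extDeriv γ (-2) 2 hlt.le k) := fun k =>
    continuous_extDeriv hlt hγ (by exact_mod_cast le_top)
  obtain ⟨A, hA, hnondeg⟩ := exists_nondeg (p := -2) (q := 2) (fun k _ _ => hγc k)
    fun s hs => by simpa only [extDeriv_of_mem _ _ _ hs] using hdet s hs
  obtain ⟨B, hB, hγB⟩ := exists_norm_le (p := -2) (q := 2) (n := d + 1) fun k _ => hγc k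
  have hχt : tsupport χ ⊆ Icc (-2) 2 :=
    closure_minimal (fun r hr => by_contra fun h => hr (hχs r h)) isClosed_Icc
  have hχ1 : ContDiff ℝ ∞ (deriv χ) := hχ.deriv'
  have hχ2 : ContDiff ℝ ∞ (deriv (deriv χ)) := hχ1.deriv'
  have hχt1 : tsupport (deriv χ) ⊆ Icc (-2) 2 := tsupport_deriv_subset.trans hχt
  have hχt2 : tsupport (deriv (deriv χ)) ⊆ Icc (-2) 2 := tsupport_deriv_subset.trans hχt1
  have hIcc : {r : ℝ | |r| ≤ 2} = Icc (-2) 2 := by ext r; simp [abs_le]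
  have bd : ∀ {F : Type} [NormedAddCommGroup F] {f : ℝ → F} {p q : ℝ}, Continuous f →
      tsupport f ⊆ Icc p q → ∃ c, ∀ r, ‖f r‖ ≤ c := fun hf hs =>
    HasCompactSupport.exists_bound_of_continuous
      (isCompact_Icc.of_isClosed_subset (isClosed_tsupport _) hs) hf
  obtain ⟨Kψ, hKψ⟩ := bd hψ.continuous hψs
  obtain ⟨Kη, hKη⟩ := bd hη.continuous (hηs.trans hIcc.subset)
  obtain ⟨Kβ, hKβ⟩ := bd hβ.continuous fun r hr => hIcc.subset (hβs hr).2
  obtain ⟨K0, hK0⟩ := bd hχ.continuous hχt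
  obtain ⟨K1, hK1⟩ := bd hχ1.continuous hχt1
  obtain ⟨K2, hK2⟩ := bd hχ2.continuous hχt2
  have hK0' := (norm_nonneg _).trans (hK0 0)
  have hK1' := (norm_nonneg _).trans (hK1 0)
  have hK2' := (norm_nonneg _).trans (hK2 0)
  have hKη' := (norm_nonneg _).trans (hKη 0)
  have hKβ' := (norm_nonneg _).trans (hKβ 0)
  have hKψ' := (norm_nonneg _).trans (hKψ 0)
  -- The derivatives in `s` fall only on the cutoff `χ(s)`, and `ψ` enters only through its
  -- supremum; hence the bound is uniform in `δ` and `lam`.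
  set K := Kψ * (K0 + K1 + K2) * K0 * (Kη + Kβ)
  have hT : (0 : ℝ) ≤ ((2 * Real.pi) ^ d) ^ 2 := by positivity
  obtain ⟨M, hM0, hM⟩ := Admissible.exists_const (ℓ := 2 - (-2)) (by norm_num) hA hB K hT
    zero_le_two d hd
  refine ⟨M, fun lam hlam δ => ?_⟩
  -- The radius `2 + 2 lam` covers both the case `lam = 0`, with frequencies up to `2`, and the
  -- dyadic case, with frequencies up to `2 lam`.
  obtain ⟨m₀, hm₀, hle⟩ := hM (2 + lam) (2 + 2 * lam) (by linarith) (by linarith)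
  have hcut : ∀ {ζ : ℝ → ℝ}, Continuous ζ →
      Continuous (cutoffSymbol (d := d) ψ χ η β δ lam ζ) :=
    continuous_cutoffSymbol hψ.continuous hχ.continuous hη.continuous hβ.continuous
  have hzero : ∀ {ζ : ℝ → ℝ}, Continuous ζ → tsupport ζ ⊆ Icc (-2) 2 → ∀ (ξ : E d) s t,
      s ∉ Ioo (-2 : ℝ) 2 → cutoffSymbol ψ χ η β δ lam ζ (ξ, s, t) = 0 := fun hζ hs ξ s t hsn =>
    cutoffSymbol_eq_zero (eq_zero_of_notMem_Ioo hζ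
      (fun r hr => image_eq_zero_of_notMem_tsupport fun h => hr (hs h)) hsn) ξ t
  have hbound : ∀ {ζ : ℝ → ℝ}, (∀ r, ‖ζ r‖ ≤ K0 + K1 + K2) → ∀ x : E d × ℝ × ℝ,
      ‖cutoffSymbol ψ χ η β δ lam ζ x‖ ≤ K := norm_cutoffSymbol_le hKψ hK0 hKη hKβ
  have hadm : Admissible (-2) 2 d A B K (2 + 2 * lam) (extDeriv γ (-2) 2 hlt.le)
      (cutoffSymbol ψ χ η β δ lam χ) (cutoffSymbol ψ χ η β δ lam (deriv χ))
      (cutoffSymbol ψ χ η β δ lam (deriv (deriv χ))) :=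
    { le := hlt.le
      one_le := hd
      A_pos := hA
      B_pos := hB
      K_nonneg := by positivity
      R_nonneg := by positivity
      γ_continuous := fun k _ => hγc k
      γ_hasDerivAt := fun k _ s hs => hasDerivAt_extDeriv hlt hγ
        (by exact_mod_cast ENat.natCast_lt_top k) hs
      γ_norm_le := fun k _ hk s hs => hγB k hk s hs
      continuous := hcut hχ.continuous
      continuous₁ := hcut hχ1.continuous
      continuous₂ := hcut hχ2.continuous
      hasDerivAt := hasDerivAt_cutoffSymbol fun s =>
        (hχ.differentiable (by norm_num) s).hasDerivAt
      hasDerivAt₁ := hasDerivAt_cutoffSymbol fun s =>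
        (hχ1.differentiable (by norm_num) s).hasDerivAt
      norm_le := hbound fun r => (hK0 r).trans (by linarith)
      norm_le₁ := hbound fun r => (hK1 r).trans (by linarith)
      norm_le₂ := hbound fun r => (hK2 r).trans (by linarith)
      zero := hzero hχ.continuous hχt
      zero₁ := hzero hχ1.continuous hχt1
      zero₂ := hzero hχ2.continuous hχt2
      freq := cutoffSymbol_eq_zero_of_lt hηs hβs hlam χ
      nondeg := fun ξ s _ hs _ => hnondeg ξ s hs }
  have hlog : 0 ≤ Real.log (2 + lam) := Real.log_nonneg (by linarith)
  refine (hadm.halfAvgNormLE hd hm₀ (mul_nonneg hM0 (Real.rpow_nonneg hlog _)) hle).congr le_rfl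
    (fun ξ s t _ => rfl) fun s => ?_
  by_cases hs : s ∈ Icc (-2 : ℝ) 2
  · left
    rw [extDeriv_of_mem _ _ _ hs, iteratedDerivWithin_zero]
  · exact Or.inr fun ξ t _ => cutoffSymbol_eq_zero (hχs s hs) ξ t

end Dyadic

end NikodymFIO

end

theorem proposition3 (d : ℕ) :
    -- the bound for symbols of type `(lam, A, L)`; `C A B` and `K β A` are the constants
    -- allowed in the definition of the type
    (∀ (C : ℝ → ℝ → ℝ) (K : ℕ → ℝ → ℝ), (∀ A B, 1 < C A B) →
      ∀ A B : ℝ, 0 < A → 0 < B →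
      ∃ M : ℝ, ∀ L : ℕ, 1 ≤ L → L ≤ d →
        ∀ lam : ℝ, 2 ≤ lam →
        ∀ γ : ℝ → NikodymFIO.E d, NikodymFIO.IsModelCurve B L γ →
        ∀ a : NikodymFIO.E d × ℝ × ℝ → ℂ, NikodymFIO.IsSymbolOfType (C A B) (fun β => K β A) lam A L γ a →
          NikodymFIO.HalfAvgNormLE a γ (M * Real.log lam ^ (((L : ℝ) - 1) / 2))) ∧
    -- the special case of the dyadic pieces of the symbol of the averaging operator
    (1 ≤ d →
      ∀ γ : ℝ → NikodymFIO.E d, ContDiffOn ℝ ∞ γ (Set.Icc (-2) 2) →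
      (∀ s ∈ Set.Icc (-2 : ℝ) 2, (Matrix.of fun i j : Fin d =>
        iteratedDerivWithin ((j : ℕ) + 1) γ (Set.Icc (-2) 2) s i).det ≠ 0) →
      ∀ (ψ : ℝ → ℂ) (χ η β : ℝ → ℝ),
        ContDiff ℝ ∞ ψ → tsupport ψ ⊆ Set.Icc (-1) 1 →
        ContDiff ℝ ∞ χ → (∀ r, 0 ≤ χ r) → (∀ r ∈ Set.Icc (-1 : ℝ) 1, χ r = 1) →
        (∀ r ∉ Set.Icc (-2 : ℝ) 2, χ r = 0) →
        ContDiff ℝ ∞ η → tsupport η ⊆ {r | |r| ≤ 2} →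
        ContDiff ℝ ∞ β → tsupport β ⊆ {r | 1 / 2 ≤ |r| ∧ |r| ≤ 2} →
      ∃ M : ℝ, ∀ lam : ℝ, (lam = 0 ∨ ∃ k : ℕ, 1 ≤ k ∧ lam = 2 ^ k) →
        ∀ δ : ℝ, 0 < δ → δ < 1 →
          NikodymFIO.HalfAvgNormLE (NikodymFIO.dyadicSymbol (d := d) ψ χ η β δ lam) γ
            (M * Real.log (2 + lam) ^ (((d : ℝ) - 1) / 2))) := by
  refine ⟨fun C K hC A B hA hB =>
    NikodymFIO.exists_halfAvgNormLE_of_isSymbolOfType d (fun β => K β A)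
      (zero_le_one.trans (hC A B).le) hA hB, ?_⟩
  intro hd γ hγ hdet ψ χ η β hψ hψs hχ _ _ hχs hη hηs hβ hβs
  obtain ⟨M, hM⟩ := NikodymFIO.exists_halfAvgNormLE_dyadicSymbol hd hγ hdet hψ hψs hχ hχs hη hηs
    hβ hβs
  refine ⟨M, fun lam hlam δ _ _ => hM lam ?_ δ⟩
  rcases hlam with rfl | ⟨k, _, rfl⟩
  · exact le_rfl
  · positivity
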